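/- **Proposition.** Let $\mathcal H$ be a complex Hilbert space with a unit vector $\xi$, let $X\in B(\mathcal H)$ be self-adjoint, put $\mathcal H^\circ=\mathcal H\ominus\mathbb C\xi$, and write $X$ with respect to $\mathcal H=\mathbb C\xi\oplus\mathcal H^\circ$ as $$X=\begin{bmatrix}\alpha & h^*\\ h& S\end{bmatrix},\qquad \alpha\in\mathbb C,\ h\in\mathcal H^\circ,\ S\in B(\mathcal H^\circ).$$ Let $(\Omega,\rho)$ be a $\sigma$-finite measure space, let $w\in L^\infty(\Omega\times\Omega)$ with $w\ge 0$, and let $A\subseteq\Omega$ be measurable with $\rho(A)<\infty$. Let $$\mathcal F=\mathcal F(\Omega,\rho,w,\mathcal H^\circ)=\bigoplus_{k\ge 0}L^2(\Omega^{k},\rho_k;(\mathcal H^\circ)^{\otimes k}),\qquad d\rho_k(\omega_1,\dots,\omega_k)=w(\omega_k,\omega_{k-1})\cdots w(\omega_2,\omega_1)\,d\rho^{\times k}(\omega_1,\dots,\omega_k),$$ where $\rho_1=\rho$ and the summand $k=0$ is $\mathbb C$, whose vector $1$ is denoted $\xi_{\mathcal F}$. On $\mathcal F$ consider the bounded operators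 determined as follows, where $f$ is in the $k$-th summand: * for $g\in L^2(\Omega,\rho;\mathcal H^\circ)$, $[\ell(g)f](\omega_1,\dots,\omega_{k+1})=g(\omega_1)\otimes f(\omega_2,\dots,\omega_{k+1})$, for $k\ge 0$; * for $T\in L^\infty(\Omega,B(\mathcal H^\circ))$, $\mathfrak m(T)|_{\mathbb C}=0$ and $[\mathfrak m(T)f](\omega_1,\dots,\omega_k)=(T(\omega_1)\otimes\mathrm{id})f(\omega_1,\dots,\omega_k)$ for $k\ge1$; * for $\phi\in L^1(\Omega,\rho)$, $\mathfrak n(\phi)|_{\mathbb C}=\int_\Omega\phi\,d\rho$ and $[\mathfrak n(\phi)f](\omega_1,\dots,\omega_k)=\big(\int_\Omega\phi(\omega)w(\omega_1,\omega)\,d\rho(\omega)\big)f(\omega_1,\dots,\omega_k)$ for $k\ge1$. Let $$\widehat X=\alpha\,\mathfrak n(\mathbf 1_A)+\ell(\mathbf 1_Ah)+\ell(\mathbf 1_Ah)^*+\mathfrak m(\mathbf 1_AS).$$ Then $\widehat X$ is self-adjoint. Let $\mu$ and $\widehat\mu$ be the spectral distributions of $X$ and $\widehat X$ with respect to the vector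 states of $\xi$ and $\xi_{\mathcal F}$, respectively. Then for every integer $k\ge 0$ the $k$-th moment of $\widehat\mu$ is $$m_k(\widehat\mu)=\sum_{\pi\in\mathcal{NC}_k}\kappa_{\mathrm{bool},\pi}(\mu)\int_{A^{\pi}}\ \prod_{\substack{B\in\pi\\ \operatorname{depth}(B)>1}}w(\omega_{\operatorname{pred}(B)},\omega_B)\ \prod_{B\in\pi}d\rho(\omega_B),$$ where all the integrals converge. Here $\mathcal{NC}_k$ is the set of non-crossing partitions of $\{1,\dots,k\}$. A block $B'$ is nested inside a block $B$, written $B\prec B'$, if there are $i<j$ in $B$ with $B'\subseteq\{i+1,\dots,j-1\}\subseteq\{1,\dots,k\}\setminus B$. For $\pi\in\mathcal{NC}_k$ the covering relation of $\prec$ makes $\pi$ a rooted forest; $\operatorname{depth}(B)$ is the depth of $B$ in it (roots have depth $1$), and $\operatorname{pred}(B)$ is the predecessor of a block $B$ of depth greater than $1$. Moreover $\kappa_{\mathrm{bool},\pi}(\mu)=\prod_{B\in\pi}\kappa_{\mathrm{bool},|B|}(\mu)$, with the boolean cumulants $\kappa_{\mathrm{bool},n}(\mu)=\sum_{\sigma}(-1)^{|\sigma|-1}\prod_{B\in\sigma}m_{|B|}(\mu)$,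 the sum being over the partitions $\sigma$ of $\{1,\dots,n\}$ into intervals. -/

import Mathlib

open MeasureTheory UniformSpace
open scoped ENNReal NNReal TensorProduct InnerProductSpace CompactlySupported

noncomputable section

namespace FockModel

section SpectralDistribution

variable {H : Type*} [NormedAddCommGroup H] [InnerProductSpace ℂ H] [CompleteSpace H]

/-- The positive functional `f ↦ ⟨ξ, f(X) ξ⟩` on compactly supported continuous functions
`f : ℝ → ℝ`, where `f(X)` is the continuous functional calculus of the bounded operator `X`. -/
def spectralFunctional (X : H →L[ℂ] H) (ξ : H) : C_c(ℝ, ℝ) →ₚ[ℝ] ℝ :=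
  PositiveLinearMap.mk₀
    { toFun := fun f => (⟪ξ, cfc (fun x => f x) X ξ⟫_ℂ).re
      map_add' := fun f g => by
        have h := cfc_add (a := X) (fun x => f x) (fun x => g x)
          (map_continuous f).continuousOn (map_continuous g).continuousOn
        simp only [CompactlySupportedContinuousMap.coe_add, Pi.add_apply, h,
          _root_.add_apply, inner_add_right, Complex.add_re]
      map_smul' := fun c f => by
        have h := cfc_smul c (fun x => f x) X (map_continuous f).continuousOn
        simp only [CompactlySupportedContinuousMap.coe_smul, Pi.smul_apply, h,
          _root_.smul_apply, RingHom.id_apply]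
        rw [← Complex.coe_smul, inner_smul_right, Complex.re_ofReal_mul, smul_eq_mul] }
    (fun f hf => by
      have h : (0 : H →L[ℂ] H) ≤ cfc (fun x => f x) X := cfc_nonneg fun x _ => hf x
      have h2 := ((ContinuousLinearMap.nonneg_iff_isPositive _).1 h).inner_nonneg_right ξ
      exact (Complex.le_def.1 h2).1)

/-- The spectral distribution of a self-adjoint bounded operator `X` with respect to the vector
state of `ξ`: the Borel measure `μ` on `ℝ` representing `f ↦ ⟨ξ, f(X) ξ⟩`. -/
def spectralDistribution (X : H →L[ℂ] H) (ξ : H) : Measure ℝ :=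
  RealRMK.rieszMeasure (spectralFunctional X ξ)

end SpectralDistribution

section TensorPower

universe u

/-- A Hilbert space, bundled with its underlying type. -/
structure HilbertObj : Type (u + 1) where
  carrier : Type u
  [normed : NormedAddCommGroup carrier]
  [inner : InnerProductSpace ℂ carrier]
  [complete : CompleteSpace carrier]

/-- The one-dimensional Hilbert space `ℂ`, lifted to the universe `u`. -/
def HilbertObj.scalar : HilbertObj.{u} where
  carrier := ULift.{u} ℂ
  inner :=
    { inner := fun x y => ⟪x.down, y.down⟫_ℂ
      norm_sq_eq_re_inner := fun x => norm_sq_eq_re_inner (𝕜 := ℂ) x.down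
      conj_inner_symm := fun x y => inner_conj_symm x.down y.down
      add_left := fun x y z => inner_add_left x.down y.down z.down
      smul_left := fun x y r => inner_smul_left x.down y.down r }

variable (H : Type u) [NormedAddCommGroup H] [InnerProductSpace ℂ H]

/-- The Hilbert space tensor power `H^{⊗k}`, by recursion: `H^{⊗0} = ℂ`, and `H^{⊗(k+1)}` is the
completion of the algebraic tensor product `H ⊗ H^{⊗k}`, with `⟨a ⊗ b, c ⊗ d⟩ = ⟨a, c⟩⟨b, d⟩`. -/
def tensorPowerObj : ℕ → HilbertObj.{u}
  | 0 => HilbertObj.scalar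
  | k + 1 =>
    letI := (tensorPowerObj k).normed
    letI := (tensorPowerObj k).inner
    { carrier := Completion (H ⊗[ℂ] (tensorPowerObj k).carrier) }

/-- The underlying type of the Hilbert space `H^{⊗k}`. -/
def TensorPower (k : ℕ) : Type u := (tensorPowerObj H k).carrier

instance (k : ℕ) : NormedAddCommGroup (TensorPower H k) := (tensorPowerObj H k).normed

instance (k : ℕ) : InnerProductSpace ℂ (TensorPower H k) := (tensorPowerObj H k).inner

instance (k : ℕ) : CompleteSpace (TensorPower H k) := (tensorPowerObj H k).complete

/-- The identification of `H^{⊗0}` with `ℂ`. -/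
def TensorPower.ofScalar (c : ℂ) : TensorPower H 0 := (ULift.up c : ULift.{u} ℂ)

variable {H}

/-- The inclusion of the algebraic tensor product `H ⊗ H^{⊗k}` in `H^{⊗(k+1)}`. -/
def TensorPower.ofTensor {k : ℕ} (t : H ⊗[ℂ] TensorPower H k) : TensorPower H (k + 1) :=
  (t : Completion (H ⊗[ℂ] TensorPower H k))

/-- The elementary tensor `x ⊗ v` in `H^{⊗(k+1)}`, for `x` in `H` and `v` in `H^{⊗k}`. -/
def TensorPower.tmul {k : ℕ} (x : H) (v : TensorPower H k) : TensorPower H (k + 1) :=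
  TensorPower.ofTensor (x ⊗ₜ[ℂ] v)

theorem TensorPower.ofTensor_add {k : ℕ} (s t : H ⊗[ℂ] TensorPower H k) :
    TensorPower.ofTensor (s + t) = TensorPower.ofTensor s + TensorPower.ofTensor t :=
  Completion.coe_add s t

theorem TensorPower.ofTensor_smul {k : ℕ} (c : ℂ) (t : H ⊗[ℂ] TensorPower H k) :
    TensorPower.ofTensor (c • t) = c • TensorPower.ofTensor t :=
  Completion.coe_smul c t

theorem TensorPower.norm_ofTensor {k : ℕ} (t : H ⊗[ℂ] TensorPower H k) :
    ‖TensorPower.ofTensor t‖ = ‖t‖ :=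
  Completion.norm_coe t

theorem TensorPower.inner_ofTensor {k : ℕ} (s t : H ⊗[ℂ] TensorPower H k) :
    ⟪TensorPower.ofTensor s, TensorPower.ofTensor t⟫_ℂ = ⟪s, t⟫_ℂ :=
  Completion.inner_coe (𝕜 := ℂ) s t

theorem TensorPower.continuous_ofTensor {k : ℕ} :
    Continuous (TensorPower.ofTensor : H ⊗[ℂ] TensorPower H k → TensorPower H (k + 1)) :=
  Completion.continuous_coe (H ⊗[ℂ] TensorPower H k)

theorem TensorPower.induction_ofTensor {k : ℕ} {p : TensorPower H (k + 1) → Prop}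
    (hclosed : IsClosed {v | p v}) (h : ∀ t, p (TensorPower.ofTensor t))
    (v : TensorPower H (k + 1)) : p v :=
  Completion.induction_on (α := H ⊗[ℂ] TensorPower H k) (p := p) v hclosed h

theorem TensorPower.inner_tmul {k : ℕ} (x y : H) (v v' : TensorPower H k) :
    ⟪TensorPower.tmul x v, TensorPower.tmul y v'⟫_ℂ = ⟪x, y⟫_ℂ * ⟪v, v'⟫_ℂ :=
  (TensorPower.inner_ofTensor _ _).trans (TensorProduct.inner_tmul ℂ x y v v')

theorem TensorPower.norm_tmul {k : ℕ} (x : H) (v : TensorPower H k) :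
    ‖TensorPower.tmul x v‖ = ‖x‖ * ‖v‖ :=
  (TensorPower.norm_ofTensor _).trans (TensorProduct.norm_tmul x v)

theorem TensorPower.tmul_add {k : ℕ} (x : H) (v v' : TensorPower H k) :
    TensorPower.tmul x (v + v') = TensorPower.tmul x v + TensorPower.tmul x v' :=
  (congrArg _ (TensorProduct.tmul_add x v v')).trans (TensorPower.ofTensor_add _ _)

theorem TensorPower.tmul_smul {k : ℕ} (c : ℂ) (x : H) (v : TensorPower H k) :
    TensorPower.tmul x (c • v) = c • TensorPower.tmul x v :=
  (congrArg _ (TensorProduct.tmul_smul c x v)).trans (TensorPower.ofTensor_smul c _)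

theorem TensorPower.continuous_tmul {k : ℕ} :
    Continuous fun p : H × TensorPower H k => TensorPower.tmul p.1 p.2 :=
  TensorPower.continuous_ofTensor.comp TensorProduct.continuous_tmul

theorem TensorPower.aestronglyMeasurable_tmul {α : Type*} [MeasurableSpace α] {μ : Measure α}
    {k : ℕ} {f : α → H} {g : α → TensorPower H k} (hf : AEStronglyMeasurable f μ)
    (hg : AEStronglyMeasurable g μ) :
    AEStronglyMeasurable (fun a => TensorPower.tmul (f a) (g a)) μ :=
  Continuous.comp_aestronglyMeasurable (g := fun p : H × TensorPower H k => TensorPower.tmul p.1 p.2)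
    (f := fun a => (f a, g a)) TensorPower.continuous_tmul (hf.prodMk hg)

/-- A closed additive property of elements of `H^{⊗(k+1)}` that holds for elementary tensors
always holds. -/
theorem TensorPower.induction_tmul {k : ℕ} {p : TensorPower H (k + 1) → Prop}
    (hclosed : IsClosed {v | p v}) (htmul : ∀ x v, p (TensorPower.tmul x v))
    (hadd : ∀ v v', p v → p v' → p (v + v')) (v : TensorPower H (k + 1)) : p v := by
  refine TensorPower.induction_ofTensor hclosed (fun t => ?_) v
  induction t using TensorProduct.induction_on with
  | zero => simpa [TensorPower.tmul] using htmul 0 0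
  | tmul x v => exact htmul x v
  | add a b ha hb =>
    rw [TensorPower.ofTensor_add]
    exact hadd _ _ ha hb

/-- The operator `S ⊗ id` on `H^{⊗(k+1)} = H ⊗ H^{⊗k}`, for a bounded operator `S` on `H`. -/
def TensorPower.leftOp {k : ℕ} (S : H →L[ℂ] H) :
    TensorPower H (k + 1) →L[ℂ] TensorPower H (k + 1) :=
  (ContinuousLinearMap.completion (S.rTensor (TensorPower H k)) :
    Completion (H ⊗[ℂ] TensorPower H k) →L[ℂ] Completion (H ⊗[ℂ] TensorPower H k))

theorem TensorPower.leftOp_ofTensor {k : ℕ} (S : H →L[ℂ] H) (t : H ⊗[ℂ] TensorPower H k) :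
    TensorPower.leftOp S (TensorPower.ofTensor t) =
      TensorPower.ofTensor (S.rTensor (TensorPower H k) t) :=
  ContinuousLinearMap.completion_apply_coe _ t

theorem TensorPower.leftOp_tmul {k : ℕ} (S : H →L[ℂ] H) (x : H) (v : TensorPower H k) :
    TensorPower.leftOp S (TensorPower.tmul x v) = TensorPower.tmul (S x) v :=
  TensorPower.leftOp_ofTensor S _

theorem TensorPower.norm_leftOp_le {k : ℕ} (S : H →L[ℂ] H) :
    ‖TensorPower.leftOp (k := k) S‖ ≤ ‖S‖ := by
  refine ContinuousLinearMap.opNorm_le_bound _ (norm_nonneg _) fun v => ?_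
  refine TensorPower.induction_ofTensor
    (p := fun v : TensorPower H (k + 1) => ‖TensorPower.leftOp S v‖ ≤ ‖S‖ * ‖v‖) ?_ (fun t => ?_) v
  · exact isClosed_le (TensorPower.leftOp (k := k) S).continuous.norm
      (continuous_const.mul continuous_norm)
  · rw [TensorPower.leftOp_ofTensor, TensorPower.norm_ofTensor, TensorPower.norm_ofTensor]
    exact (ContinuousLinearMap.le_opNorm _ _).trans (mul_le_mul_of_nonneg_right
      (ContinuousLinearMap.norm_rTensor_le (TensorPower H k) S) (norm_nonneg _))

end TensorPower

section PointwiseOperators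

variable {α : Type*} [MeasurableSpace α] {μ : Measure α}
  {E : Type*} [NormedAddCommGroup E] [InnerProductSpace ℂ E]

theorem aestronglyMeasurable_pointwise {T : α → E →L[ℂ] E}
    (hT : ∀ v, AEStronglyMeasurable (fun a => T a v) μ) {f : α → E}
    (hf : AEStronglyMeasurable f μ) : AEStronglyMeasurable (fun a => T a (f a)) μ := by
  obtain ⟨g, hg, hfg⟩ := hf
  refine AEStronglyMeasurable.congr ?_ (hfg.mono fun a ha => by
    change T a (g a) = T a (f a); rw [ha])
  have hs : ∀ s : SimpleFunc α E, AEStronglyMeasurable (fun a => T a (s a)) μ := by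
    intro s
    induction s using SimpleFunc.induction with
    | @const c t ht =>
      refine ((hT c).indicator ht).congr (Filter.Eventually.of_forall fun a => ?_)
      by_cases ha : a ∈ t <;> simp [ha]
    | @add f g _ h1 h2 =>
      refine (h1.add h2).congr (Filter.Eventually.of_forall fun a => ?_)
      simp
  exact aestronglyMeasurable_of_tendsto_ae Filter.atTop (fun n => hs (hg.approx n))
    (Filter.Eventually.of_forall fun a => ((T a).continuous.tendsto _).comp (hg.tendsto_approx a))

theorem memLp_pointwise {T : α → E →L[ℂ] E}
    (hT : ∀ v, AEStronglyMeasurable (fun a => T a v) μ) {C : ℝ} (hC : ∀ᵐ a ∂μ, ‖T a‖ ≤ C)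
    (f : Lp E 2 μ) : MemLp (fun a => T a (f a)) 2 μ :=
  (Lp.memLp f).of_le_mul (aestronglyMeasurable_pointwise hT (Lp.aestronglyMeasurable f))
    (hC.mono fun a ha => ((T a).le_opNorm _).trans
      (mul_le_mul_of_nonneg_right ha (norm_nonneg _)))

/-- The bounded operator `f ↦ (a ↦ T(a) f(a))` on `L²(μ; E)`, for an essentially bounded family
`T` of bounded operators on `E` that is measurable in the strong operator topology. -/
def pointwiseOp (T : α → E →L[ℂ] E) (hT : ∀ v, AEStronglyMeasurable (fun a => T a v) μ) (C : ℝ)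
    (hC : ∀ᵐ a ∂μ, ‖T a‖ ≤ C) : Lp E 2 μ →L[ℂ] Lp E 2 μ :=
  LinearMap.mkContinuous
    { toFun := fun f => (memLp_pointwise hT hC f).toLp _
      map_add' := fun f g => by
        rw [← MemLp.toLp_add]
        refine MemLp.toLp_congr _ _ ((Lp.coeFn_add f g).mono fun a ha => ?_)
        change T a ((f + g : Lp E 2 μ) a) = T a (f a) + T a (g a)
        rw [ha, Pi.add_apply, map_add]
      map_smul' := fun c f => by
        rw [RingHom.id_apply, ← MemLp.toLp_const_smul]
        refine MemLp.toLp_congr _ _ ((Lp.coeFn_smul c f).mono fun a ha => ?_)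
        change T a ((c • f : Lp E 2 μ) a) = c • T a (f a)
        rw [ha, Pi.smul_apply, map_smul] }
    (max C 0) fun f => by
      refine Lp.norm_le_mul_norm_of_ae_le_mul ?_
      filter_upwards [MemLp.coeFn_toLp (memLp_pointwise hT hC f), hC] with a ha hCa
      change ‖((memLp_pointwise hT hC f).toLp _ : Lp E 2 μ) a‖ ≤ _
      rw [ha]
      exact ((T a).le_opNorm _).trans
        (mul_le_mul_of_nonneg_right (hCa.trans (le_max_left _ _)) (norm_nonneg _))

theorem coeFn_pointwiseOp (T : α → E →L[ℂ] E)
    (hT : ∀ v, AEStronglyMeasurable (fun a => T a v) μ) (C : ℝ) (hC : ∀ᵐ a ∂μ, ‖T a‖ ≤ C)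
    (f : Lp E 2 μ) : pointwiseOp T hT C hC f =ᵐ[μ] fun a => T a (f a) :=
  MemLp.coeFn_toLp (memLp_pointwise hT hC f)

theorem norm_pointwiseOp_le (T : α → E →L[ℂ] E)
    (hT : ∀ v, AEStronglyMeasurable (fun a => T a v) μ) (C : ℝ) (hC : ∀ᵐ a ∂μ, ‖T a‖ ≤ C) :
    ‖pointwiseOp T hT C hC‖ ≤ max C 0 :=
  LinearMap.mkContinuous_norm_le _ (le_max_right _ _) _

end PointwiseOperators

section DirectSum

variable {G : ℕ → Type*} [∀ k, NormedAddCommGroup (G k)]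

theorem memℓp_of_le {f : lp G 2} {g : ∀ k, G k} {C : ℝ} (h : ∀ k, ‖g k‖ ≤ C * ‖f k‖) :
    Memℓp g 2 := by
  refine memℓp_gen ?_
  have hf := (lp.memℓp f).summable (by norm_num)
  simp only [ENNReal.toReal_ofNat, Real.rpow_two] at hf ⊢
  refine Summable.of_nonneg_of_le (fun k => sq_nonneg _) (fun k => ?_) (hf.mul_left (C ^ 2))
  rw [← mul_pow]
  exact pow_le_pow_left₀ (norm_nonneg _) (h k) 2

theorem lp_norm_sq (f : lp G 2) : HasSum (fun k => ‖f k‖ ^ 2) (‖f‖ ^ 2) := by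
  have h := lp.hasSum_norm (p := 2) (by norm_num) f
  simpa only [ENNReal.toReal_ofNat, Real.rpow_two] using h

variable [∀ k, InnerProductSpace ℂ (G k)]

/-- The bounded operator on the Hilbert space direct sum of the `G k` that acts as `T k` on the
summand `G k`. -/
def directSumDiag (T : ∀ k, G k →L[ℂ] G k) (C : ℝ) (hC : ∀ k, ‖T k‖ ≤ C) : lp G 2 →L[ℂ] lp G 2 :=
  LinearMap.mkContinuous
    { toFun := fun f => ⟨fun k => T k (f k), memℓp_of_le (f := f) fun k =>
        (T k).le_of_opNorm_le (hC k) _⟩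
      map_add' := fun f g => by ext k; exact map_add (T k) (f k) (g k)
      map_smul' := fun c f => by ext k; exact map_smul (T k) c (f k) }
    C fun f => by
      have hC0 : 0 ≤ C := (norm_nonneg _).trans (hC 0)
      refine le_of_sq_le_sq ?_ (by positivity)
      rw [mul_pow]
      refine hasSum_le (fun k => ?_) (lp_norm_sq _) ((lp_norm_sq f).mul_left (C ^ 2))
      rw [← mul_pow]
      exact pow_le_pow_left₀ (norm_nonneg _) ((T k).le_of_opNorm_le (hC k) _) 2

theorem directSumDiag_apply (T : ∀ k, G k →L[ℂ] G k) (C : ℝ) (hC : ∀ k, ‖T k‖ ≤ C) (f : lp G 2)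
    (k : ℕ) : directSumDiag T C hC f k = T k (f k) := rfl

/-- The sequence `0, T 0 (f 0), T 1 (f 1), …`. -/
def shiftSeq (T : ∀ k, G k →L[ℂ] G (k + 1)) (f : ∀ k, G k) : ∀ k, G k
  | 0 => 0
  | k + 1 => T k (f k)

theorem memℓp_shiftSeq (T : ∀ k, G k →L[ℂ] G (k + 1)) {C : ℝ} (hC : ∀ k, ‖T k‖ ≤ C) (f : lp G 2) :
    Memℓp (shiftSeq T f) 2 := by
  refine memℓp_gen ?_
  simp only [ENNReal.toReal_ofNat, Real.rpow_two]
  rw [← summable_nat_add_iff 1]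
  refine Summable.of_nonneg_of_le (fun k => sq_nonneg _) (fun k => ?_)
    ((lp_norm_sq f).summable.mul_left (C ^ 2))
  rw [← mul_pow]
  exact pow_le_pow_left₀ (norm_nonneg _) ((T k).le_of_opNorm_le (hC k) _) 2

/-- The bounded operator on the Hilbert space direct sum of the `G k` that maps the summand `G k`
into the summand `G (k + 1)` by `T k`. -/
def directSumShift (T : ∀ k, G k →L[ℂ] G (k + 1)) (C : ℝ) (hC : ∀ k, ‖T k‖ ≤ C) :
    lp G 2 →L[ℂ] lp G 2 :=
  LinearMap.mkContinuous
    { toFun := fun f => ⟨shiftSeq T f, memℓp_shiftSeq T hC f⟩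
      map_add' := fun f g => by
        ext k
        cases k with
        | zero => exact (add_zero (0 : G 0)).symm
        | succ k => exact map_add (T k) (f k) (g k)
      map_smul' := fun c f => by
        ext k
        cases k with
        | zero => exact (smul_zero c).symm
        | succ k => exact map_smul (T k) c (f k) }
    C fun f => by
      have hC0 : 0 ≤ C := (norm_nonneg _).trans (hC 0)
      refine le_of_sq_le_sq ?_ (by positivity)
      rw [mul_pow]
      have h := (hasSum_nat_add_iff' 1).2
        (lp_norm_sq (⟨shiftSeq T f, memℓp_shiftSeq T hC f⟩ : lp G 2))
      simp only [Finset.range_one, Finset.sum_singleton, shiftSeq, norm_zero, ne_eq,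
        OfNat.ofNat_ne_zero, not_false_eq_true, zero_pow, sub_zero] at h
      refine hasSum_le (fun k => ?_) h ((lp_norm_sq f).mul_left (C ^ 2))
      rw [← mul_pow]
      exact pow_le_pow_left₀ (norm_nonneg _) ((T k).le_of_opNorm_le (hC k) _) 2

theorem directSumShift_apply_zero (T : ∀ k, G k →L[ℂ] G (k + 1)) (C : ℝ) (hC : ∀ k, ‖T k‖ ≤ C)
    (f : lp G 2) : directSumShift T C hC f 0 = 0 := rfl

theorem directSumShift_apply_succ (T : ∀ k, G k →L[ℂ] G (k + 1)) (C : ℝ) (hC : ∀ k, ‖T k‖ ≤ C)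
    (f : lp G 2) (k : ℕ) : directSumShift T C hC f (k + 1) = T k (f k) := rfl

end DirectSum

section Fock

universe u

variable {Ω : Type*} [MeasurableSpace Ω] {ρ : Measure Ω}

/-- The density `w(ω_k, ω_{k-1}) ⋯ w(ω_2, ω_1)` (with coordinates numbered from `0` here). -/
def chainDensity (w : Ω × Ω → ℝ) : (k : ℕ) → (Fin k → Ω) → ℝ≥0∞
  | 0, _ => 1
  | k + 1, ω => ∏ i : Fin k, ENNReal.ofReal (w (ω i.succ, ω i.castSucc))

theorem measurable_chainDensity {w : Ω × Ω → ℝ} (hw : Measurable w) (k : ℕ) :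
    Measurable (chainDensity w k) := by
  cases k with
  | zero => exact measurable_const
  | succ k => unfold chainDensity; fun_prop

/-- The measure `ρ_k` on `Ω^k`, with density `chainDensity` with respect to the product measure. -/
def chainMeasure (w : Lp ℝ ∞ (ρ.prod ρ)) (k : ℕ) : Measure (Fin k → Ω) :=
  (Measure.pi fun _ => ρ).withDensity (chainDensity w k)

theorem measurable_weight (w : Lp ℝ ∞ (ρ.prod ρ)) : Measurable w :=
  (Lp.stronglyMeasurable w).measurable

theorem weight_le (w : Lp ℝ ∞ (ρ.prod ρ)) : ∀ᵐ p ∂(ρ.prod ρ), |w p| ≤ ‖w‖ := by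
  have h : eLpNorm w ∞ (ρ.prod ρ) ≠ ∞ := Lp.eLpNorm_ne_top w
  rw [eLpNorm_exponent_top] at h
  filter_upwards [ae_le_eLpNormEssSup (f := w) (μ := ρ.prod ρ)] with p hp
  rw [Lp.norm_def, eLpNorm_exponent_top, ← Real.norm_eq_abs, ← toReal_enorm]
  exact ENNReal.toReal_mono h hp

theorem chainMeasure_absolutelyContinuous (w : Lp ℝ ∞ (ρ.prod ρ)) (k : ℕ) :
    chainMeasure w k ≪ Measure.pi fun _ => ρ :=
  withDensity_absolutelyContinuous _ _

variable [SigmaFinite ρ]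

instance (w : Lp ℝ ∞ (ρ.prod ρ)) (k : ℕ) : SFinite (chainMeasure w k) :=
  inferInstanceAs (SFinite (Measure.withDensity _ _))

theorem quasiMeasurePreserving_eval_chainMeasure (w : Lp ℝ ∞ (ρ.prod ρ)) (k : ℕ) (i : Fin k) :
    Measure.QuasiMeasurePreserving (fun ω : Fin k → Ω => ω i) (chainMeasure w k) ρ :=
  (Measure.quasiMeasurePreserving_eval (fun _ => ρ) i).mono_left
    (chainMeasure_absolutelyContinuous w k)

/-- The equivalence `Ω × Ω^k → Ω^{k+1}` that puts a new coordinate in front. -/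
def consEquiv (Ω : Type*) [MeasurableSpace Ω] (k : ℕ) : Ω × (Fin k → Ω) ≃ᵐ (Fin (k + 1) → Ω) :=
  (MeasurableEquiv.piFinSuccAbove (fun _ => Ω) 0).symm

theorem consEquiv_apply (k : ℕ) (p : Ω × (Fin k → Ω)) : consEquiv Ω k p = Fin.cons p.1 p.2 := by
  simp [consEquiv, MeasurableEquiv.piFinSuccAbove, Fin.consEquiv]

theorem measurePreserving_consEquiv (ρ : Measure Ω) [SigmaFinite ρ] (k : ℕ) :
    MeasurePreserving (consEquiv Ω k) (ρ.prod (Measure.pi fun _ => ρ)) (Measure.pi fun _ => ρ) :=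
  (measurePreserving_piFinSuccAbove (fun _ : Fin (k + 1) => ρ) 0).symm

theorem chainDensity_cons_le (w : Lp ℝ ∞ (ρ.prod ρ)) (k : ℕ) :
    ∀ᵐ p ∂(ρ.prod (Measure.pi fun _ : Fin k => ρ)),
      chainDensity w (k + 1) (consEquiv Ω k p) ≤
        ENNReal.ofReal (max 1 ‖w‖) * chainDensity w k p.2 := by
  cases k with
  | zero =>
    refine Filter.Eventually.of_forall fun p => ?_
    simp [chainDensity]
  | succ k =>
    have hq : Measure.QuasiMeasurePreserving (fun p : Ω × (Fin (k + 1) → Ω) => (p.2 0, p.1))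
        (ρ.prod (Measure.pi fun _ => ρ)) (ρ.prod ρ) :=
      Measure.measurePreserving_swap.quasiMeasurePreserving.comp
        (QuasiMeasurePreserving.prodMap (Measure.QuasiMeasurePreserving.id ρ)
          (Measure.quasiMeasurePreserving_eval (fun _ => ρ) 0))
    filter_upwards [hq.ae (weight_le w)] with p hp
    rw [consEquiv_apply]
    simp only [chainDensity]
    rw [Fin.prod_univ_succ]
    refine mul_le_mul' (ENNReal.ofReal_le_ofReal ?_) (le_of_eq rfl)
    exact (le_abs_self _).trans (hp.trans (le_max_right _ _))

theorem chainMeasure_succ_le (w : Lp ℝ ∞ (ρ.prod ρ)) (k : ℕ) :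
    chainMeasure w (k + 1) ≤
      ENNReal.ofReal (max 1 ‖w‖) • (ρ.prod (chainMeasure w k)).map (consEquiv Ω k) := by
  refine Measure.le_iff.2 fun s hs => ?_
  have hs2 := (consEquiv Ω k).measurable hs
  rw [chainMeasure, withDensity_apply _ hs,
    ← (measurePreserving_consEquiv ρ k).setLIntegral_comp_preimage hs
      (measurable_chainDensity (measurable_weight w) (k + 1)),
    Measure.smul_apply, smul_eq_mul, Measure.map_apply (consEquiv Ω k).measurable hs,
    chainMeasure, prod_withDensity_right (measurable_chainDensity (measurable_weight w) k),
    withDensity_apply _ hs2, ← lintegral_const_mul' _ _ ENNReal.ofReal_ne_top]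
  exact lintegral_mono_ae (ae_restrict_of_ae (chainDensity_cons_le w k))

variable {H : Type u} [NormedAddCommGroup H] [InnerProductSpace ℂ H]

/-- The summand `L²(Ω^k, ρ_k; H^{⊗k})` of the Fock space. -/
abbrev FockComponent (w : Lp ℝ ∞ (ρ.prod ρ)) (H : Type u) [NormedAddCommGroup H]
    [InnerProductSpace ℂ H] (k : ℕ) : Type _ :=
  Lp (TensorPower H k) 2 (chainMeasure w k)

/-- The Fock space `F(Ω, ρ, w, H) = ⨁_{k ≥ 0} L²(Ω^k, ρ_k; H^{⊗k})` (Hilbert space direct sum).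
The summand `k = 0` is `ℂ`, since `Ω^0` is a point of mass one and `H^{⊗0} = ℂ`. -/
abbrev Fock (w : Lp ℝ ∞ (ρ.prod ρ)) (H : Type u) [NormedAddCommGroup H]
    [InnerProductSpace ℂ H] : Type _ :=
  lp (fun k : ℕ => FockComponent w H k) 2

instance (w : Lp ℝ ∞ (ρ.prod ρ)) : IsProbabilityMeasure (chainMeasure w 0) := by
  constructor
  simp [chainMeasure, chainDensity]

/-- The vacuum vector `1 ∈ ℂ` of the Fock space. -/
def vacuum (w : Lp ℝ ∞ (ρ.prod ρ)) (H : Type u) [NormedAddCommGroup H]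
    [InnerProductSpace ℂ H] : Fock w H :=
  lp.single 2 0 (Lp.const 2 (chainMeasure w 0) (TensorPower.ofScalar H 1))

theorem quasiMeasurePreserving_tail (w : Lp ℝ ∞ (ρ.prod ρ)) (k : ℕ) :
    Measure.QuasiMeasurePreserving (fun ω : Fin (k + 1) → Ω => Fin.tail ω)
      (chainMeasure w (k + 1)) (chainMeasure w k) := by
  have hm : Measurable fun ω : Fin (k + 1) → Ω => Fin.tail ω :=
    measurable_pi_lambda _ fun i => measurable_pi_apply i.succ
  refine Measure.QuasiMeasurePreserving.mono_left ⟨hm, ?_⟩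
    (Measure.absolutelyContinuous_of_le_smul (chainMeasure_succ_le w k))
  rw [Measure.map_map hm (consEquiv Ω k).measurable]
  have h : (fun ω : Fin (k + 1) → Ω => Fin.tail ω) ∘ consEquiv Ω k = Prod.snd := by
    funext p
    simp [consEquiv_apply]
  rw [h]
  exact Measure.quasiMeasurePreserving_snd.absolutelyContinuous

theorem memLp_creation (w : Lp ℝ ∞ (ρ.prod ρ)) (k : ℕ) (h : Lp H 2 ρ) (f : FockComponent w H k) :
    MemLp (fun ω : Fin (k + 1) → Ω => TensorPower.tmul (h (ω 0)) (f (Fin.tail ω))) 2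
        (chainMeasure w (k + 1)) ∧
      eLpNorm (fun ω : Fin (k + 1) → Ω => TensorPower.tmul (h (ω 0)) (f (Fin.tail ω))) 2
        (chainMeasure w (k + 1)) ≤ ENNReal.ofReal (max 1 ‖w‖) * (‖h‖ₑ * ‖f‖ₑ) := by
  set c : ℝ≥0∞ := ENNReal.ofReal (max 1 ‖w‖) with hc
  have hc1 : 1 ≤ c := by
    rw [hc, ← ENNReal.ofReal_one]
    exact ENNReal.ofReal_le_ofReal (le_max_left _ _)
  set F : (Fin (k + 1) → Ω) → TensorPower H (k + 1) :=
    fun ω => TensorPower.tmul (h (ω 0)) (f (Fin.tail ω)) with hF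
  have hcomp : F ∘ consEquiv Ω k = fun p => TensorPower.tmul (h p.1) (f p.2) := by
    funext p
    simp [hF, consEquiv_apply]
  have hmeas : AEStronglyMeasurable (fun p : Ω × (Fin k → Ω) => TensorPower.tmul (h p.1) (f p.2))
      (ρ.prod (chainMeasure w k)) :=
    TensorPower.aestronglyMeasurable_tmul (Lp.aestronglyMeasurable h).comp_fst
      (Lp.aestronglyMeasurable f).comp_snd
  have hmeas2 : AEStronglyMeasurable F ((ρ.prod (chainMeasure w k)).map (consEquiv Ω k)) := by
    rw [(consEquiv Ω k).measurableEmbedding.aestronglyMeasurable_map_iff, hcomp]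
    exact hmeas
  have hprod : eLpNorm (fun p : Ω × (Fin k → Ω) => TensorPower.tmul (h p.1) (f p.2)) 2
      (ρ.prod (chainMeasure w k)) = ‖h‖ₑ * ‖f‖ₑ := by
    rw [Lp.enorm_def, Lp.enorm_def]
    simp only [eLpNorm_eq_lintegral_rpow_enorm_toReal two_ne_zero ENNReal.ofNat_ne_top]
    rw [← ENNReal.mul_rpow_of_nonneg _ _ (by positivity), ← lintegral_prod_mul
      ((Lp.aestronglyMeasurable h).enorm.pow_const _)
      ((Lp.aestronglyMeasurable f).enorm.pow_const _)]
    congr 1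
    refine lintegral_congr fun p => ?_
    rw [← ENNReal.mul_rpow_of_nonneg _ _ (by positivity)]
    congr 1
    rw [← ofReal_norm, TensorPower.norm_tmul, ENNReal.ofReal_mul (norm_nonneg _), ofReal_norm,
      ofReal_norm]
  have hmap : eLpNorm F 2 ((ρ.prod (chainMeasure w k)).map (consEquiv Ω k)) = ‖h‖ₑ * ‖f‖ₑ := by
    rw [eLpNorm_map_measure hmeas2 (consEquiv Ω k).measurable.aemeasurable, hcomp, hprod]
  have hmem : MemLp F 2 ((ρ.prod (chainMeasure w k)).map (consEquiv Ω k)) :=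
    ⟨hmeas2, by rw [hmap]; exact ENNReal.mul_lt_top enorm_lt_top enorm_lt_top⟩
  refine ⟨hmem.of_measure_le_smul ENNReal.ofReal_ne_top (chainMeasure_succ_le w k), ?_⟩
  refine (eLpNorm_le_of_measure_le_smul (chainMeasure_succ_le w k)).trans ?_
  rw [hmap, smul_eq_mul]
  refine mul_le_mul' ?_ le_rfl
  calc c ^ (1 / (2 : ℝ≥0∞)).toReal ≤ c ^ (1 : ℝ) :=
        ENNReal.rpow_le_rpow_of_exponent_le hc1 (by norm_num)
    _ = c := ENNReal.rpow_one c

/-- The creation operator on the summand `k` of the Fock space: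
`(ω_1, …, ω_{k+1}) ↦ h(ω_1) ⊗ f(ω_2, …, ω_{k+1})`. -/
def creationComponent (w : Lp ℝ ∞ (ρ.prod ρ)) (h : Lp H 2 ρ) (k : ℕ) :
    FockComponent w H k →L[ℂ] FockComponent w H (k + 1) :=
  LinearMap.mkContinuous
    { toFun := fun f => (memLp_creation w k h f).1.toLp
        (fun ω => TensorPower.tmul (h (ω 0)) (f (Fin.tail ω)))
      map_add' := fun f g => by
        rw [← MemLp.toLp_add]
        refine MemLp.toLp_congr _ _
          (((quasiMeasurePreserving_tail w k).ae (Lp.coeFn_add f g)).mono fun ω hω => ?_)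
        change TensorPower.tmul (h (ω 0)) ((f + g : FockComponent w H k) (Fin.tail ω)) =
          TensorPower.tmul (h (ω 0)) (f (Fin.tail ω)) + TensorPower.tmul (h (ω 0)) (g (Fin.tail ω))
        rw [hω, Pi.add_apply, TensorPower.tmul_add]
      map_smul' := fun c f => by
        rw [RingHom.id_apply, ← MemLp.toLp_const_smul]
        refine MemLp.toLp_congr _ _
          (((quasiMeasurePreserving_tail w k).ae (Lp.coeFn_smul c f)).mono fun ω hω => ?_)
        change TensorPower.tmul (h (ω 0)) ((c • f : FockComponent w H k) (Fin.tail ω)) =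
          c • TensorPower.tmul (h (ω 0)) (f (Fin.tail ω))
        rw [hω, Pi.smul_apply, TensorPower.tmul_smul] }
    (max 1 ‖w‖ * ‖h‖) fun f => by
      refine (Lp.norm_toLp _ (memLp_creation w k h f).1).trans_le ?_
      refine ENNReal.toReal_le_of_le_ofReal (by positivity)
        ((memLp_creation w k h f).2.trans (le_of_eq ?_))
      rw [mul_assoc, ENNReal.ofReal_mul (by positivity), ENNReal.ofReal_mul (norm_nonneg _),
        ofReal_norm, ofReal_norm]

theorem coeFn_creationComponent (w : Lp ℝ ∞ (ρ.prod ρ)) (h : Lp H 2 ρ) (k : ℕ)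
    (f : FockComponent w H k) :
    creationComponent w h k f =ᵐ[chainMeasure w (k + 1)]
      fun ω => TensorPower.tmul (h (ω 0)) (f (Fin.tail ω)) :=
  MemLp.coeFn_toLp (memLp_creation w k h f).1

/-- The left creation operator `ℓ(h)`. The left annihilation operator is its adjoint. -/
def creation (w : Lp ℝ ∞ (ρ.prod ρ)) (h : Lp H 2 ρ) : Fock w H →L[ℂ] Fock w H :=
  directSumShift (creationComponent w h) (max 1 ‖w‖ * ‖h‖) fun _ =>
    LinearMap.mkContinuous_norm_le _ (by positivity) _

/-- The function `x ↦ ∫ φ(y) w(x, y) dρ(y)`. -/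
def weightedIntegral (w : Lp ℝ ∞ (ρ.prod ρ)) (φ : Lp ℂ 1 ρ) (x : Ω) : ℂ :=
  ∫ y, φ y * (w (x, y) : ℂ) ∂ρ

theorem stronglyMeasurable_weightedIntegral (w : Lp ℝ ∞ (ρ.prod ρ)) (φ : Lp ℂ 1 ρ) :
    StronglyMeasurable (weightedIntegral w φ) :=
  StronglyMeasurable.integral_prod_right
    (f := fun x y => φ y * (w (x, y) : ℂ))
    (((Lp.stronglyMeasurable φ).comp_measurable measurable_snd).mul
      (Complex.continuous_ofReal.comp_stronglyMeasurable (Lp.stronglyMeasurable w)))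

theorem weightedIntegral_le (w : Lp ℝ ∞ (ρ.prod ρ)) (φ : Lp ℂ 1 ρ) :
    ∀ᵐ x ∂ρ, ‖weightedIntegral w φ x‖ ≤ ‖w‖ * ‖φ‖ := by
  filter_upwards [Measure.ae_ae_of_ae_prod (weight_le w)] with x hx
  have hφ : Integrable φ ρ := L1.integrable_coeFn φ
  calc ‖weightedIntegral w φ x‖ ≤ ∫ y, ‖w‖ * ‖φ y‖ ∂ρ := by
        refine norm_integral_le_of_norm_le (hφ.norm.const_mul _) ?_
        filter_upwards [hx] with y hy
        rw [norm_mul, Complex.norm_real, Real.norm_eq_abs, mul_comm]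
        gcongr
    _ = ‖w‖ * ‖φ‖ := by rw [integral_const_mul, L1.norm_eq_integral_norm]

theorem aestronglyMeasurable_weightedIntegral_smul (w : Lp ℝ ∞ (ρ.prod ρ)) (φ : Lp ℂ 1 ρ) (k : ℕ)
    (v : TensorPower H (k + 1)) :
    AEStronglyMeasurable (fun ω : Fin (k + 1) → Ω =>
      (weightedIntegral w φ (ω 0) • ContinuousLinearMap.id ℂ (TensorPower H (k + 1))) v)
      (chainMeasure w (k + 1)) := by
  have h := ((stronglyMeasurable_weightedIntegral w φ).comp_measurable
    (g := fun ω : Fin (k + 1) → Ω => ω 0) (measurable_pi_apply 0)).smul_const v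
  exact h.aestronglyMeasurable

theorem norm_weightedIntegral_smul_le (w : Lp ℝ ∞ (ρ.prod ρ)) (φ : Lp ℂ 1 ρ) (k : ℕ) :
    ∀ᵐ ω ∂(chainMeasure w (k + 1)),
      ‖weightedIntegral w φ (ω 0) • ContinuousLinearMap.id ℂ (TensorPower H (k + 1))‖ ≤
        ‖w‖ * ‖φ‖ := by
  filter_upwards [(quasiMeasurePreserving_eval_chainMeasure w (k + 1) 0).ae
    (weightedIntegral_le w φ)] with ω hω
  exact (norm_smul_le _ _).trans ((mul_le_of_le_one_right (norm_nonneg _)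
    ContinuousLinearMap.norm_id_le).trans hω)

/-- The operator `𝔫(φ)` on the summand `k` of the Fock space: multiplication by the constant
`∫ φ dρ` for `k = 0`, and by the function `∫ φ(y) w(ω_1, y) dρ(y)` of `(ω_1, …, ω_k)` otherwise. -/
def scalarMulComponent (w : Lp ℝ ∞ (ρ.prod ρ)) (H : Type u) [NormedAddCommGroup H]
    [InnerProductSpace ℂ H] (φ : Lp ℂ 1 ρ) : (k : ℕ) → FockComponent w H k →L[ℂ] FockComponent w H k
  | 0 => (∫ y, φ y ∂ρ) • ContinuousLinearMap.id ℂ _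
  | k + 1 =>
    pointwiseOp (fun ω => weightedIntegral w φ (ω 0) • ContinuousLinearMap.id ℂ _)
      (aestronglyMeasurable_weightedIntegral_smul w φ k) (‖w‖ * ‖φ‖)
      (norm_weightedIntegral_smul_le w φ k)

/-- The operator `𝔫(φ)` on the Fock space, for `φ` in `L¹(Ω, ρ)`. -/
def scalarMul (w : Lp ℝ ∞ (ρ.prod ρ)) (H : Type u) [NormedAddCommGroup H]
    [InnerProductSpace ℂ H] (φ : Lp ℂ 1 ρ) : Fock w H →L[ℂ] Fock w H :=
  directSumDiag (scalarMulComponent w H φ) (max 1 ‖w‖ * ‖φ‖) fun k => by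
    cases k with
    | zero =>
      refine (norm_smul_le _ _).trans ((mul_le_of_le_one_right (norm_nonneg _)
        ContinuousLinearMap.norm_id_le).trans ?_)
      refine (norm_integral_le_integral_norm _).trans ?_
      rw [← L1.norm_eq_integral_norm]
      exact le_mul_of_one_le_left (norm_nonneg _) (le_max_left _ _)
    | succ k =>
      refine (norm_pointwiseOp_le _ (aestronglyMeasurable_weightedIntegral_smul w φ k) _
        (norm_weightedIntegral_smul_le w φ k)).trans (max_le ?_ (by positivity))
      exact mul_le_mul_of_nonneg_right (le_max_right _ _) (norm_nonneg _)

/-- An element of `L^∞(Ω, B(H))`: an essentially bounded map from `Ω` to the bounded operators on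
`H`, measurable in the strong-* operator topology. -/
structure BoundedOperatorField (ρ : Measure Ω) (H : Type u) [NormedAddCommGroup H]
    [InnerProductSpace ℂ H] [CompleteSpace H] where
  toFun : Ω → H →L[ℂ] H
  measurable_apply : ∀ v, AEStronglyMeasurable (fun x => toFun x v) ρ
  measurable_adjoint_apply : ∀ v,
    AEStronglyMeasurable (fun x => ContinuousLinearMap.adjoint (toFun x) v) ρ
  essBounded : ∃ C : ℝ, ∀ᵐ x ∂ρ, ‖toFun x‖ ≤ C

theorem aestronglyMeasurable_leftOp {α : Type*} [MeasurableSpace α] {μ : Measure α}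
    {T : α → H →L[ℂ] H} (hT : ∀ x, AEStronglyMeasurable (fun a => T a x) μ) {k : ℕ}
    (v : TensorPower H (k + 1)) :
    AEStronglyMeasurable (fun a => TensorPower.leftOp (T a) v) μ := by
  refine TensorPower.induction_tmul
    (p := fun v => AEStronglyMeasurable (fun a => TensorPower.leftOp (T a) v) μ)
    ?_ (fun x v => ?_) (fun v v' h h2 => ?_) v
  · refine IsSeqClosed.isClosed fun u v hu huv => ?_
    exact aestronglyMeasurable_of_tendsto_ae Filter.atTop hu
      (Filter.Eventually.of_forall fun a =>
        ((TensorPower.leftOp (T a)).continuous.tendsto v).comp huv)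
  · simp only [TensorPower.leftOp_tmul]
    exact TensorPower.aestronglyMeasurable_tmul (hT x) aestronglyMeasurable_const
  · simp only [map_add]
    exact h.add h2

variable [CompleteSpace H]

/-- The essential bound of an operator field chosen for the construction of `𝔪(S)`. -/
def BoundedOperatorField.bound (S : BoundedOperatorField ρ H) : ℝ := S.essBounded.choose

theorem BoundedOperatorField.aestronglyMeasurable_leftOp (w : Lp ℝ ∞ (ρ.prod ρ))
    (S : BoundedOperatorField ρ H) (k : ℕ) (v : TensorPower H (k + 1)) :
    AEStronglyMeasurable (fun ω : Fin (k + 1) → Ω => TensorPower.leftOp (S.toFun (ω 0)) v)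
      (chainMeasure w (k + 1)) :=
  FockModel.aestronglyMeasurable_leftOp (fun x => (S.measurable_apply x).comp_quasiMeasurePreserving
    (quasiMeasurePreserving_eval_chainMeasure w (k + 1) 0)) v

theorem BoundedOperatorField.norm_leftOp_le (w : Lp ℝ ∞ (ρ.prod ρ))
    (S : BoundedOperatorField ρ H) (k : ℕ) :
    ∀ᵐ ω ∂(chainMeasure w (k + 1)), ‖TensorPower.leftOp (k := k) (S.toFun (ω 0))‖ ≤ S.bound :=
  ((quasiMeasurePreserving_eval_chainMeasure w (k + 1) 0).ae S.essBounded.choose_spec).mono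
    fun _ hω => (TensorPower.norm_leftOp_le _).trans hω

/-- The operator `𝔪(S)` on the summand `k` of the Fock space: zero for `k = 0`, and
`(ω_1, …, ω_k) ↦ (S(ω_1) ⊗ id) f(ω_1, …, ω_k)` otherwise. -/
def operatorMulComponent (w : Lp ℝ ∞ (ρ.prod ρ)) (S : BoundedOperatorField ρ H) :
    (k : ℕ) → FockComponent w H k →L[ℂ] FockComponent w H k
  | 0 => 0
  | k + 1 =>
    pointwiseOp (fun ω => TensorPower.leftOp (S.toFun (ω 0)))
      (S.aestronglyMeasurable_leftOp w k) S.bound (S.norm_leftOp_le w k)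

/-- The multiplication operator `𝔪(S)` on the Fock space. -/
def operatorMul (w : Lp ℝ ∞ (ρ.prod ρ)) (S : BoundedOperatorField ρ H) :
    Fock w H →L[ℂ] Fock w H :=
  directSumDiag (operatorMulComponent w S) (max S.bound 0) fun k => by
    cases k with
    | zero => exact norm_zero.trans_le (le_max_right _ _)
    | succ k =>
      exact norm_pointwiseOp_le _ (S.aestronglyMeasurable_leftOp w k) _ (S.norm_leftOp_le w k)

/-- The operator field `1_A S`, for a bounded operator `S` and a measurable set `A`. -/
def indicatorField (ρ : Measure Ω) {A : Set Ω} (hA : MeasurableSet A) (S : H →L[ℂ] H) :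
    BoundedOperatorField ρ H where
  toFun := A.indicator fun _ => S
  measurable_apply := fun v => by
    refine ((stronglyMeasurable_const (b := S v)).indicator hA).aestronglyMeasurable.congr
      (Filter.Eventually.of_forall fun x => ?_)
    by_cases hx : x ∈ A <;> simp [hx]
  measurable_adjoint_apply := fun v => by
    refine ((stronglyMeasurable_const (b := ContinuousLinearMap.adjoint S v)).indicator
      hA).aestronglyMeasurable.congr (Filter.Eventually.of_forall fun x => ?_)
    by_cases hx : x ∈ A <;> simp [hx]
  essBounded := ⟨‖S‖, Filter.Eventually.of_forall fun x => norm_indicator_le_norm_self _ _⟩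

/-- The operator `α 𝔫(1_A) + ℓ(1_A h) + ℓ(1_A h)* + 𝔪(1_A S)` on the Fock space. -/
def fieldOperator (w : Lp ℝ ∞ (ρ.prod ρ)) {A : Set Ω} (hA : MeasurableSet A) (hAρ : ρ A ≠ ∞)
    (α : ℂ) (h : H) (S : H →L[ℂ] H) : Fock w H →L[ℂ] Fock w H :=
  α • scalarMul w H (indicatorConstLp 1 hA hAρ (1 : ℂ)) +
    creation w (indicatorConstLp 2 hA hAρ h) +
    ContinuousLinearMap.adjoint (creation w (indicatorConstLp 2 hA hAρ h)) +
    operatorMul w (indicatorField ρ hA S)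

end Fock

section Combinatorics

variable {k : ℕ}

/-- A partition of `{1, …, k}` (indexed here by `Fin k`) is non-crossing if there are no
`i < i₂ < j < j₂` with `i, j` in a block and `i₂, j₂` in a different block. -/
def IsNoncrossing (π : Finpartition (Finset.univ : Finset (Fin k))) : Prop :=
  ∀ B ∈ π.parts, ∀ B₂ ∈ π.parts, ∀ i i₂ j j₂ : Fin k, i < i₂ → i₂ < j → j < j₂ →
    i ∈ B → j ∈ B → i₂ ∈ B₂ → j₂ ∈ B₂ → B = B₂

/-- An interval partition: every block has the form `{i, …, j}`. -/
def IsIntervalPartition (π : Finpartition (Finset.univ : Finset (Fin k))) : Prop :=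
  ∀ B ∈ π.parts, ∃ i j : Fin k, i ≤ j ∧ B = Finset.Icc i j

/-- `B ≺ C`: the block `C` is nested inside `B`, that is, it lies strictly between two consecutive
elements `i < j` of `B`. -/
def Precedes (B C : Finset (Fin k)) : Prop :=
  ∃ i ∈ B, ∃ j ∈ B, i < j ∧ C ⊆ Finset.Ioo i j ∧ Finset.Ioo i j ⊆ Bᶜ

/-- The edges `B ⇝ C` of the nesting forest of `π`: the covering relation of `≺` on the blocks. -/
def NestingEdge (π : Finpartition (Finset.univ : Finset (Fin k))) (B C : π.parts) : Prop :=
  Precedes B.1 C.1 ∧ ¬ ∃ D : π.parts, Precedes B.1 D.1 ∧ Precedes D.1 C.1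

open Classical in
/-- The depth of a block in the nesting forest: the number of vertices on the path to it from the
root of its tree, that is, one more than the number of blocks in which it is nested. -/
def depth (π : Finpartition (Finset.univ : Finset (Fin k))) (C : π.parts) : ℕ :=
  (Finset.univ.filter fun B : π.parts => Precedes B.1 C.1).card + 1

open Classical in
/-- The predecessor of a block in the nesting forest (the block itself if there is none). -/
def pred (π : Finpartition (Finset.univ : Finset (Fin k))) (C : π.parts) : π.parts :=
  if h : ∃ B, NestingEdge π B C then h.choose else C

open Classical in
/-- The set `NC_k` of non-crossing partitions of `{1, …, k}`. -/
def noncrossingPartitions (k : ℕ) : Finset (Finpartition (Finset.univ : Finset (Fin k))) :=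
  Finset.univ.filter IsNoncrossing

open Classical in
/-- The set `I_k` of interval partitions of `{1, …, k}`. -/
def intervalPartitions (k : ℕ) : Finset (Finpartition (Finset.univ : Finset (Fin k))) :=
  Finset.univ.filter IsIntervalPartition

/-- The moment `m_k(μ)`. -/
def moment (μ : Measure ℝ) (k : ℕ) : ℝ := ∫ x, x ^ k ∂μ

/-- The boolean cumulant `κ_{bool,k}(μ)`, for `k ≥ 1`. -/
def booleanCumulant (μ : Measure ℝ) (k : ℕ) : ℝ :=
  ∑ π ∈ intervalPartitions k, (-1) ^ (π.parts.card - 1) * ∏ B ∈ π.parts, moment μ B.card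

/-- `κ_{bool,π}(μ)`, the product over the blocks `B` of `π` of `κ_{bool,|B|}(μ)`. -/
def booleanCumulantPartition (μ : Measure ℝ) (π : Finpartition (Finset.univ : Finset (Fin k))) :
    ℝ :=
  ∏ B ∈ π.parts, booleanCumulant μ B.card

/-- The product over the blocks `B` of depth greater than one of `w(ω_{pred(B)}, ω_B)`. -/
def nestingWeight {Ω : Type*} (w : Ω × Ω → ℝ) (π : Finpartition (Finset.univ : Finset (Fin k)))
    (ω : π.parts → Ω) : ℝ :=
  ∏ B : π.parts with 1 < depth π B, w (ω (pred π B), ω B)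

end Combinatorics

end FockModel

end

open FockModel

/-! The vacuum moments and the sum over non-crossing partitions satisfy the same recursion.

Operator side. For φ in L¹ write φ_w(x) = ∫ φ(y) w(x, y) dρ(y). The building blocks satisfy
ℓ(g)*ℓ(f) = 𝔫(⟨g, f⟩), 𝔪(T)ℓ(f) = ℓ(Tf) and 𝔫(φ)ℓ(f) = ℓ(φ_w f); moreover 𝔪(T) and ℓ(g)* annihilate
the vacuum ξ_F, and 𝔫(φ) multiplies it by ∫ φ dρ. The first relation holds because integrating φ
over the first coordinate of ρ_{k+1} leaves the factor φ_w (`adjoint_creation_creation`). By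
induction (`fieldOperator_pow_succ_vacuum`), X̂^{n+1} ξ_F = m_{n+1} ξ_F + Σ_{b+c=n} ℓ(t_b) X̂^c ξ_F,
where t_0 = 1_A h, t_{n+1} = S t_n + Σ_{b+c=n} E_b t_c on A, φ_0 = α 1_A, φ_{b+1} = 1_A ⟨h, t_b⟩,
E_b = (φ_b)_w, m_0 = 1 and m_{n+1} = Σ_{b+c=n} (∫ φ_b dρ) m_c. Creation operators have range
orthogonal to ξ_F, so m_n is the n-th vacuum moment.

Cumulants. Expanding X^n ξ in the block decomposition gives m_{n+1}(μ) = Σ_{b+c=n} κ_{b+1} m_c(μ)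
with κ_1 = α and κ_{r+2} = ⟨h, S^r h⟩, and this recursion determines the boolean cumulants
(`booleanCumulant_eq_of_recursion`). A block of size r + 2 thus reads: open with h, apply S for each
of the r inner elements, close with h*.

Combinatorial side. In a non-crossing partition of n + 1 points, the outermost block B below the
last point, with all that is nested in B, occupies the last b + 1 points for some b. Once ω_B = y is
fixed, the gaps of B are filled independently; let M_j(y) be the total weight of the fillings of a
gap of length j, whose outermost blocks carry w(y, ·). Summing κ_{|B|} times the product of the
M_j(y) over all shapes of B yields φ_b(y) (`closeFun`), because M_{n+1} = Σ_{b+c=n} E_b M_c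
(`treeFun_succ`). Hence the sum over partitions obeys the recursion of m_n (`treeSum_succ_eq_sum`).

For the inductions, a non-crossing partition is coded by a binary tree: remove the last point; the
left subtree is the partition up to the preceding point of its block, the right subtree is what is
nested in between. Block products and iterated integrals then follow the tree
(`Encodes.blockProd_eq`, `lmarginal_treeWeight`). -/

namespace FockModel

/-! ### Moments of spectral distributions -/

section SpectralMoments

variable {H : Type*} [NormedAddCommGroup H] [InnerProductSpace ℂ H] [CompleteSpace H]

/-- The continuous cutoff that is one on `[-R, R]` and zero outside `[-(R+1), R+1]`. -/
noncomputable def cutoff (R x : ℝ) : ℝ := max 0 (min 1 (R + 1 - |x|))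

theorem continuous_cutoff (R : ℝ) : Continuous (cutoff R) := by
  unfold cutoff; fun_prop

theorem cutoff_eq_one {R x : ℝ} (h : |x| ≤ R) : cutoff R x = 1 := by
  unfold cutoff
  rw [min_eq_left (by linarith), max_eq_right zero_le_one]

theorem cutoff_eq_zero {R x : ℝ} (h : R + 1 ≤ |x|) : cutoff R x = 0 := by
  unfold cutoff
  exact max_eq_left ((min_le_right _ _).trans (by linarith))

theorem cutoff_nonneg (R x : ℝ) : 0 ≤ cutoff R x := le_max_left _ _

/-- A continuous function multiplied by a cutoff, as a compactly supported function. -/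
noncomputable def cutoffMul (f : C(ℝ, ℝ)) (R : ℝ) : C_c(ℝ, ℝ) where
  toFun := fun x => f x * cutoff R x
  continuous_toFun := f.continuous.mul (continuous_cutoff R)
  hasCompactSupport' := by
    refine HasCompactSupport.intro (isCompact_closedBall (0 : ℝ) (R + 1)) fun x hx => ?_
    rw [Metric.mem_closedBall, dist_zero_right, Real.norm_eq_abs, not_le] at hx
    rw [cutoff_eq_zero hx.le, mul_zero]

/-- The factor `‖1‖` covers the zero space, where the identity has norm zero. -/
theorem abs_le_of_mem_spectrum (X : H →L[ℂ] H) {x : ℝ} (hx : x ∈ spectrum ℝ X) :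
    |x| ≤ ‖X‖ * ‖(1 : H →L[ℂ] H)‖ := by
  have := spectrum.subset_closedBall_norm_mul X hx
  rwa [Metric.mem_closedBall, dist_zero_right, Real.norm_eq_abs] at this

theorem integral_spectralDistribution (X : H →L[ℂ] H) (ξ : H) (f : C_c(ℝ, ℝ)) :
    ∫ x, f x ∂(spectralDistribution X ξ) = (⟪ξ, cfc (fun x => f x) X ξ⟫_ℂ).re :=
  RealRMK.integral_rieszMeasure _ _

/-- The functions max(0, |x| - R), cut off at n, vanish on the spectrum, so their integrals are
zero. Being nonnegative, they vanish almost everywhere, and the cutoffs exhaust the line. -/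
theorem ae_abs_le_spectralDistribution (X : H →L[ℂ] H) (ξ : H) :
    ∀ᵐ x ∂(spectralDistribution X ξ), |x| ≤ ‖X‖ * ‖(1 : H →L[ℂ] H)‖ := by
  set R := ‖X‖ * ‖(1 : H →L[ℂ] H)‖ with hR
  have : IsFiniteMeasureOnCompacts (spectralDistribution X ξ) := by
    unfold spectralDistribution; infer_instance
  have key : ∀ n : ℕ, ∀ᵐ x ∂(spectralDistribution X ξ), (max 0 (|x| - R)) * cutoff n x = 0 := by
    intro n
    let f : C_c(ℝ, ℝ) := cutoffMul ⟨fun x => max 0 (|x| - R), by fun_prop⟩ n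
    have hf : ∫ x, f x ∂(spectralDistribution X ξ) = 0 := by
      rw [integral_spectralDistribution]
      have : cfc (fun x => f x) X = cfc (fun _ => (0 : ℝ)) X := by
        refine cfc_congr fun x hx => ?_
        change max 0 (|x| - R) * cutoff n x = 0
        rw [max_eq_left (by linarith [abs_le_of_mem_spectrum X hx]), zero_mul]
      rw [this, cfc_const_zero]
      simp
    have hint : Integrable f (spectralDistribution X ξ) :=
      f.continuous.integrable_of_hasCompactSupport f.hasCompactSupport
    have := (integral_eq_zero_iff_of_nonneg
      (fun x => mul_nonneg (le_max_left 0 (|x| - R)) (cutoff_nonneg n x)) hint).1 hf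
    exact this
  filter_upwards [ae_all_iff.2 key] with x hx
  obtain ⟨n, hn⟩ := exists_nat_ge |x|
  have := hx n
  rw [cutoff_eq_one hn, mul_one] at this
  linarith [le_max_right 0 (|x| - R)]

/-- The Riesz measure is known only through compactly supported functions. Cutting off x^k outside
[-R, R] changes neither the integral, by the support bound, nor the functional calculus, by the
bound on the spectrum. -/
theorem moment_spectralDistribution (X : H →L[ℂ] H) (hX : IsSelfAdjoint X) (ξ : H) (k : ℕ) :
    Integrable (fun x : ℝ => x ^ k) (spectralDistribution X ξ) ∧
      moment (spectralDistribution X ξ) k = (⟪ξ, (X ^ k) ξ⟫_ℂ).re := by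
  set R := ‖X‖ * ‖(1 : H →L[ℂ] H)‖ with hR
  have : IsFiniteMeasureOnCompacts (spectralDistribution X ξ) := by
    unfold spectralDistribution; infer_instance
  let f : C_c(ℝ, ℝ) := cutoffMul ⟨fun x => x ^ k, by fun_prop⟩ R
  have hf : ∀ x : ℝ, f x = x ^ k * cutoff R x := fun x => rfl
  have hae : f =ᵐ[spectralDistribution X ξ] fun x => x ^ k := by
    filter_upwards [ae_abs_le_spectralDistribution X ξ] with x hx
    rw [hf, cutoff_eq_one hx, mul_one]
  refine ⟨(f.continuous.integrable_of_hasCompactSupport f.hasCompactSupport).congr hae, ?_⟩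
  rw [moment, ← integral_congr_ae hae, integral_spectralDistribution]
  have : cfc (fun x => f x) X = cfc (fun x : ℝ => x ^ k) X := by
    refine cfc_congr fun x hx => ?_
    rw [hf, cutoff_eq_one (abs_le_of_mem_spectrum X hx), mul_one]
  rw [this, cfc_pow_id X k]

end SpectralMoments

/-! ### Relations between creation, annihilation and multiplication operators -/

section FockAlgebra

universe u

variable {Ω : Type*} [MeasurableSpace Ω] {ρ : Measure Ω} [SigmaFinite ρ]
  {H : Type u} [NormedAddCommGroup H] [InnerProductSpace ℂ H]

theorem TensorPower.add_tmul {k : ℕ} (x y : H) (v : TensorPower H k) :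
    TensorPower.tmul (x + y) v = TensorPower.tmul x v + TensorPower.tmul y v :=
  (congrArg _ (TensorProduct.add_tmul x y v)).trans (TensorPower.ofTensor_add _ _)

theorem TensorPower.smul_tmul {k : ℕ} (c : ℂ) (x : H) (v : TensorPower H k) :
    TensorPower.tmul (c • x) v = c • TensorPower.tmul x v :=
  (congrArg _ (TensorProduct.smul_tmul' c x v).symm).trans (TensorPower.ofTensor_smul c _)

theorem creation_apply_zero (w : Lp ℝ ∞ (ρ.prod ρ)) (f : Lp H 2 ρ) (v : Fock w H) :
    creation w f v 0 = 0 := rfl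

theorem creation_apply_succ (w : Lp ℝ ∞ (ρ.prod ρ)) (f : Lp H 2 ρ) (v : Fock w H) (k : ℕ) :
    creation w f v (k + 1) = creationComponent w f k (v k) := rfl

theorem creationComponent_add (w : Lp ℝ ∞ (ρ.prod ρ)) (f g : Lp H 2 ρ) (k : ℕ)
    (v : FockComponent w H k) :
    creationComponent w (f + g) k v = creationComponent w f k v + creationComponent w g k v := by
  refine Lp.ext ?_
  filter_upwards [coeFn_creationComponent w (f + g) k v,
    coeFn_creationComponent w f k v, coeFn_creationComponent w g k v,
    Lp.coeFn_add (creationComponent w f k v) (creationComponent w g k v),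
    (quasiMeasurePreserving_eval_chainMeasure w (k + 1) 0).ae (Lp.coeFn_add f g)]
    with ω h1 h2 h3 h4 h5
  rw [h1, h4, Pi.add_apply, h2, h3, h5, Pi.add_apply, TensorPower.add_tmul]

theorem creationComponent_smul (w : Lp ℝ ∞ (ρ.prod ρ)) (c : ℂ) (f : Lp H 2 ρ) (k : ℕ)
    (v : FockComponent w H k) :
    creationComponent w (c • f) k v = c • creationComponent w f k v := by
  refine Lp.ext ?_
  filter_upwards [coeFn_creationComponent w (c • f) k v,
    coeFn_creationComponent w f k v,
    Lp.coeFn_smul c (creationComponent w f k v),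
    (quasiMeasurePreserving_eval_chainMeasure w (k + 1) 0).ae (Lp.coeFn_smul c f)]
    with ω h1 h2 h3 h4
  rw [h1, h3, Pi.smul_apply, h2, h4, Pi.smul_apply, TensorPower.smul_tmul]

theorem creation_add (w : Lp ℝ ∞ (ρ.prod ρ)) (f g : Lp H 2 ρ) :
    creation w (f + g) = creation w f + creation w g := by
  ext1 v
  refine lp.ext (funext fun k => ?_)
  rw [_root_.add_apply, lp.coeFn_add, Pi.add_apply]
  cases k with
  | zero => rw [creation_apply_zero, creation_apply_zero, creation_apply_zero, add_zero]
  | succ k =>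
    rw [creation_apply_succ, creation_apply_succ, creation_apply_succ, creationComponent_add]

theorem creation_smul (w : Lp ℝ ∞ (ρ.prod ρ)) (c : ℂ) (f : Lp H 2 ρ) :
    creation w (c • f) = c • creation w f := by
  ext1 v
  refine lp.ext (funext fun k => ?_)
  rw [_root_.smul_apply, lp.coeFn_smul, Pi.smul_apply]
  cases k with
  | zero => rw [creation_apply_zero, creation_apply_zero, smul_zero]
  | succ k => rw [creation_apply_succ, creation_apply_succ, creationComponent_smul]

/-- The creation operator `ℓ(f)` as a linear function of `f`. -/
noncomputable def creationLinear (w : Lp ℝ ∞ (ρ.prod ρ)) (H : Type u) [NormedAddCommGroup H]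
    [InnerProductSpace ℂ H] : Lp H 2 ρ →ₗ[ℂ] (Fock w H →L[ℂ] Fock w H) where
  toFun := creation w
  map_add' := creation_add w
  map_smul' := creation_smul w

theorem creationLinear_apply (w : Lp ℝ ∞ (ρ.prod ρ)) (f : Lp H 2 ρ) :
    creationLinear w H f = creation w f := rfl

theorem scalarMul_apply (w : Lp ℝ ∞ (ρ.prod ρ)) (φ : Lp ℂ 1 ρ) (v : Fock w H) (k : ℕ) :
    scalarMul w H φ v k = scalarMulComponent w H φ k (v k) := rfl

theorem coeFn_scalarMulComponent (w : Lp ℝ ∞ (ρ.prod ρ)) (φ : Lp ℂ 1 ρ) (k : ℕ)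
    (v : FockComponent w H (k + 1)) :
    scalarMulComponent w H φ (k + 1) v =ᵐ[chainMeasure w (k + 1)]
      fun ω => weightedIntegral w φ (ω 0) • v ω :=
  coeFn_pointwiseOp _ (aestronglyMeasurable_weightedIntegral_smul w φ k) _
    (norm_weightedIntegral_smul_le w φ k) v

/-- Multiplication by a function of the first coordinate is absorbed into the created function.
Together with `operatorMul_creation`, this keeps the powers of X̂ on the vacuum in the form of sums
of vectors ℓ(t) X̂^c ξ_F. -/
theorem scalarMul_creation (w : Lp ℝ ∞ (ρ.prod ρ)) (φ : Lp ℂ 1 ρ) {f g : Lp H 2 ρ}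
    (hg : ∀ᵐ x ∂ρ, g x = weightedIntegral w φ x • f x) (v : Fock w H) :
    scalarMul w H φ (creation w f v) = creation w g v := by
  refine lp.ext (funext fun k => ?_)
  rw [scalarMul_apply]
  cases k with
  | zero => rw [creation_apply_zero, creation_apply_zero, map_zero]
  | succ k =>
    rw [creation_apply_succ, creation_apply_succ]
    refine Lp.ext ?_
    filter_upwards [coeFn_scalarMulComponent w φ k (creationComponent w f k (v k)),
      coeFn_creationComponent w f k (v k), coeFn_creationComponent w g k (v k),
      (quasiMeasurePreserving_eval_chainMeasure w (k + 1) 0).ae hg] with ω h1 h2 h3 h4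
    rw [h1, h2, h3, h4, TensorPower.smul_tmul]

section OperatorMul

variable [CompleteSpace H]

theorem operatorMul_apply (w : Lp ℝ ∞ (ρ.prod ρ)) (S : BoundedOperatorField ρ H) (v : Fock w H)
    (k : ℕ) : operatorMul w S v k = operatorMulComponent w S k (v k) := rfl

theorem coeFn_operatorMulComponent (w : Lp ℝ ∞ (ρ.prod ρ)) (S : BoundedOperatorField ρ H) (k : ℕ)
    (v : FockComponent w H (k + 1)) :
    operatorMulComponent w S (k + 1) v =ᵐ[chainMeasure w (k + 1)]
      fun ω => TensorPower.leftOp (S.toFun (ω 0)) (v ω) :=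
  coeFn_pointwiseOp _ (S.aestronglyMeasurable_leftOp w k) _ (S.norm_leftOp_le w k) v

theorem operatorMul_creation (w : Lp ℝ ∞ (ρ.prod ρ))
    (S : BoundedOperatorField ρ H) {f g : Lp H 2 ρ}
    (hg : ∀ᵐ x ∂ρ, g x = S.toFun x (f x)) (v : Fock w H) :
    operatorMul w S (creation w f v) = creation w g v := by
  refine lp.ext (funext fun k => ?_)
  rw [operatorMul_apply]
  cases k with
  | zero => rw [creation_apply_zero, creation_apply_zero, map_zero]
  | succ k =>
    rw [creation_apply_succ, creation_apply_succ]
    refine Lp.ext ?_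
    filter_upwards [coeFn_operatorMulComponent w S k (creationComponent w f k (v k)),
      coeFn_creationComponent w f k (v k), coeFn_creationComponent w g k (v k),
      (quasiMeasurePreserving_eval_chainMeasure w (k + 1) 0).ae hg] with ω h1 h2 h3 h4
    rw [h1, h2, h3, h4, TensorPower.leftOp_tmul]

end OperatorMul

omit [SigmaFinite ρ] in
theorem vacuum_apply_succ (w : Lp ℝ ∞ (ρ.prod ρ)) (k : ℕ) : vacuum w H (k + 1) = 0 :=
  lp.single_apply_ne _ _ _ (Nat.succ_ne_zero k)

theorem scalarMul_vacuum (w : Lp ℝ ∞ (ρ.prod ρ)) (φ : Lp ℂ 1 ρ) :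
    scalarMul w H φ (vacuum w H) = (∫ y, φ y ∂ρ) • vacuum w H := by
  refine lp.ext (funext fun k => ?_)
  rw [scalarMul_apply, lp.coeFn_smul, Pi.smul_apply]
  cases k with
  | zero => rw [scalarMulComponent, _root_.smul_apply, ContinuousLinearMap.id_apply]
  | succ k => rw [vacuum_apply_succ, map_zero, smul_zero]

theorem operatorMul_vacuum [CompleteSpace H] (w : Lp ℝ ∞ (ρ.prod ρ))
    (S : BoundedOperatorField ρ H) : operatorMul w S (vacuum w H) = 0 := by
  refine lp.ext (funext fun k => ?_)
  rw [operatorMul_apply]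
  cases k with
  | zero => rw [operatorMulComponent, _root_.zero_apply, lp.coeFn_zero, Pi.zero_apply]
  | succ k => rw [vacuum_apply_succ, map_zero, lp.coeFn_zero, Pi.zero_apply]

omit [SigmaFinite ρ] in
theorem inner_vacuum (w : Lp ℝ ∞ (ρ.prod ρ)) (v : Fock w H) :
    ⟪vacuum w H, v⟫_ℂ =
      ⟪(Lp.const 2 (chainMeasure w 0) (TensorPower.ofScalar H 1) : FockComponent w H 0), v 0⟫_ℂ :=
  lp.inner_single_left _ _ _

theorem inner_vacuum_creation (w : Lp ℝ ∞ (ρ.prod ρ)) (f : Lp H 2 ρ) (v : Fock w H) :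
    ⟪vacuum w H, creation w f v⟫_ℂ = 0 := by
  rw [inner_vacuum, creation_apply_zero, inner_zero_right]

omit [SigmaFinite ρ] in
theorem inner_vacuum_self (w : Lp ℝ ∞ (ρ.prod ρ)) : ⟪vacuum w H, vacuum w H⟫_ℂ = 1 := by
  have h : ‖vacuum w H‖ = 1 := by
    have h1 : ‖TensorPower.ofScalar H 1‖ = 1 := (norm_one : ‖(1 : ℂ)‖ = 1)
    rw [vacuum, lp.norm_single (by norm_num), Lp.norm_const' (p := 2) (μ := chainMeasure w 0)
      (c := TensorPower.ofScalar H 1) two_ne_zero ENNReal.ofNat_ne_top, h1]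
    simp
  rw [inner_self_eq_norm_sq_to_K, h]
  norm_num

theorem adjoint_creation_vacuum (w : Lp ℝ ∞ (ρ.prod ρ)) (f : Lp H 2 ρ) :
    ContinuousLinearMap.adjoint (creation w f) (vacuum w H) = 0 := by
  refine ext_inner_right ℂ fun v => ?_
  rw [ContinuousLinearMap.adjoint_inner_left, inner_vacuum_creation, inner_zero_left]

/-- The factor of the density of `ρ_{k+1}` that involves the first coordinate. -/
noncomputable def headDensity (w : Ω × Ω → ℝ) : (k : ℕ) → Ω × (Fin k → Ω) → ℝ
  | 0, _ => 1
  | _ + 1, p => max (w (p.2 0, p.1)) 0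

theorem measurable_headDensity {w : Ω × Ω → ℝ} (hw : Measurable w) (k : ℕ) :
    Measurable (headDensity w k) := by
  cases k with
  | zero => exact measurable_const
  | succ k => unfold headDensity; fun_prop

omit [MeasurableSpace Ω] in
theorem headDensity_nonneg (w : Ω × Ω → ℝ) (k : ℕ) (p : Ω × (Fin k → Ω)) :
    0 ≤ headDensity w k p := by
  cases k with
  | zero => exact zero_le_one
  | succ k => exact le_max_right _ _

/-- The truncation in `headDensity` mirrors that of `ENNReal.ofReal`, so the identity holds at every
point. For k = 0 there is no pair of adjacent coordinates, whence the factor 1. -/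
theorem chainDensity_cons (w : Ω × Ω → ℝ) (k : ℕ) (p : Ω × (Fin k → Ω)) :
    chainDensity w (k + 1) (consEquiv Ω k p) =
      chainDensity w k p.2 * ENNReal.ofReal (headDensity w k p) := by
  rw [consEquiv_apply]
  cases k with
  | zero => simp [chainDensity, headDensity]
  | succ k =>
    simp only [chainDensity, headDensity]
    rw [Fin.prod_univ_succ, mul_comm]
    congr 1
    simp [ENNReal.ofReal, Real.toNNReal]

theorem chainMeasure_succ (w : Lp ℝ ∞ (ρ.prod ρ)) (k : ℕ) :
    chainMeasure w (k + 1) = ((ρ.prod (chainMeasure w k)).withDensity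
      fun p => ENNReal.ofReal (headDensity w k p)).map (consEquiv Ω k) := by
  have hm := measurable_chainDensity (measurable_weight w)
  have hh : Measurable fun p => ENNReal.ofReal (headDensity w k p) :=
    (measurable_headDensity (measurable_weight w) k).ennreal_ofReal
  rw [chainMeasure, chainMeasure, prod_withDensity_right (hm k),
    ← (measurePreserving_consEquiv ρ k).map_eq]
  have h := withDensity_mul (ρ.prod (Measure.pi fun _ : Fin k => ρ))
    ((hm k).comp measurable_snd) hh
  simp only [Function.comp_def] at h
  rw [← h]
  refine Measure.ext fun s hs => ?_
  rw [withDensity_apply _ hs, (consEquiv Ω k).map_apply, Measure.restrict_map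
    (consEquiv Ω k).measurable hs, lintegral_map_equiv,
    withDensity_apply _ ((consEquiv Ω k).measurable hs)]
  exact lintegral_congr fun p => chainDensity_cons w k p

/-- The first coordinate enters ρ_{k+1} only through ρ and the factor w(ω_2, ω_1). Integrating it
out by Fubini turns ⟨g, f⟩ into the multiplier of 𝔫(φ): ∫ φ(y) w(ω_2, y) dρ(y) for k ≥ 1, and ∫ φ dρ
for k = 0. -/
theorem inner_creationComponent {w : Lp ℝ ∞ (ρ.prod ρ)} (hw : 0 ≤ w) (f g : Lp H 2 ρ)
    (φ : Lp ℂ 1 ρ) (hφ : ∀ᵐ x ∂ρ, φ x = ⟪g x, f x⟫_ℂ) (k : ℕ) (u v : FockComponent w H k) :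
    ⟪creationComponent w g k u, creationComponent w f k v⟫_ℂ =
      ⟪u, scalarMulComponent w H φ k v⟫_ℂ := by
  set F : (Fin (k + 1) → Ω) → ℂ := fun ω => φ (ω 0) * ⟪u (Fin.tail ω), v (Fin.tail ω)⟫_ℂ with hF
  have hae : (fun ω => ⟪creationComponent w g k u ω, creationComponent w f k v ω⟫_ℂ)
      =ᵐ[chainMeasure w (k + 1)] F := by
    filter_upwards [coeFn_creationComponent w g k u, coeFn_creationComponent w f k v,
      (quasiMeasurePreserving_eval_chainMeasure w (k + 1) 0).ae hφ] with ω h1 h2 h3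
    rw [h1, h2, TensorPower.inner_tmul, hF]
    simp only [h3]
  have hint : Integrable F (chainMeasure w (k + 1)) :=
    (L2.integrable_inner (𝕜 := ℂ) _ _).congr hae
  have hmd : Measurable fun p => (headDensity w k p).toNNReal :=
    (measurable_headDensity (measurable_weight w) k).real_toNNReal
  have hcomp : ∀ p : Ω × (Fin k → Ω), F (consEquiv Ω k p) = φ p.1 * ⟪u p.2, v p.2⟫_ℂ := by
    intro p
    rw [hF, consEquiv_apply]
    simp
  have hint2 : Integrable (fun p : Ω × (Fin k → Ω) =>
      headDensity w k p • (φ p.1 * ⟪u p.2, v p.2⟫_ℂ)) (ρ.prod (chainMeasure w k)) := by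
    rw [chainMeasure_succ, integrable_map_equiv] at hint
    have := (integrable_withDensity_iff_integrable_smul hmd).1 hint
    refine this.congr (Filter.Eventually.of_forall fun p => ?_)
    simp only [Function.comp_apply, hcomp]
    rw [NNReal.smul_def, Real.coe_toNNReal _ (headDensity_nonneg _ _ _)]
  rw [L2.inner_def, integral_congr_ae hae, chainMeasure_succ, integral_map_equiv]
  have h1 := integral_withDensity_eq_integral_smul (μ := ρ.prod (chainMeasure w k)) hmd
    (fun p => F (consEquiv Ω k p))
  change ∫ p, F (consEquiv Ω k p) ∂((ρ.prod (chainMeasure w k)).withDensity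
    fun p => ((headDensity w k p).toNNReal : ℝ≥0∞)) = _
  rw [h1]
  have h2 : ∀ p : Ω × (Fin k → Ω), (headDensity w k p).toNNReal • F (consEquiv Ω k p) =
      headDensity w k p • (φ p.1 * ⟪u p.2, v p.2⟫_ℂ) := by
    intro p
    rw [hcomp, NNReal.smul_def, Real.coe_toNNReal _ (headDensity_nonneg _ _ _)]
  simp_rw [h2]
  -- The created coordinate becomes the inner variable of integration.
  rw [integral_prod_symm _ hint2, L2.inner_def]
  cases k with
  | zero =>
    refine integral_congr_ae (((Lp.coeFn_smul (∫ y, φ y ∂ρ) v)).mono fun ω hω => ?_)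
    change ∫ y, (1 : ℝ) • (φ y * ⟪u ω, v ω⟫_ℂ) ∂ρ =
      ⟪u ω, ((∫ y, φ y ∂ρ) • v : FockComponent w H 0) ω⟫_ℂ
    rw [hω, Pi.smul_apply, inner_smul_right]
    simp only [one_smul]
    rw [integral_mul_const]
  | succ k =>
    -- Positivity of w removes the truncation in `headDensity`, but only almost everywhere.
    have hw0 : ∀ᵐ x ∂ρ, ∀ᵐ y ∂ρ, 0 ≤ w (x, y) :=
      Measure.ae_ae_of_ae_prod ((Lp.coeFn_nonneg w).2 hw)
    refine integral_congr_ae ?_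
    filter_upwards [coeFn_scalarMulComponent w φ k v,
      (quasiMeasurePreserving_eval_chainMeasure w (k + 1) 0).ae hw0] with ω h1 h2
    rw [h1]
    change ∫ y, (max (w (ω 0, y)) 0 : ℝ) • (φ y * ⟪u ω, v ω⟫_ℂ) ∂ρ = _
    rw [inner_smul_right, weightedIntegral, ← integral_mul_const]
    refine integral_congr_ae (h2.mono fun y hy => ?_)
    simp only
    rw [max_eq_left hy, Complex.real_smul]
    ring

theorem adjoint_creation_creation {w : Lp ℝ ∞ (ρ.prod ρ)} (hw : 0 ≤ w) (f g : Lp H 2 ρ)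
    (φ : Lp ℂ 1 ρ) (hφ : ∀ᵐ x ∂ρ, φ x = ⟪g x, f x⟫_ℂ) (v : Fock w H) :
    ContinuousLinearMap.adjoint (creation w g) (creation w f v) = scalarMul w H φ v := by
  refine ext_inner_left ℂ fun u => ?_
  have h1 := (lp.summable_inner (𝕜 := ℂ) (creation w g u) (creation w f v)).tsum_eq_zero_add
  rw [creation_apply_zero, inner_zero_left, zero_add] at h1
  rw [ContinuousLinearMap.adjoint_inner_right, lp.inner_eq_tsum, lp.inner_eq_tsum, h1]
  refine tsum_congr fun k => ?_
  rw [creation_apply_succ, creation_apply_succ, scalarMul_apply]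
  exact inner_creationComponent hw f g φ hφ k (u k) (v k)

theorem isSelfAdjoint_pointwiseOp {α : Type*} [MeasurableSpace α] {μ : Measure α}
    {E : Type*} [NormedAddCommGroup E] [InnerProductSpace ℂ E] [CompleteSpace E]
    (T : α → E →L[ℂ] E) (hT : ∀ v, AEStronglyMeasurable (fun a => T a v) μ) (C : ℝ)
    (hC : ∀ᵐ a ∂μ, ‖T a‖ ≤ C) (hs : ∀ᵐ a ∂μ, IsSelfAdjoint (T a)) :
    IsSelfAdjoint (pointwiseOp T hT C hC) := by
  rw [ContinuousLinearMap.isSelfAdjoint_iff_isSymmetric]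
  intro f g
  change ⟪pointwiseOp T hT C hC f, g⟫_ℂ = ⟪f, pointwiseOp T hT C hC g⟫_ℂ
  rw [L2.inner_def, L2.inner_def]
  refine integral_congr_ae ?_
  filter_upwards [coeFn_pointwiseOp T hT C hC f, coeFn_pointwiseOp T hT C hC g, hs] with a h1 h2 h3
  rw [h1, h2]
  exact (ContinuousLinearMap.isSelfAdjoint_iff_isSymmetric.1 h3) (f a) (g a)

theorem isSelfAdjoint_directSumDiag {G : ℕ → Type*} [∀ k, NormedAddCommGroup (G k)]
    [∀ k, InnerProductSpace ℂ (G k)] [∀ k, CompleteSpace (G k)] (T : ∀ k, G k →L[ℂ] G k) (C : ℝ)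
    (hC : ∀ k, ‖T k‖ ≤ C) (hs : ∀ k, IsSelfAdjoint (T k)) :
    IsSelfAdjoint (directSumDiag T C hC) := by
  rw [ContinuousLinearMap.isSelfAdjoint_iff_isSymmetric]
  intro f g
  change ⟪directSumDiag T C hC f, g⟫_ℂ = ⟪f, directSumDiag T C hC g⟫_ℂ
  rw [lp.inner_eq_tsum, lp.inner_eq_tsum]
  exact tsum_congr fun k =>
    (ContinuousLinearMap.isSelfAdjoint_iff_isSymmetric.1 (hs k)) (f k) (g k)

theorem isSelfAdjoint_leftOp {k : ℕ} [CompleteSpace H] {S : H →L[ℂ] H} (hS : IsSelfAdjoint S) :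
    IsSelfAdjoint (TensorPower.leftOp (k := k) S) := by
  rw [ContinuousLinearMap.isSelfAdjoint_iff_isSymmetric] at hS ⊢
  intro a b
  change ⟪TensorPower.leftOp S a, b⟫_ℂ = ⟪a, TensorPower.leftOp S b⟫_ℂ
  refine TensorPower.induction_tmul
    (p := fun a => ⟪TensorPower.leftOp S a, b⟫_ℂ = ⟪a, TensorPower.leftOp S b⟫_ℂ)
    ?_ (fun x v => ?_) (fun v v' h h2 => ?_) a
  · exact isClosed_eq (by fun_prop) (by fun_prop)
  · refine TensorPower.induction_tmul
      (p := fun b => ⟪TensorPower.leftOp S (TensorPower.tmul x v), b⟫_ℂ =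
        ⟪TensorPower.tmul x v, TensorPower.leftOp S b⟫_ℂ)
      ?_ (fun y v' => ?_) (fun v v' h h2 => ?_) b
    · exact isClosed_eq (by fun_prop) (by fun_prop)
    · rw [TensorPower.leftOp_tmul, TensorPower.leftOp_tmul, TensorPower.inner_tmul,
        TensorPower.inner_tmul]
      congr 1
      exact hS x y
    · rw [map_add, inner_add_right, inner_add_right, h, h2]
  · rw [map_add, inner_add_left, inner_add_left, h, h2]

theorem isSelfAdjoint_smul_id {E : Type*} [NormedAddCommGroup E] [InnerProductSpace ℂ E]
    [CompleteSpace E] {c : ℂ} (hc : (starRingEnd ℂ) c = c) :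
    IsSelfAdjoint (c • ContinuousLinearMap.id ℂ E) :=
  IsSelfAdjoint.smul hc (IsSelfAdjoint.one (E →L[ℂ] E))

theorem isSelfAdjoint_scalarMul (w : Lp ℝ ∞ (ρ.prod ρ)) (φ : Lp ℂ 1 ρ)
    (hφ : ∀ᵐ x ∂ρ, (starRingEnd ℂ) (φ x) = φ x) : IsSelfAdjoint (scalarMul w H φ) := by
  refine isSelfAdjoint_directSumDiag _ _ _ fun k => ?_
  cases k with
  | zero =>
    refine isSelfAdjoint_smul_id ?_
    rw [← integral_conj]
    exact integral_congr_ae hφ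
  | succ k =>
    refine isSelfAdjoint_pointwiseOp _ (aestronglyMeasurable_weightedIntegral_smul w φ k) _
      (norm_weightedIntegral_smul_le w φ k) (Filter.Eventually.of_forall fun ω => ?_)
    refine isSelfAdjoint_smul_id ?_
    rw [weightedIntegral, ← integral_conj]
    refine integral_congr_ae (hφ.mono fun y hy => ?_)
    simp only [map_mul, hy, Complex.conj_ofReal]

theorem isSelfAdjoint_operatorMul [CompleteSpace H] (w : Lp ℝ ∞ (ρ.prod ρ))
    (S : BoundedOperatorField ρ H) (hS : ∀ x, IsSelfAdjoint (S.toFun x)) :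
    IsSelfAdjoint (operatorMul w S) := by
  refine isSelfAdjoint_directSumDiag _ _ _ fun k => ?_
  cases k with
  | zero => exact IsSelfAdjoint.zero _
  | succ k =>
    exact isSelfAdjoint_pointwiseOp _ (S.aestronglyMeasurable_leftOp w k) _ (S.norm_leftOp_le w k)
      (Filter.Eventually.of_forall fun ω => isSelfAdjoint_leftOp (hS _))

theorem isSelfAdjoint_fieldOperator [CompleteSpace H] (w : Lp ℝ ∞ (ρ.prod ρ)) {A : Set Ω}
    (hA : MeasurableSet A) (hAρ : ρ A ≠ ∞) {α : ℂ} (hα : (starRingEnd ℂ) α = α) (h : H)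
    {S : H →L[ℂ] H} (hS : IsSelfAdjoint S) : IsSelfAdjoint (fieldOperator w hA hAρ α h S) := by
  unfold fieldOperator
  -- Groups ℓ + ℓ*, which is self-adjoint as a whole.
  rw [add_assoc (α • _)]
  refine ((IsSelfAdjoint.smul hα (isSelfAdjoint_scalarMul w _ ?_)).add ?_).add
    (isSelfAdjoint_operatorMul w _ fun x => ?_)
  · filter_upwards [indicatorConstLp_coeFn (p := 1) (hs := hA) (hμs := hAρ) (c := (1 : ℂ))]
      with x hx
    rw [hx]
    by_cases h : x ∈ A <;> simp [h]
  · rw [← ContinuousLinearMap.star_eq_adjoint]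
    exact IsSelfAdjoint.add_star_self _
  · change IsSelfAdjoint (A.indicator (fun _ => S) x)
    by_cases h : x ∈ A <;> simp [h, hS]

end FockAlgebra

/-! ### Binary trees as codes of non-crossing partitions -/

section Trees

open BinaryTree

/-- The function `f` maps each element of `[a, b)` to the least element of its block in a
noncrossing partition of `[a, b)`. -/
structure IsLeader (f : ℕ → ℕ) (a b : ℕ) : Prop where
  le_apply : ∀ j, a ≤ j → j < b → a ≤ f j
  apply_le : ∀ j, a ≤ j → j < b → f j ≤ j
  apply_apply : ∀ j, a ≤ j → j < b → f (f j) = f j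
  noncrossing : ∀ j k, a ≤ j → j ≤ k → k < b → f k ≤ j → f k ≤ f j

theorem IsLeader.mono {f : ℕ → ℕ} {a b c : ℕ} (h : IsLeader f a b) (hc : c ≤ b) :
    IsLeader f a c where
  le_apply j h1 h2 := h.le_apply j h1 (by omega)
  apply_le j h1 h2 := h.apply_le j h1 (by omega)
  apply_apply j h1 h2 := h.apply_apply j h1 (by omega)
  noncrossing j k h1 h2 h3 := h.noncrossing j k h1 h2 (by omega)

/-- The binary tree `t` encodes the noncrossing partition of the interval of length `|t|` starting
at `a` whose leader function is `f`: at a node, the last element of the interval is a singleton if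
the left subtree is empty, and otherwise it is joined to the block of the last element of the
interval of the left subtree. -/
def Encodes (f : ℕ → ℕ) : BinaryTree Unit → ℕ → Prop
  | .nil, _ => True
  | .node _ l r, a => Encodes f l a ∧ Encodes f r (a + l.numNodes) ∧
      f (a + l.numNodes + r.numNodes) =
        if l.numNodes = 0 then a + l.numNodes + r.numNodes else f (a + l.numNodes - 1)

theorem Encodes.congr {f g : ℕ → ℕ} {t : BinaryTree Unit} {a : ℕ} (h : Encodes f t a)
    (hfg : ∀ j, a ≤ j → j < a + t.numNodes → f j = g j) : Encodes g t a := by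
  induction t generalizing a with
  | nil => trivial
  | node u l r ihl ihr =>
    obtain ⟨h1, h2, h3⟩ := h
    simp only [numNodes] at hfg
    refine ⟨ihl h1 fun j _ _ => hfg j (by omega) (by omega),
      ihr h2 fun j _ _ => hfg j (by omega) (by omega), ?_⟩
    rw [← hfg _ (by omega) (by omega), h3]
    split_ifs with h
    · rfl
    · rw [hfg _ (by omega) (by omega)]

theorem exists_encodes (t : BinaryTree Unit) (a : ℕ) : ∃ f, Encodes f t a := by
  induction t generalizing a with
  | nil => exact ⟨id, trivial⟩
  | node u l r ihl ihr =>
    obtain ⟨f, hf⟩ := ihl a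
    obtain ⟨g, hg⟩ := ihr (a + l.numNodes)
    refine ⟨fun j => if j < a + l.numNodes then f j else if j < a + l.numNodes + r.numNodes then g j
      else if l.numNodes = 0 then j else f (a + l.numNodes - 1), hf.congr fun j h1 h2 => ?_,
      hg.congr fun j h1 h2 => ?_, ?_⟩
    · grind
    · grind
    · grind

/-- Leaders of the right interval stay in the right interval, and the last element is either a
singleton or inherits a leader of the left interval; so the new element crosses no block. -/
theorem Encodes.isLeader {f : ℕ → ℕ} {t : BinaryTree Unit} {a : ℕ} (h : Encodes f t a) :
    IsLeader f a (a + t.numNodes) := by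
  induction t generalizing a with
  | nil =>
    simp only [numNodes]
    constructor <;> intros <;> omega
  | node u l r ihl ihr =>
    obtain ⟨h1, h2, h3⟩ := h
    have hl := ihl h1
    have hr := ihr h2
    simp only [numNodes]
    have hb : ∀ j, j < a + (l.numNodes + r.numNodes + 1) → j < a + l.numNodes ∨
      (a + l.numNodes ≤ j ∧ j < a + l.numNodes + r.numNodes) ∨
        j = a + l.numNodes + r.numNodes := by omega
    constructor
    · intro j ha hj
      rcases hb j hj with hj | hj | rfl
      · exact hl.le_apply j ha hj
      · have := hr.le_apply j hj.1 hj.2; omega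
      · rw [h3]
        split_ifs with h0
        · omega
        · exact hl.le_apply _ (by omega) (by omega)
    · intro j ha hj
      rcases hb j hj with hj | hj | rfl
      · exact hl.apply_le j ha hj
      · exact hr.apply_le j hj.1 hj.2
      · rw [h3]
        split_ifs with h0
        · omega
        · have := hl.apply_le (a + l.numNodes - 1) (by omega) (by omega)
          omega
    · intro j ha hj
      rcases hb j hj with hj | hj | rfl
      · exact hl.apply_apply j ha hj
      · exact hr.apply_apply j hj.1 hj.2
      · rw [h3]
        split_ifs with h0
        · rw [h3, if_pos h0]
        · exact hl.apply_apply _ (by omega) (by omega)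
    · intro j k ha hjk hk hkj
      rcases hb k hk with hk | hk | rfl
      · exact hl.noncrossing j k ha hjk hk hkj
      · have := hr.le_apply k hk.1 hk.2
        exact hr.noncrossing j k (by omega) hjk hk.2 hkj
      · rw [h3] at hkj ⊢
        split_ifs at hkj ⊢ with h0
        · have : j = a + l.numNodes + r.numNodes := by omega
          rw [this, h3, if_pos h0]
        · rcases hb j (by omega) with hj | hj | rfl
          · exact hl.noncrossing j _ ha (by omega) (by omega) hkj
          · have h4 := hr.le_apply j hj.1 hj.2
            have h5 := hl.apply_le (a + l.numNodes - 1) (by omega) (by omega)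
            omega
          · rw [h3, if_neg h0]

/-- If the last element is not its own leader, let c be the preceding element of its block. The left
subtree encodes the elements up to c, the right subtree those strictly between c and the last
element. -/
theorem IsLeader.exists_encodes {f : ℕ → ℕ} (n a : ℕ) (h : IsLeader f a (a + n)) :
    ∃ t : BinaryTree Unit, t.numNodes = n ∧ Encodes f t a := by
  induction n using Nat.strong_induction_on generalizing a with
  | h n ih =>
    cases n with
    | zero => exact ⟨.nil, rfl, trivial⟩
    | succ n =>
      by_cases hb : f (a + n) = a + n
      · obtain ⟨r, hr, hrf⟩ := ih n (by omega) a (h.mono (by omega))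
        refine ⟨.node () .nil r, ?_, trivial, ?_, ?_⟩
        · simp only [numNodes]; omega
        · simpa [numNodes] using hrf
        · simp [numNodes, hr, hb]
      · have h1 := h.le_apply (a + n) (by omega) (by omega)
        have h2 := h.apply_le (a + n) (by omega) (by omega)
        have h3 := h.apply_apply (a + n) (by omega) (by omega)
        obtain ⟨c, hc, hcmax⟩ := ((Finset.Ico a (a + n)).filter fun j => f j = f (a + n)).exists_max_image
          id ⟨f (a + n), by simp; omega⟩
        simp only [Finset.mem_filter, Finset.mem_Ico, id] at hc hcmax
        obtain ⟨⟨hc1, hc2⟩, hc3⟩ := hc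
        -- The gap after c is closed under f: a leader f j ≤ c would be squeezed by the non-crossing
        -- condition, from both sides, to f (a + n), against the maximality of c.
        have hge : ∀ j, c + 1 ≤ j → j < a + n → c + 1 ≤ f j := by
          intro j hj1 hj2
          by_contra hlt
          have h4 := h.noncrossing c j hc1 (by omega) (by omega) (by omega)
          have h5 := h.noncrossing j (a + n) (by omega) (by omega) (by omega)
            (by have := h.apply_le c hc1 (by omega); omega)
          have := hcmax j ⟨⟨by omega, hj2⟩, by omega⟩
          omega
        obtain ⟨l, hl, hlf⟩ := ih (c + 1 - a) (by omega) a (h.mono (by omega))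
        obtain ⟨r, hr, hrf⟩ := ih (a + n - (c + 1)) (by omega) (c + 1)
          { le_apply := fun j h4 h5 => hge j h4 (by omega)
            apply_le := fun j h4 h5 => h.apply_le j (by omega) (by omega)
            apply_apply := fun j h4 h5 => h.apply_apply j (by omega) (by omega)
            noncrossing := fun j k h4 h5 h6 => h.noncrossing j k (by omega) h5 (by omega) }
        have h4 : a + l.numNodes = c + 1 := by omega
        refine ⟨.node () l r, ?_, hlf, by rwa [h4], ?_⟩
        · simp only [numNodes]; omega
        · have h5 : a + l.numNodes + r.numNodes = a + n := by omega
          rw [h5, if_neg (by omega), h4, Nat.add_sub_cancel, hc3]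

/-- The size of the left subtree can be read off from f. If one left subtree were larger than the
other, its last element would lie in the other's right interval and still share a leader with the
last element of the whole interval. -/
theorem Encodes.unique {f : ℕ → ℕ} {t t' : BinaryTree Unit} {a : ℕ} (h : Encodes f t a)
    (h' : Encodes f t' a) (hn : t.numNodes = t'.numNodes) : t = t' := by
  induction t generalizing a t' with
  | nil =>
    cases t' with
    | nil => rfl
    | node u l r => simp [numNodes] at hn
  | node u l r ihl ihr =>
    cases t' with
    | nil => simp [numNodes] at hn
    | node u' l' r' =>
      obtain ⟨h1, h2, h3⟩ := h
      obtain ⟨h1', h2', h3'⟩ := h'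
      simp only [numNodes] at hn
      have hll : l.numNodes = l'.numNodes := by
        have key : ∀ l r l' r' : BinaryTree Unit,
            l.numNodes + r.numNodes + 1 = l'.numNodes + r'.numNodes + 1 →
            Encodes f l a → Encodes f r (a + l.numNodes) → Encodes f l' a →
            f (a + l.numNodes + r.numNodes) = (if l.numNodes = 0 then a + l.numNodes + r.numNodes
              else f (a + l.numNodes - 1)) →
            f (a + l'.numNodes + r'.numNodes) = (if l'.numNodes = 0 then
              a + l'.numNodes + r'.numNodes else f (a + l'.numNodes - 1)) →
            ¬ l.numNodes < l'.numNodes := by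
          intro l r l' r' hn h1 h2 h1' h3 h3' hlt
          have hb : a + l.numNodes + r.numNodes = a + l'.numNodes + r'.numNodes := by omega
          rw [hb, h3', if_neg (by omega)] at h3
          split_ifs at h3 with h0
          · have := h1'.isLeader.apply_le (a + l'.numNodes - 1) (by omega) (by omega)
            omega
          · have h4 := h2.isLeader.le_apply (a + l'.numNodes - 1) (by omega) (by omega)
            have h5 := h1.isLeader.apply_le (a + l.numNodes - 1) (by omega) (by omega)
            omega
        have k1 := key l r l' r' hn h1 h2 h1' h3 h3'
        have k2 := key l' r' l r hn.symm h1' h2' h1 h3' h3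
        omega
      rw [← hll] at h2'
      rw [ihl h1 h1' hll, ihr h2 h2' (by omega)]

theorem Encodes.eqOn {f g : ℕ → ℕ} {t : BinaryTree Unit} {a : ℕ} (h : Encodes f t a)
    (h' : Encodes g t a) {j : ℕ} (ha : a ≤ j) (hj : j < a + t.numNodes) : f j = g j := by
  induction t generalizing a j with
  | nil => simp only [numNodes] at hj; omega
  | node u l r ihl ihr =>
    obtain ⟨h1, h2, h3⟩ := h
    obtain ⟨h1', h2', h3'⟩ := h'
    simp only [numNodes] at hj
    rcases lt_or_ge j (a + l.numNodes) with hjl | hjl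
    · exact ihl h1 h1' ha hjl
    rcases lt_or_ge j (a + l.numNodes + r.numNodes) with hjr | hjr
    · exact ihr h2 h2' hjl hjr
    obtain rfl : j = a + l.numNodes + r.numNodes := by omega
    rw [h3, h3']
    split_ifs with h0
    · rfl
    · exact ihl h1 h1' (by omega) (by omega)

/-- The minimal elements of the blocks in `[a, b)` of the partition with leader function `f`. -/
def leaders (f : ℕ → ℕ) (a b : ℕ) : Finset ℕ := (Finset.Ico a b).filter fun j => f j = j

theorem mem_leaders {f : ℕ → ℕ} {a b j : ℕ} : j ∈ leaders f a b ↔ (a ≤ j ∧ j < b) ∧ f j = j := by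
  simp [leaders]

theorem leaders_self (f : ℕ → ℕ) (a : ℕ) : leaders f a a = ∅ := by simp [leaders]

theorem leaders_union (f : ℕ → ℕ) {a b c : ℕ} (hab : a ≤ b) (hbc : b ≤ c) :
    leaders f a c = leaders f a b ∪ leaders f b c := by
  ext j
  simp only [Finset.mem_union, mem_leaders]
  omega

theorem disjoint_leaders (f : ℕ → ℕ) (a b c d : ℕ) (h : b ≤ c) :
    Disjoint (leaders f a b) (leaders f c d) := by
  rw [Finset.disjoint_left]
  intro j
  simp only [mem_leaders]
  omega

theorem leaders_succ_of_eq {f : ℕ → ℕ} {a b : ℕ} (hab : a ≤ b) (h : f b = b) :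
    leaders f a (b + 1) = insert b (leaders f a b) := by
  ext j
  simp only [Finset.mem_insert, mem_leaders]
  grind

theorem leaders_succ_of_ne {f : ℕ → ℕ} {a b : ℕ} (h : f b ≠ b) :
    leaders f a (b + 1) = leaders f a b := by
  ext j
  simp only [mem_leaders]
  grind

theorem notMem_leaders_self (f : ℕ → ℕ) (a b : ℕ) : b ∉ leaders f a b := by
  simp [mem_leaders]

/-- The size of the block in `[a, b)` with minimal element `q`. -/
def blockSize (f : ℕ → ℕ) (a b q : ℕ) : ℕ := ((Finset.Ico a b).filter fun j => f j = q).card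

theorem blockSize_add {f : ℕ → ℕ} {a b c : ℕ} (hab : a ≤ b) (hbc : b ≤ c) (q : ℕ) :
    blockSize f a c q = blockSize f a b q + blockSize f b c q := by
  unfold blockSize
  rw [← Finset.card_union_of_disjoint]
  · rw [← Finset.filter_union, Finset.Ico_union_Ico_eq_Ico hab hbc]
  · exact Finset.disjoint_filter_filter (Finset.Ico_disjoint_Ico_consecutive a b c)

theorem blockSize_succ_self (f : ℕ → ℕ) (b q : ℕ) :
    blockSize f b (b + 1) q = if f b = q then 1 else 0 := by
  unfold blockSize
  rw [Nat.Ico_succ_singleton, Finset.filter_singleton]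
  split_ifs <;> simp

theorem blockSize_eq_zero {f : ℕ → ℕ} {a b q : ℕ} (h : ∀ j, a ≤ j → j < b → f j ≠ q) :
    blockSize f a b q = 0 := by
  unfold blockSize
  rw [Finset.card_eq_zero, Finset.filter_eq_empty_iff]
  intro j hj
  rw [Finset.mem_Ico] at hj
  exact h j hj.1 hj.2

/-- The product over the blocks `B` of the partition encoded by a tree of `s |B|`, where `m` is
added to the size of the block of the last element. -/
def blockProd {R : Type*} [CommMonoid R] (s : ℕ → R) : BinaryTree Unit → ℕ → R
  | .nil, _ => 1
  | .node _ l r, m =>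
    (if l.numNodes = 0 then s (m + 1) else blockProd s l (m + 1)) * blockProd s r 0

/-- The counter m records elements already removed from the right that belong to the block of the
current last element. Passing to a nonempty left subtree removes one more of them, hence m + 1; the
right subtree starts afresh at 0. -/
theorem Encodes.blockProd_eq {R : Type*} [CommMonoid R] (s : ℕ → R) {f : ℕ → ℕ}
    {t : BinaryTree Unit} {a : ℕ} (h : Encodes f t a) (m : ℕ) :
    blockProd s t m = ∏ q ∈ leaders f a (a + t.numNodes), s (blockSize f a (a + t.numNodes) q +
      if f (a + t.numNodes - 1) = q then m else 0) := by
  induction t generalizing a m with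
  | nil => simp [blockProd, numNodes, leaders_self]
  | node u l r ihl ihr =>
    have hN := h.isLeader
    obtain ⟨h1, h2, h3⟩ := h
    have hl := h1.isLeader
    have hr := h2.isLeader
    have hb : a + (node u l r).numNodes = a + l.numNodes + r.numNodes + 1 := by
      simp only [numNodes]; omega
    rw [hb] at hN ⊢
    rw [blockProd, ihr h2 0, Nat.add_sub_cancel]
    by_cases h0 : l.numNodes = 0
    · rw [if_pos h0] at h3 ⊢
      simp only [h0, Nat.add_zero] at h2 h3 hr ⊢
      rw [leaders_succ_of_eq (by omega) h3, Finset.prod_insert (notMem_leaders_self _ _ _)]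
      congr 1
      · congr 1
        rw [blockSize_add (b := a + r.numNodes) (by omega) (by omega), blockSize_succ_self, if_pos h3,
          if_pos h3, blockSize_eq_zero]
        · omega
        · intro j hj1 hj2
          have := hr.apply_le j hj1 hj2
          omega
      · refine Finset.prod_congr rfl fun q hq => ?_
        rw [mem_leaders] at hq
        rw [blockSize_add (c := a + r.numNodes + 1) (b := a + r.numNodes) (by omega) (by omega),
          blockSize_succ_self, if_neg (show f (a + r.numNodes) ≠ q by omega),
          if_neg (show f (a + r.numNodes) ≠ q by omega)]
        split_ifs <;> rfl
    · rw [if_neg h0] at h3 ⊢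
      have hlast := hl.apply_le (a + l.numNodes - 1) (by omega) (by omega)
      rw [leaders_succ_of_ne (by omega), leaders_union f (a := a) (b := a + l.numNodes) (by omega) (by omega),
        Finset.prod_union (disjoint_leaders _ _ _ _ _ le_rfl), ihl h1]
      congr 1
      · refine Finset.prod_congr rfl fun q hq => ?_
        rw [mem_leaders] at hq
        rw [blockSize_add (c := a + l.numNodes + r.numNodes + 1) (b := a + l.numNodes + r.numNodes)
          (by omega) (by omega), blockSize_add (a := a) (c := a + l.numNodes + r.numNodes)
          (b := a + l.numNodes) (by omega) (by omega), blockSize_succ_self, h3,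
          blockSize_eq_zero (a := a + l.numNodes)]
        · congr 1
          split_ifs <;> omega
        · intro j hj1 hj2
          have := hr.le_apply j hj1 hj2
          omega
      · refine Finset.prod_congr rfl fun q hq => ?_
        rw [mem_leaders] at hq
        rw [blockSize_add (c := a + l.numNodes + r.numNodes + 1) (b := a + l.numNodes + r.numNodes)
          (by omega) (by omega), blockSize_add (a := a) (c := a + l.numNodes + r.numNodes)
          (b := a + l.numNodes) (by omega) (by omega), blockSize_succ_self,
          if_neg (show f (a + l.numNodes + r.numNodes) ≠ q by omega),
          if_neg (show f (a + l.numNodes + r.numNodes) ≠ q by omega),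
          blockSize_eq_zero (a := a) (b := a + l.numNodes)]
        · congr 1
          split_ifs <;> omega
        · intro j hj1 hj2
          have := hl.apply_le j hj1 hj2
          omega

/-- The minimal element of the block that covers, in the nesting order, the block in `[a, b)` with
minimal element `q`; it is `⊥` if the latter is not nested in any block. -/
def parent (f : ℕ → ℕ) (a b q : ℕ) : WithBot ℕ :=
  ((Finset.Ico a q).filter fun p => ∃ j ∈ Finset.Ioo q b, f j = p).max

/-- `w(x, y)`, where an absent `x` means the value `φ(y)`. -/
def edgeWeight {Ω R : Type*} (w : Ω × Ω → R) (φ : Ω → R) (ω : ℕ → Ω) (y : Ω) : WithBot ℕ → R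
  | ⊥ => φ y
  | (p : ℕ) => w (ω p, y)

/-- The nesting weight of the partition encoded by a tree, with a factor `φ(ω_B)` for every block
that is not nested in another one. -/
def treeWeight {Ω R : Type*} [CommMonoid R] (f : ℕ → ℕ) (w : Ω × Ω → R) :
    BinaryTree Unit → ℕ → (Ω → R) → (ℕ → Ω) → R
  | .nil, _, _, _ => 1
  | .node _ l r, a, φ, ω =>
    if l.numNodes = 0 then φ (ω (a + l.numNodes + r.numNodes)) * treeWeight f w r a φ ω
    else treeWeight f w l a φ ω *
      treeWeight f w r (a + l.numNodes) (fun y => w (ω (f (a + l.numNodes - 1)), y)) ω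

/-- The last block encloses the whole right interval, so it becomes the parent of exactly those
blocks there that had none. This is why the right subtree is weighted with w(ω_p, ·) in place of φ,
where p is the leader of that block. -/
theorem Encodes.treeWeight_eq {Ω R : Type*} [CommMonoid R] (w : Ω × Ω → R) {f : ℕ → ℕ}
    {t : BinaryTree Unit} {a : ℕ} (h : Encodes f t a) (φ : Ω → R) (ω : ℕ → Ω) :
    treeWeight f w t a φ ω = ∏ q ∈ leaders f a (a + t.numNodes),
      edgeWeight w φ ω (ω q) (parent f a (a + t.numNodes) q) := by
  induction t generalizing a φ with
  | nil => simp [treeWeight, numNodes, leaders_self]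
  | node u l r ihl ihr =>
    obtain ⟨h1, h2, h3⟩ := h
    have hl := h1.isLeader
    have hr := h2.isLeader
    have hb : a + (node u l r).numNodes = a + l.numNodes + r.numNodes + 1 := by
      simp only [numNodes]; omega
    rw [hb, treeWeight]
    by_cases h0 : l.numNodes = 0
    · rw [if_pos h0] at h3 ⊢
      simp only [h0, Nat.add_zero] at h2 h3 hr ⊢
      rw [leaders_succ_of_eq (by omega) h3, Finset.prod_insert (notMem_leaders_self _ _ _), ihr h2]
      congr 1
      · have : parent f a (a + r.numNodes + 1) (a + r.numNodes) = ⊥ := by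
          unfold parent
          rw [Finset.max_eq_bot, Finset.filter_eq_empty_iff]
          simp only [Finset.mem_Ioo]
          rintro p - ⟨j, hj, -⟩
          omega
        rw [this]
        rfl
      · refine Finset.prod_congr rfl fun q hq => ?_
        rw [mem_leaders] at hq
        have : parent f a (a + r.numNodes + 1) q = parent f a (a + r.numNodes) q := by
          unfold parent
          congr 1
          refine Finset.filter_congr fun p hp => ?_
          simp only [Finset.mem_Ioo, Finset.mem_Ico] at hp ⊢
          constructor
          · rintro ⟨j, hj, rfl⟩
            rcases Nat.lt_succ_iff_lt_or_eq.1 hj.2 with hj2 | rfl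
            · exact ⟨j, ⟨hj.1, hj2⟩, rfl⟩
            · omega
          · rintro ⟨j, hj, rfl⟩
            exact ⟨j, ⟨hj.1, by omega⟩, rfl⟩
        rw [this]
    · rw [if_neg h0] at h3 ⊢
      have hlast := hl.apply_le (a + l.numNodes - 1) (by omega) (by omega)
      have hlast2 := hl.le_apply (a + l.numNodes - 1) (by omega) (by omega)
      rw [leaders_succ_of_ne (by omega), leaders_union f (a := a) (b := a + l.numNodes) (by omega) (by omega),
        Finset.prod_union (disjoint_leaders _ _ _ _ _ le_rfl), ihl h1, ihr h2]
      refine congrArg₂ (· * ·) ?_ ?_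
      · refine Finset.prod_congr rfl fun q hq => ?_
        rw [mem_leaders] at hq
        have : parent f a (a + l.numNodes + r.numNodes + 1) q = parent f a (a + l.numNodes) q := by
          unfold parent
          congr 1
          refine Finset.filter_congr fun p hp => ?_
          simp only [Finset.mem_Ioo, Finset.mem_Ico] at hp ⊢
          constructor
          · rintro ⟨j, hj, rfl⟩
            rcases lt_or_ge j (a + l.numNodes) with hj2 | hj2
            · exact ⟨j, ⟨hj.1, hj2⟩, rfl⟩
            rcases Nat.lt_succ_iff_lt_or_eq.1 hj.2 with hj3 | rfl
            · have := hr.le_apply j hj2 hj3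
              omega
            -- The removed last element is replaced, as a witness, by its predecessor in the block.
            -- The latter is not q, since otherwise the candidate parent would be q itself.
            · refine ⟨a + l.numNodes - 1, ⟨?_, by omega⟩, h3.symm⟩
              rcases Nat.lt_or_ge q (a + l.numNodes - 1) with h4 | h4
              · exact h4
              · have h5 : q = a + l.numNodes - 1 := by omega
                rw [← h5] at h3
                omega
          · rintro ⟨j, hj, rfl⟩
            exact ⟨j, ⟨hj.1, by omega⟩, rfl⟩
        rw [this]
      · refine Finset.prod_congr rfl fun q hq => ?_
        rw [mem_leaders] at hq
        -- The new candidate lies in the left interval, hence is smaller than any parent within the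
        -- right interval and counts only if there is none.
        have : parent f a (a + l.numNodes + r.numNodes + 1) q =
            max (WithBot.some (f (a + l.numNodes - 1)))
              (parent f (a + l.numNodes) (a + l.numNodes + r.numNodes) q) := by
          unfold parent
          rw [← Finset.max_insert]
          congr 1
          ext p
          simp only [Finset.mem_Ioo, Finset.mem_Ico, Finset.mem_filter, Finset.mem_insert]
          constructor
          · rintro ⟨hp, j, hj, rfl⟩
            rcases Nat.lt_succ_iff_lt_or_eq.1 hj.2 with hj3 | rfl
            · have := hr.le_apply j (by omega) hj3
              exact Or.inr ⟨⟨this, hp.2⟩, j, ⟨hj.1, hj3⟩, rfl⟩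
            · exact Or.inl h3
          · rintro (rfl | ⟨hp, j, hj, rfl⟩)
            · exact ⟨⟨by omega, by omega⟩, a + l.numNodes + r.numNodes, ⟨by omega, by omega⟩, h3⟩
            · exact ⟨⟨by omega, by omega⟩, j, ⟨hj.1, by omega⟩, rfl⟩
        rw [this]
        cases hp : parent f (a + l.numNodes) (a + l.numNodes + r.numNodes) q with
        | bot => rw [max_bot_right]; rfl
        | coe p =>
          have hmem := Finset.mem_of_max hp
          simp only [Finset.mem_filter, Finset.mem_Ico] at hmem
          rw [max_eq_right (WithBot.coe_le_coe.2 (by omega))]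
          rfl

end Trees

/-! ### Leader functions, partitions of `Fin n` and the nesting order -/

section Partitions

open Finset

/-- The block of the elements mapped to `q` by the leader function `f`. -/
def block (f : ℕ → ℕ) (n q : ℕ) : Finset (Fin n) := univ.filter fun i : Fin n => f i = q

theorem mem_block {f : ℕ → ℕ} {n q : ℕ} {i : Fin n} : i ∈ block f n q ↔ f i = q := by
  simp [block]

theorem card_block (f : ℕ → ℕ) (n q : ℕ) : (block f n q).card = blockSize f 0 n q := by
  unfold block blockSize
  rw [← Finset.card_map Fin.valEmbedding]
  congr 1
  ext j
  simp only [mem_map, mem_filter, mem_univ, true_and, Fin.valEmbedding_apply, mem_Ico, Nat.zero_le]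
  exact ⟨fun ⟨i, hi, hij⟩ => hij ▸ ⟨i.2, hi⟩, fun ⟨hj, hf⟩ => ⟨⟨j, hj⟩, hf, rfl⟩⟩

/-- The partition of `Fin n` into the fibres of the function `f`. -/
def fiberPartition (f : ℕ → ℕ) (n : ℕ) : Finpartition (univ : Finset (Fin n)) :=
  letI : DecidableRel (Setoid.ker fun i : Fin n => f i).r :=
    fun i j => inferInstanceAs (Decidable (f i = f j))
  Finpartition.ofSetoid (Setoid.ker fun i : Fin n => f i)

theorem part_fiberPartition (f : ℕ → ℕ) {n : ℕ} (i : Fin n) :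
    (fiberPartition f n).part i = block f n (f i) := by
  let d : DecidableRel (Setoid.ker fun i : Fin n => f i).r :=
    fun i j => inferInstanceAs (Decidable (f i = f j))
  ext j
  rw [mem_block]
  exact (Finpartition.mem_part_ofSetoid_iff_rel (s := Setoid.ker fun i : Fin n => f i)).trans
    eq_comm

theorem mem_parts_iff_exists_part {n : ℕ} {π : Finpartition (univ : Finset (Fin n))}
    {B : Finset (Fin n)} : B ∈ π.parts ↔ ∃ i, π.part i = B := by
  constructor
  · intro hB
    obtain ⟨i, hi⟩ := π.nonempty_of_mem_parts hB
    exact ⟨i, π.part_eq_of_mem hB hi⟩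
  · rintro ⟨i, rfl⟩
    exact π.part_mem.2 (mem_univ i)

theorem finpartition_ext_part {n : ℕ} {π σ : Finpartition (univ : Finset (Fin n))}
    (h : ∀ i, π.part i = σ.part i) : π = σ := by
  refine Finpartition.ext (Finset.ext fun B => ?_)
  rw [mem_parts_iff_exists_part, mem_parts_iff_exists_part]
  simp only [h]

variable {f : ℕ → ℕ} {n : ℕ}

theorem mem_parts_fiberPartition (hf : IsLeader f 0 n) {B : Finset (Fin n)} :
    B ∈ (fiberPartition f n).parts ↔ ∃ q ∈ leaders f 0 n, block f n q = B := by
  rw [mem_parts_iff_exists_part]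
  simp only [part_fiberPartition]
  constructor
  · rintro ⟨i, rfl⟩
    have := hf.apply_le i (Nat.zero_le _) i.2
    exact ⟨f i, mem_leaders.2 ⟨⟨Nat.zero_le _, by omega⟩, hf.apply_apply i (Nat.zero_le _) i.2⟩, rfl⟩
  · rintro ⟨q, hq, rfl⟩
    rw [mem_leaders] at hq
    exact ⟨⟨q, hq.1.2⟩, by rw [hq.2]⟩

theorem block_injOn : Set.InjOn (block f n) (leaders f 0 n) := by
  intro p hp q hq h
  rw [mem_coe, mem_leaders] at hp hq
  have : (⟨p, hp.1.2⟩ : Fin n) ∈ block f n q := h ▸ mem_block.2 hp.2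
  rw [mem_block] at this
  simpa [hp.2] using this

/-- The correspondence between the minimal elements of the blocks and the blocks. -/
noncomputable def leadersEquiv (hf : IsLeader f 0 n) :
    leaders f 0 n ≃ (fiberPartition f n).parts :=
  Equiv.ofBijective
    (fun q => ⟨block f n q, (mem_parts_fiberPartition hf).2 ⟨q, q.2, rfl⟩⟩)
    ⟨fun p q h => Subtype.ext (block_injOn p.2 q.2 (congrArg Subtype.val h)),
      fun ⟨_, hB⟩ => by
        obtain ⟨q, hq, rfl⟩ := (mem_parts_fiberPartition hf).1 hB
        exact ⟨⟨q, hq⟩, rfl⟩⟩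

theorem coe_leadersEquiv (hf : IsLeader f 0 n) (q : leaders f 0 n) :
    (leadersEquiv hf q : Finset (Fin n)) = block f n q := rfl

theorem prod_parts_fiberPartition {R : Type*} [CommMonoid R] (hf : IsLeader f 0 n) (s : ℕ → R) :
    ∏ B ∈ (fiberPartition f n).parts, s B.card = ∏ q ∈ leaders f 0 n, s (blockSize f 0 n q) := by
  symm
  refine prod_bij (fun q _ => block f n q) (fun q hq => (mem_parts_fiberPartition hf).2 ⟨q, hq, rfl⟩)
    (fun p hp q hq h => block_injOn hp hq h) (fun B hB => ?_) fun q _ => by rw [card_block]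
  obtain ⟨q, hq, rfl⟩ := (mem_parts_fiberPartition hf).1 hB
  exact ⟨q, hq, rfl⟩

theorem isNoncrossing_fiberPartition (hf : IsLeader f 0 n) :
    IsNoncrossing (fiberPartition f n) := by
  intro B hB B₂ hB₂ i i₂ j j₂ h1 h2 h3 hi hj hi₂ hj₂
  obtain ⟨p, hp, rfl⟩ := (mem_parts_fiberPartition hf).1 hB
  obtain ⟨q, hq, rfl⟩ := (mem_parts_fiberPartition hf).1 hB₂
  rw [mem_block] at hi hj hi₂ hj₂
  have h4 := hf.apply_le i (Nat.zero_le _) i.2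
  have h5 := hf.apply_le i₂ (Nat.zero_le _) i₂.2
  have h6 := hf.noncrossing i₂ j (Nat.zero_le _) (by omega) j.2 (by omega)
  have h7 := hf.noncrossing j j₂ (Nat.zero_le _) (by omega) j₂.2 (by omega)
  have : p = q := by omega
  rw [this]

theorem IsLeader.eq_of_fiberPartition_eq {g : ℕ → ℕ} (hf : IsLeader f 0 n) (hg : IsLeader g 0 n)
    (h : fiberPartition f n = fiberPartition g n) {j : ℕ} (hj : j < n) : f j = g j := by
  have key : ∀ {f g : ℕ → ℕ}, IsLeader f 0 n → IsLeader g 0 n →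
      fiberPartition f n = fiberPartition g n → g j ≤ f j := by
    intro f g hf hg h
    have h1 := hf.apply_le j (Nat.zero_le _) hj
    have h2 := hf.apply_apply j (Nat.zero_le _) hj
    have h3 : (⟨f j, by omega⟩ : Fin n) ∈ block f n (f (⟨j, hj⟩ : Fin n)) := mem_block.2 h2
    rw [← part_fiberPartition, h, part_fiberPartition, mem_block] at h3
    have h4 := hg.apply_le (f j) (Nat.zero_le _) (by omega)
    simp only at h3
    omega
  exact le_antisymm (key hg hf h.symm) (key hf hg h)

/-- Each element is sent to the minimum of its block. A failure of the last axiom of `IsLeader`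
gives m j < m k < j < k with alternating blocks, which is a crossing. -/
theorem exists_isLeader_fiberPartition_eq {π : Finpartition (univ : Finset (Fin n))}
    (hπ : IsNoncrossing π) : ∃ f, IsLeader f 0 n ∧ fiberPartition f n = π := by
  have hne : ∀ i, (π.part i).Nonempty := fun i => ⟨i, π.mem_part (mem_univ i)⟩
  let m : Fin n → Fin n := fun i => (π.part i).min' (hne i)
  have hm1 : ∀ i, m i ∈ π.part i := fun i => min'_mem _ _
  have hm2 : ∀ i, π.part (m i) = π.part i := fun i =>
    π.part_eq_of_mem (π.part_mem.2 (mem_univ i)) (hm1 i)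
  have hm3 : ∀ i, m i ≤ i := fun i => min'_le _ _ (π.mem_part (mem_univ i))
  have hm4 : ∀ i j, π.part i = π.part j → m i = m j := by
    intro i j h
    simp only [m, h]
  have hm5 : ∀ i j, m i = m j ↔ π.part i = π.part j := fun i j =>
    ⟨fun h => by rw [← hm2 i, h, hm2], hm4 i j⟩
  let f : ℕ → ℕ := fun j => if h : j < n then m ⟨j, h⟩ else j
  have hfm : ∀ j (h : j < n), f j = m ⟨j, h⟩ := fun j h => dif_pos h
  refine ⟨f, ⟨fun _ _ _ => Nat.zero_le _, fun j _ hj => ?_, fun j _ hj => ?_,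
    fun j k _ hjk hk hkj => ?_⟩, finpartition_ext_part fun i => ?_⟩
  · rw [hfm j hj]
    exact hm3 ⟨j, hj⟩
  · rw [hfm j hj, hfm _ (Fin.is_lt _)]
    exact congrArg Fin.val (hm4 _ _ (hm2 _))
  · rw [hfm k hk] at hkj ⊢
    rw [hfm j (by omega)]
    set k' : Fin n := ⟨k, hk⟩
    set j' : Fin n := ⟨j, by omega⟩
    by_contra hlt
    rw [not_le] at hlt
    have h1 : m j' < m k' := hlt
    have h2 : m k' ≤ j' := hkj
    have h3 : j' ≤ k' := hjk
    have h4 : π.part j' ≠ π.part k' := fun h => by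
      rw [hm4 _ _ h] at h1
      exact lt_irrefl _ h1
    have h5 : m k' ≠ j' := fun h => h4 (by rw [← h, hm2])
    have h6 : j' ≠ k' := fun h => h4 (by rw [h])
    refine h4 (hπ _ (π.part_mem.2 (mem_univ j')) _ (π.part_mem.2 (mem_univ k')) (m j') (m k') j' k'
      h1 (lt_of_le_of_ne h2 h5) (lt_of_le_of_ne h3 h6) (hm1 _) (π.mem_part (mem_univ _)) (hm1 _)
      (π.mem_part (mem_univ _)))
  · rw [part_fiberPartition]
    ext j
    rw [mem_block, hfm _ j.2, hfm _ i.2, ← Fin.ext_iff, hm5]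
    constructor
    · intro h
      rw [← h]
      exact π.mem_part (mem_univ j)
    · intro h
      exact π.part_eq_of_mem (π.part_mem.2 (mem_univ i)) h

/-- A leader function of the noncrossing partition encoded by a tree. -/
noncomputable def leaderFun (t : BinaryTree Unit) : ℕ → ℕ := (exists_encodes t 0).choose

theorem encodes_leaderFun (t : BinaryTree Unit) : Encodes (leaderFun t) t 0 :=
  (exists_encodes t 0).choose_spec

theorem isLeader_leaderFun {t : BinaryTree Unit} (ht : t.numNodes = n) :
    IsLeader (leaderFun t) 0 n := by
  have := (encodes_leaderFun t).isLeader
  rwa [zero_add, ht] at this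

theorem exists_fiberPartition_leaderFun_eq {n : ℕ} {π : Finpartition (univ : Finset (Fin n))}
    (hπ : π ∈ noncrossingPartitions n) :
    ∃ t : BinaryTree Unit, t.numNodes = n ∧ fiberPartition (leaderFun t) n = π := by
  classical
  rw [noncrossingPartitions, mem_filter] at hπ
  obtain ⟨f, hf, rfl⟩ := exists_isLeader_fiberPartition_eq hπ.2
  obtain ⟨t, ht, htf⟩ := IsLeader.exists_encodes n 0 (by rwa [zero_add])
  refine ⟨t, ht, finpartition_ext_part fun i => ?_⟩
  have h : ∀ j < n, leaderFun t j = f j := fun j hj =>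
    (encodes_leaderFun t).eqOn htf (Nat.zero_le _) (by omega)
  rw [part_fiberPartition, part_fiberPartition]
  ext j
  rw [mem_block, mem_block, h _ i.2, h _ j.2]

/-- Surjectivity of the tree code is `IsLeader.exists_encodes`, injectivity is `Encodes.unique`. A
partition determines its leader function only below n, which is all that `Encodes` depends on. -/
theorem sum_noncrossingPartitions {R : Type*} [AddCommMonoid R] (n : ℕ)
    (F : Finpartition (univ : Finset (Fin n)) → R) :
    ∑ π ∈ noncrossingPartitions n, F π =
      ∑ t ∈ BinaryTree.treesOfNumNodesEq n, F (fiberPartition (leaderFun t) n) := by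
  classical
  symm
  refine sum_bij (fun t _ => fiberPartition (leaderFun t) n) (fun t ht => ?_)
    (fun t ht t' ht' h => ?_) (fun π hπ => ?_) fun _ _ => rfl
  · rw [BinaryTree.mem_treesOfNumNodesEq] at ht
    rw [noncrossingPartitions, mem_filter]
    exact ⟨mem_univ _, isNoncrossing_fiberPartition (isLeader_leaderFun ht)⟩
  · rw [BinaryTree.mem_treesOfNumNodesEq] at ht ht'
    refine (encodes_leaderFun t).unique ((encodes_leaderFun t').congr fun j _ hj => ?_)
      (ht.trans ht'.symm)
    exact (isLeader_leaderFun ht').eq_of_fiberPartition_eq (isLeader_leaderFun ht) h.symm (by omega)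
  · obtain ⟨t, ht, rfl⟩ := exists_fiberPartition_leaderFun_eq hπ
    exact ⟨t, BinaryTree.mem_treesOfNumNodesEq.2 ht, rfl⟩

/-- In a non-crossing partition nesting can be tested on the leader q alone: the last element of the
outer block before q and its first element after q bound a gap, and an element of the inner block
beyond this gap would create a crossing. -/
theorem precedes_block_iff (hf : IsLeader f 0 n) {p q : ℕ} (hp : p ∈ leaders f 0 n)
    (hq : q ∈ leaders f 0 n) :
    Precedes (block f n p) (block f n q) ↔ p < q ∧ ∃ j ∈ Ioo q n, f j = p := by
  rw [mem_leaders] at hp hq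
  have hqn := hq.1.2
  have hpn := hp.1.2
  constructor
  · rintro ⟨i, hi, j, hj, hij, hsub, -⟩
    have h1 := hsub (mem_block.2 hq.2 : (⟨q, hqn⟩ : Fin n) ∈ block f n q)
    rw [mem_block] at hi hj
    rw [mem_Ioo, Fin.lt_def, Fin.lt_def] at h1
    have h2 := hf.apply_le i (Nat.zero_le _) i.2
    simp only at h1
    exact ⟨by omega, j, mem_Ioo.2 ⟨h1.2, j.2⟩, hj⟩
  · rintro ⟨hpq, j₀, hj₀, hfj₀⟩
    rw [mem_Ioo] at hj₀
    obtain ⟨i, hi, himax⟩ := ((block f n p).filter fun i : Fin n => (i : ℕ) < q).exists_max_image id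
      ⟨⟨p, hpn⟩, by simp [mem_block, hp.2, hpq]⟩
    obtain ⟨j, hj, hjmin⟩ := ((block f n p).filter fun i : Fin n => q < (i : ℕ)).exists_min_image id
      ⟨⟨j₀, hj₀.2⟩, by simp [mem_block, hfj₀, hj₀.1]⟩
    simp only [mem_filter, mem_block, id] at hi hj himax hjmin
    refine ⟨i, mem_block.2 hi.1, j, mem_block.2 hj.1, Fin.lt_def.2 (by omega), fun x hx => ?_,
      fun x hx => ?_⟩
    · rw [mem_block] at hx
      have h1 := hf.apply_le x (Nat.zero_le _) x.2
      rw [mem_Ioo, Fin.lt_def, Fin.lt_def]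
      refine ⟨by omega, ?_⟩
      by_contra hxj
      have h2 := hf.noncrossing j x (Nat.zero_le _) (by omega) x.2 (by omega)
      omega
    · rw [mem_compl, mem_block]
      intro hx2
      rw [mem_Ioo, Fin.lt_def, Fin.lt_def] at hx
      rcases lt_trichotomy (x : ℕ) q with h | h | h
      · have := himax x ⟨hx2, h⟩
        rw [Fin.le_def] at this
        omega
      · rw [h] at hx2
        omega
      · have := hjmin x ⟨hx2, h⟩
        rw [Fin.le_def] at this
        omega

theorem mem_parent_set {p q : ℕ} (hf : IsLeader f 0 n) (hp : p < q)
    (h : ∃ j ∈ Ioo q n, f j = p) : p ∈ leaders f 0 n := by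
  obtain ⟨j, hj, rfl⟩ := h
  rw [mem_Ioo] at hj
  exact mem_leaders.2 ⟨⟨Nat.zero_le _, by omega⟩, hf.apply_apply j (Nat.zero_le _) hj.2⟩

theorem depth_gt_one_iff {π : Finpartition (univ : Finset (Fin n))} (C : π.parts) :
    1 < depth π C ↔ ∃ B : π.parts, Precedes B.1 C.1 := by
  classical
  unfold depth
  rw [Nat.lt_add_left_iff_pos, card_pos]
  constructor
  · rintro ⟨B, hB⟩
    exact ⟨B, (mem_filter.1 hB).2⟩
  · rintro ⟨B, hB⟩
    exact ⟨B, mem_filter.2 ⟨mem_univ _, hB⟩⟩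

theorem depth_gt_one_iff_parent (hf : IsLeader f 0 n) (q : leaders f 0 n) :
    1 < depth (fiberPartition f n) (leadersEquiv hf q) ↔ parent f 0 n q ≠ ⊥ := by
  rw [depth_gt_one_iff, ne_eq, parent, Finset.max_eq_bot, ← ne_eq, ← nonempty_iff_ne_empty]
  constructor
  · rintro ⟨B, hB⟩
    obtain ⟨p, rfl⟩ := (leadersEquiv hf).surjective B
    rw [coe_leadersEquiv, coe_leadersEquiv, precedes_block_iff hf p.2 q.2] at hB
    exact ⟨p, mem_filter.2 ⟨mem_Ico.2 ⟨Nat.zero_le _, hB.1⟩, hB.2⟩⟩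
  · rintro ⟨p, hp⟩
    rw [mem_filter, mem_Ico] at hp
    have hpl := mem_parent_set hf hp.1.2 hp.2
    refine ⟨leadersEquiv hf ⟨p, hpl⟩, ?_⟩
    rw [coe_leadersEquiv, coe_leadersEquiv, precedes_block_iff hf hpl q.2]
    exact ⟨hp.1.2, hp.2⟩

/-- `pred` is a choice among covering edges, so uniqueness is needed. Among the blocks enclosing q
the one with the largest leader is covering; any other enclosing block also encloses that one and
therefore is not. -/
theorem pred_leadersEquiv (hf : IsLeader f 0 n) (p q : leaders f 0 n)
    (h : parent f 0 n q = WithBot.some (p : ℕ)) :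
    pred (fiberPartition f n) (leadersEquiv hf q) = leadersEquiv hf p := by
  have hmem := Finset.mem_of_max h
  rw [mem_filter, mem_Ico] at hmem
  have hmax : ∀ p' : leaders f 0 n, (p' : ℕ) < q → (∃ j ∈ Ioo (q : ℕ) n, f j = p') →
      (p' : ℕ) ≤ p := by
    intro p' h1 h2
    have := Finset.le_max (s := (Finset.Ico 0 (q : ℕ)).filter fun p => ∃ j ∈ Ioo (q : ℕ) n, f j = p)
      (mem_filter.2 ⟨mem_Ico.2 ⟨Nat.zero_le _, h1⟩, h2⟩)
    change _ ≤ parent f 0 n q at this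
    rw [h] at this
    exact WithBot.coe_le_coe.1 this
  have hprec : ∀ p' q' : leaders f 0 n, Precedes (leadersEquiv hf p').1 (leadersEquiv hf q').1 ↔
      (p' : ℕ) < q' ∧ ∃ j ∈ Ioo (q' : ℕ) n, f j = p' := fun p' q' => precedes_block_iff hf p'.2 q'.2
  have hedge : NestingEdge (fiberPartition f n) (leadersEquiv hf p) (leadersEquiv hf q) := by
    refine ⟨(hprec p q).2 ⟨hmem.1.2, hmem.2⟩, ?_⟩
    rintro ⟨D, hD1, hD2⟩
    obtain ⟨d, rfl⟩ := (leadersEquiv hf).surjective D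
    rw [hprec] at hD1 hD2
    have := hmax d hD2.1 hD2.2
    omega
  have hex : ∃ B, NestingEdge (fiberPartition f n) B (leadersEquiv hf q) := ⟨_, hedge⟩
  rw [pred, dif_pos hex]
  have hspec := hex.choose_spec
  obtain ⟨d, hd⟩ := (leadersEquiv hf).surjective hex.choose
  rw [← hd] at hspec ⊢
  have h1 := (hprec d q).1 hspec.1
  have h2 := hmax d h1.1 h1.2
  rcases h2.lt_or_eq with h3 | h3
  · refine absurd ⟨_, (hprec d p).2 ⟨h3, ?_⟩, hedge.1⟩ hspec.2
    obtain ⟨j, hj, hjd⟩ := h1.2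
    rw [mem_Ioo] at hj
    exact ⟨j, mem_Ioo.2 ⟨by omega, hj.2⟩, hjd⟩
  · rw [Subtype.ext h3]

theorem nestingWeight_fiberPartition {Ω : Type*} (hf : IsLeader f 0 n) (w : Ω × Ω → ℝ)
    (ω : ℕ → Ω) (ω' : (fiberPartition f n).parts → Ω)
    (hω : ∀ q : leaders f 0 n, ω' (leadersEquiv hf q) = ω q) :
    nestingWeight w (fiberPartition f n) ω' =
      ∏ q ∈ leaders f 0 n, edgeWeight w 1 ω (ω q) (parent f 0 n q) := by
  classical
  rw [nestingWeight, prod_filter, ← Finset.prod_coe_sort (leaders f 0 n), ← (leadersEquiv hf).prod_comp]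
  refine Fintype.prod_congr _ _ fun q => ?_
  cases hp : parent f 0 n q with
  | bot =>
    rw [if_neg (by rw [depth_gt_one_iff_parent, hp]; simp)]
    rfl
  | coe p =>
    have hmem := Finset.mem_of_max hp
    rw [mem_filter, mem_Ico] at hmem
    have hpl := mem_parent_set hf hmem.1.2 hmem.2
    rw [if_pos (by rw [depth_gt_one_iff_parent, hp]; simp),
      pred_leadersEquiv hf ⟨p, hpl⟩ q hp, hω, hω]
    rfl

end Partitions

/-! ### Integrals of nesting weights along trees -/

section TreeIntegral

open BinaryTree

universe u

variable {Ω : Type u} [MeasurableSpace Ω]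

/-- The integral of the nesting weight of the partition encoded by a tree, where the blocks that are
not nested contribute a factor `φ`, and the block of the last element a further factor `g`. -/
noncomputable def treeIntegral (μ : Measure Ω) (w : Ω × Ω → ℝ≥0∞) :
    BinaryTree Unit → (Ω → ℝ≥0∞) → (Ω → ℝ≥0∞) → ℝ≥0∞
  | .nil, _, _ => 1
  | .node _ l r, φ, g =>
    if l.numNodes = 0 then (∫⁻ y, φ y * g y ∂μ) * treeIntegral μ w r φ 1
    else treeIntegral μ w l φ fun y => g y * treeIntegral μ w r (fun z => w (y, z)) 1

variable {μ : Measure Ω} {w : Ω × Ω → ℝ≥0∞}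

/-- The functions φ and g carry a parameter because the right subtree is integrated with φ = w(y,
·), where y is the variable of the enclosing block. -/
theorem measurable_treeIntegral [SFinite μ] (hw : Measurable w) (t : BinaryTree Unit)
    {Φ G : Ω × Ω → ℝ≥0∞} (hΦ : Measurable Φ) (hG : Measurable G) :
    Measurable fun x => treeIntegral μ w t (fun y => Φ (x, y)) fun y => G (x, y) := by
  induction t generalizing Φ G with
  | nil => exact measurable_const
  | node u l r ihl ihr =>
    simp only [treeIntegral]
    split_ifs with h0
    · exact (hΦ.mul hG).lintegral_prod_right'.mul (ihr hΦ (G := fun _ => 1) measurable_const)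
    · exact ihl hΦ (G := fun p => G p * treeIntegral μ w r (fun z => w (p.2, z)) 1)
        (hG.mul ((ihr hw (G := fun _ => 1) measurable_const).comp measurable_snd))

/-- The bound must be uniform in φ and g: in the recursion g absorbs the integral of a right
subtree, which is known only through its bound. -/
theorem exists_treeIntegral_le [IsFiniteMeasure μ] {C : ℝ≥0} (hw : ∀ p, w p ≤ C)
    (t : BinaryTree Unit) (D : ℝ≥0) : ∃ K : ℝ≥0, ∀ φ g : Ω → ℝ≥0∞, (∀ y, φ y ≤ D) →
      (∀ y, g y ≤ D) → treeIntegral μ w t φ g ≤ K := by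
  induction t generalizing D with
  | nil => exact ⟨1, fun _ _ _ _ => by simp [treeIntegral]⟩
  | node u l r ihl ihr =>
    simp only [treeIntegral]
    split_ifs with h0
    · obtain ⟨K, hK⟩ := ihr (max D 1)
      refine ⟨D * D * (μ Set.univ).toNNReal * K, fun φ g hφ hg => ?_⟩
      rw [ENNReal.coe_mul]
      refine mul_le_mul' ?_ (hK _ _ (fun y => (hφ y).trans (by simp)) fun y => by simp)
      calc ∫⁻ y, φ y * g y ∂μ ≤ ∫⁻ _, (D * D : ℝ≥0∞) ∂μ :=
            lintegral_mono fun y => mul_le_mul' (hφ y) (hg y)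
        _ = _ := by
            rw [lintegral_const, ENNReal.coe_mul, ENNReal.coe_mul,
              ENNReal.coe_toNNReal (measure_ne_top _ _)]
    · obtain ⟨K, hK⟩ := ihr (max C 1)
      obtain ⟨K', hK'⟩ := ihl (max D (D * K))
      refine ⟨K', fun φ g hφ hg => hK' _ _ (fun y => (hφ y).trans (by simp)) fun y => ?_⟩
      refine (mul_le_mul' (hg y) (hK _ _ (fun z => (hw _).trans (by simp)) fun z => by simp)).trans ?_
      rw [← ENNReal.coe_mul]
      exact ENNReal.coe_le_coe.2 (le_max_right _ _)

omit [MeasurableSpace Ω] in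
theorem treeWeight_congr {R : Type*} [CommMonoid R] {w : Ω × Ω → R} {f : ℕ → ℕ}
    {t : BinaryTree Unit} {a : ℕ} (h : Encodes f t a) (φ : Ω → R) {ω ω' : ℕ → Ω}
    (hω : ∀ j ∈ leaders f a (a + t.numNodes), ω j = ω' j) :
    treeWeight f w t a φ ω = treeWeight f w t a φ ω' := by
  rw [h.treeWeight_eq, h.treeWeight_eq]
  refine Finset.prod_congr rfl fun q hq => ?_
  cases hp : parent f a (a + t.numNodes) q with
  | bot => exact congrArg φ (hω q hq)
  | coe p =>
    have hmem := Finset.mem_of_max hp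
    simp only [Finset.mem_filter, Finset.mem_Ico, Finset.mem_Ioo] at hmem
    obtain ⟨⟨h1, h2⟩, j, hj, rfl⟩ := hmem
    change w (ω _, ω q) = w (ω' _, ω' q)
    rw [mem_leaders] at hq
    rw [hω q (mem_leaders.2 hq), hω (f j) (mem_leaders.2 ⟨⟨h1, by omega⟩,
      h.isLeader.apply_apply j (by omega) hj.2⟩)]

theorem measurable_treeWeight (hw : Measurable w) (f : ℕ → ℕ) (t : BinaryTree Unit) (a : ℕ)
    {Φ : (ℕ → Ω) × Ω → ℝ≥0∞} (hΦ : Measurable Φ) :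
    Measurable fun ω : ℕ → Ω => treeWeight f w t a (fun y => Φ (ω, y)) ω := by
  induction t generalizing a Φ with
  | nil => exact measurable_const
  | node u l r ihl ihr =>
    simp only [treeWeight]
    split_ifs with h0
    · exact (hΦ.comp (measurable_id.prodMk (measurable_pi_apply _))).mul (ihr a hΦ)
    · exact (ihl a hΦ).mul (ihr _ (Φ := fun p => w (p.1 (f (a + l.numNodes - 1)), p.2))
        (hw.comp (((measurable_pi_apply _).comp measurable_fst).prodMk measurable_snd)))

theorem lmarginal_mul_left [SigmaFinite μ] {s : Finset ℕ} {c F : (ℕ → Ω) → ℝ≥0∞}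
    (hF : Measurable F) (x : ℕ → Ω)
    (hc : ∀ y : ℕ → Ω, (∀ j ∉ s, y j = x j) → c y = c x) :
    lmarginal (fun _ => μ) s (fun ω => c ω * F ω) x = c x * lmarginal (fun _ => μ) s F x := by
  have hF' : Measurable fun y : s → Ω => F (Function.updateFinset x s y) :=
    hF.comp measurable_updateFinset
  unfold lmarginal
  rw [← lintegral_const_mul _ hF']
  refine lintegral_congr fun y => congrArg (· * _) (hc _ fun j hj => ?_)
  simp [Function.updateFinset, hj]

/-- With coordinates indexed by ℕ and only leaders integrated out, subintervals can be treated one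
at a time. At a node with nonempty left subtree the right interval is integrated first; the result
depends only on the coordinate of the last block's leader and is multiplied into g. -/
theorem lmarginal_treeWeight [SigmaFinite μ] (hw : Measurable w) {f : ℕ → ℕ}
    {t : BinaryTree Unit} {a : ℕ} (h : Encodes f t a) {φ g : Ω → ℝ≥0∞} (hφ : Measurable φ)
    (hg : Measurable g) (x : ℕ → Ω) :
    lmarginal (fun _ => μ) (leaders f a (a + t.numNodes)) (fun ω => treeWeight f w t a φ ω *
      if t.numNodes = 0 then 1 else g (ω (f (a + t.numNodes - 1)))) x =
        treeIntegral μ w t φ g := by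
  induction t generalizing a φ g x with
  | nil => simp [treeWeight, treeIntegral, numNodes, leaders_self]
  | node u l r ihl ihr =>
    obtain ⟨h1, h2, h3⟩ := h
    have hl := h1.isLeader
    have hr := h2.isLeader
    have hr1 : ∀ {φ : Ω → ℝ≥0∞} (_ : Measurable φ) (x : ℕ → Ω),
        lmarginal (fun _ => μ) (leaders f (a + l.numNodes) (a + l.numNodes + r.numNodes))
          (fun ω => treeWeight f w r (a + l.numNodes) φ ω) x = treeIntegral μ w r φ 1 := by
      intro φ hφ x
      rw [← ihr h2 hφ (g := 1) measurable_const x]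
      simp
    have hb : a + (node u l r).numNodes = a + l.numNodes + r.numNodes + 1 := by
      simp only [numNodes]; omega
    have hne : (node u l r).numNodes ≠ 0 := by simp [numNodes]
    have hmr : ∀ {φ : Ω → ℝ≥0∞}, Measurable φ →
        Measurable fun ω : ℕ → Ω => treeWeight f w r (a + l.numNodes) φ ω := fun {φ} hφ =>
      measurable_treeWeight hw f r _ (Φ := fun p => φ p.2) (hφ.comp measurable_snd)
    rw [hb]
    simp only [if_neg hne, Nat.add_sub_cancel]
    by_cases h0 : l.numNodes = 0
    · rw [if_pos h0] at h3
      simp only [treeWeight, treeIntegral, if_pos h0, h3]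
      simp only [h0, Nat.add_zero] at h3 hr hr1 hmr ⊢
      have hmr2 := hmr hφ
      rw [leaders_succ_of_eq (by omega) h3]
      have hφg : Measurable fun y => φ y * g y := hφ.mul hg
      have hm : Measurable fun ω : ℕ → Ω => φ (ω (a + r.numNodes)) * treeWeight f w r a φ ω *
          g (ω (a + r.numNodes)) := by fun_prop
      rw [lmarginal_insert _ hm (notMem_leaders_self _ _ _),
        ← lintegral_mul_const _ hφg]
      refine lintegral_congr fun y => ?_
      have : (fun ω : ℕ → Ω => φ (ω (a + r.numNodes)) * treeWeight f w r a φ ω *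
          g (ω (a + r.numNodes))) = fun ω => (φ (ω (a + r.numNodes)) * g (ω (a + r.numNodes))) *
            treeWeight f w r a φ ω := by
        funext ω
        ring
      rw [this, lmarginal_mul_left hmr2, hr1 hφ, Function.update_self]
      intro y hy
      rw [hy _ (notMem_leaders_self _ _ _)]
    · rw [if_neg h0] at h3
      have hlast := hl.apply_le (a + l.numNodes - 1) (by omega) (by omega)
      simp only [treeWeight, treeIntegral, if_neg h0, h3]
      rw [leaders_succ_of_ne (by omega), leaders_union f (a := a) (b := a + l.numNodes) (by omega)
        (by omega)]
      set p := f (a + l.numNodes - 1) with hp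
      have hml : Measurable fun ω : ℕ → Ω => treeWeight f w l a φ ω :=
        measurable_treeWeight hw f l _ (Φ := fun p => φ p.2) (hφ.comp measurable_snd)
      have hmr2 : Measurable fun ω : ℕ → Ω =>
          treeWeight f w r (a + l.numNodes) (fun y => w (ω p, y)) ω :=
        measurable_treeWeight hw f r _ (Φ := fun q => w (q.1 p, q.2))
          (hw.comp (((measurable_pi_apply _).comp measurable_fst).prodMk measurable_snd))
      have hgp : Measurable fun ω : ℕ → Ω => g (ω p) := hg.comp (measurable_pi_apply p)
      have hm : Measurable fun ω : ℕ → Ω => treeWeight f w l a φ ω *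
          treeWeight f w r (a + l.numNodes) (fun y => w (ω p, y)) ω * g (ω p) :=
        (hml.mul hmr2).mul hgp
      rw [lmarginal_union _ _ hm (disjoint_leaders _ _ _ _ _ le_rfl)]
      have hJ : Measurable fun y => treeIntegral μ w r (fun z => w (y, z)) 1 :=
        measurable_treeIntegral hw r hw (G := fun _ => 1) measurable_const
      have hgJ : Measurable fun y => g y * treeIntegral μ w r (fun z => w (y, z)) 1 := hg.mul hJ
      rw [← ihl h1 hφ hgJ x]
      congr 1
      funext ω
      have : (fun ω : ℕ → Ω => treeWeight f w l a φ ω *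
          treeWeight f w r (a + l.numNodes) (fun y => w (ω p, y)) ω * g (ω p)) = fun ω =>
          (treeWeight f w l a φ ω * g (ω p)) *
            treeWeight f w r (a + l.numNodes) (fun y => w (ω p, y)) ω := by
        funext ω
        ring
      -- The coordinate of p is held fixed while the right interval is integrated out.
      have hpn : p ∉ leaders f (a + l.numNodes) (a + l.numNodes + r.numNodes) := by
        rw [mem_leaders]
        omega
      rw [this, lmarginal_mul_left hmr2, if_neg h0, mul_assoc]
      · congr 2
        rw [← hr1 (φ := fun z => w (ω p, z)) (hw.comp (measurable_const.prodMk measurable_id)) ω]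
        unfold lmarginal
        refine lintegral_congr fun y => ?_
        have : Function.updateFinset ω
            (leaders f (a + l.numNodes) (a + l.numNodes + r.numNodes)) y p = ω p := by
          simp [Function.updateFinset, hpn]
        simp only [this]
      · intro y hy
        rw [hy p hpn]
        congr 1
        refine treeWeight_congr h1 _ fun j hj => hy j ?_
        exact Finset.disjoint_left.1 (disjoint_leaders _ _ _ _ _ le_rfl) hj

theorem treeIntegral_of_isEmpty [IsEmpty Ω] {t : BinaryTree Unit} (ht : t.numNodes ≠ 0)
    (φ g : Ω → ℝ≥0∞) : treeIntegral μ w t φ g = 0 := by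
  induction t generalizing φ g with
  | nil => exact absurd rfl ht
  | node u l r ihl ihr =>
    simp only [treeIntegral]
    split_ifs with h0
    · rw [lintegral_of_isEmpty, zero_mul]
    · exact ihl h0 _ _

theorem measurable_nestingWeight {n : ℕ} {v : Ω × Ω → ℝ} (hv : Measurable v)
    (π : Finpartition (Finset.univ : Finset (Fin n))) : Measurable (nestingWeight v π) := by
  unfold nestingWeight
  fun_prop

theorem lintegral_nestingWeight [SigmaFinite μ] {v : Ω × Ω → ℝ} (hv : Measurable v)
    (hv0 : ∀ p, 0 ≤ v p) {n : ℕ} {t : BinaryTree Unit} (ht : t.numNodes = n) :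
    ∫⁻ ω, ENNReal.ofReal (nestingWeight v (fiberPartition (leaderFun t) n) ω)
      ∂(Measure.pi fun _ => μ) = treeIntegral μ (fun p => ENNReal.ofReal (v p)) t 1 1 := by
  have hf : IsLeader (leaderFun t) 0 n := isLeader_leaderFun ht
  have hvE : Measurable fun p => ENNReal.ofReal (v p) := hv.ennreal_ofReal
  -- The coordinates that are not integrated need a base point. For empty Ω both sides are 1 if n =
  -- 0 and 0 otherwise.
  rcases isEmpty_or_nonempty Ω with hΩ | ⟨⟨x₀⟩⟩
  · cases n with
    | zero =>
      cases t with
      | nil =>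
        have hE : IsEmpty (fiberPartition (leaderFun .nil) 0).parts := by
          refine ⟨fun B => ?_⟩
          obtain ⟨i, -⟩ := Finpartition.nonempty_of_mem_parts _ B.2
          exact i.elim0
        rw [lintegral_congr (g := fun _ => 1) fun ω => by simp [nestingWeight], lintegral_const,
          Measure.pi_of_empty (fun _ => μ)]
        simp [treeIntegral]
      | node u l r => simp [numNodes] at ht
    | succ n =>
      have : IsEmpty ((fiberPartition (leaderFun t) (n + 1)).parts → Ω) :=
        ⟨fun ω => hΩ.elim (ω ⟨_, Finpartition.part_mem _ |>.2 (Finset.mem_univ (0 : Fin (n + 1)))⟩)⟩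
      rw [lintegral_of_isEmpty, treeIntegral_of_isEmpty (by omega)]
  · have h := lmarginal_treeWeight (μ := μ) hvE (encodes_leaderFun t) (φ := 1) (g := 1)
      measurable_const measurable_const fun _ => x₀
    rw [← h, zero_add, ht]
    unfold lmarginal
    rw [← (measurePreserving_piCongrLeft (fun _ => μ) (leadersEquiv hf)).lintegral_comp
      (measurable_nestingWeight hv _).ennreal_ofReal]
    refine lintegral_congr fun y => ?_
    set ω := Function.updateFinset (fun _ => x₀) (leaders (leaderFun t) 0 n) y with hω
    have hy : ∀ q : leaders (leaderFun t) 0 n, y q = ω q := fun q => by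
      simp [hω, Function.updateFinset]
    rw [nestingWeight_fiberPartition hf v ω]
    · simp only
      rw [(encodes_leaderFun t).treeWeight_eq, zero_add, ht, ENNReal.ofReal_prod_of_nonneg]
      · simp only [Pi.one_apply, ite_self, mul_one]
        refine Finset.prod_congr rfl fun q _ => ?_
        cases parent (leaderFun t) 0 n q with
        | bot => exact ENNReal.ofReal_one
        | coe p => rfl
      · intro q _
        cases parent (leaderFun t) 0 n q with
        | bot => exact zero_le_one
        | coe p => exact hv0 _
    · intro q
      rw [MeasurableEquiv.coe_piCongrLeft, Equiv.piCongrLeft_apply_apply, hy]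

/-- Integrating out the coordinates i and j first already gives zero on a null set, whatever the
total mass of the other coordinates. -/
theorem quasiMeasurePreserving_eval_pair {ι : Type*} [Fintype ι] [SigmaFinite μ] {i j : ι}
    (hij : i ≠ j) : Measure.QuasiMeasurePreserving (fun ω : ι → Ω => (ω i, ω j))
      (Measure.pi fun _ => μ) (μ.prod μ) := by
  classical
  have hm : Measurable fun ω : ι → Ω => (ω i, ω j) := by fun_prop
  refine ⟨hm, Measure.AbsolutelyContinuous.mk fun s hs h0 => ?_⟩
  rw [Measure.map_apply hm hs, ← lintegral_indicator_one (hm hs),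
    ← lintegral_zero (μ := Measure.pi fun _ : ι => μ)]
  have hind : Measurable (s.indicator (1 : Ω × Ω → ℝ≥0∞)) := measurable_one.indicator hs
  refine lintegral_eq_of_lmarginal_eq {i, j} (measurable_one.indicator (hm hs)) measurable_const ?_
  funext x
  rw [lmarginal_insert _ (measurable_one.indicator (hm hs)) (by simpa using hij),
    lmarginal_singleton]
  have hz : lmarginal (fun _ : ι => μ) {i, j} (fun _ => 0) x = 0 := by simp [lmarginal]
  rw [hz]
  have h1 : ∫⁻ a, ∫⁻ b, s.indicator (1 : Ω × Ω → ℝ≥0∞) (a, b) ∂μ ∂μ = 0 := by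
    rw [← lintegral_prod _ hind.aemeasurable, lintegral_indicator_one hs, h0]
  rw [← h1]
  refine lintegral_congr fun a => lintegral_congr fun b => ?_
  simp only [Set.indicator, Set.mem_preimage, Function.update_self, Function.update_of_ne hij]
  rfl

/-- A weight defined only almost everywhere may be evaluated at two distinct coordinates. The
restriction to depth greater than one is essential: `pred` maps a root to itself, and the diagonal
may be a null set. -/
theorem nestingWeight_ae_eq [SigmaFinite μ] {v v' : Ω × Ω → ℝ} (hv : ∀ᵐ p ∂(μ.prod μ), v p = v' p)
    {f : ℕ → ℕ} {n : ℕ} (hf : IsLeader f 0 n) :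
    nestingWeight v (fiberPartition f n) =ᵐ[Measure.pi fun _ => μ]
      nestingWeight v' (fiberPartition f n) := by
  have h : ∀ B : (fiberPartition f n).parts, 1 < depth (fiberPartition f n) B →
      ∀ᵐ ω : (fiberPartition f n).parts → Ω ∂(Measure.pi fun _ => μ),
        v (ω (pred (fiberPartition f n) B), ω B) = v' (ω (pred (fiberPartition f n) B), ω B) := by
    intro B hB
    obtain ⟨q, rfl⟩ := (leadersEquiv hf).surjective B
    rw [depth_gt_one_iff_parent, WithBot.ne_bot_iff_exists] at hB
    obtain ⟨p, hp⟩ := hB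
    have hmem := Finset.mem_of_max hp.symm
    rw [Finset.mem_filter, Finset.mem_Ico] at hmem
    have hpl := mem_parent_set hf hmem.1.2 hmem.2
    rw [pred_leadersEquiv hf ⟨p, hpl⟩ q hp.symm]
    refine (quasiMeasurePreserving_eval_pair fun hpq => ?_).ae hv
    have := congrArg Subtype.val ((leadersEquiv hf).injective hpq)
    simp only at this
    omega
  have h' := ae_all_iff.2 fun B => ae_all_iff.2 (h B)
  filter_upwards [h'] with ω hω
  exact Finset.prod_congr rfl fun B hB => hω B (Finset.mem_filter.1 hB).2

/-- Restricting to the cube over A replaces ρ by the finite measure ρ|_A in every coordinate.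
Convergence then follows from the pointwise bound on v', through the bound on the tree integral. -/
theorem integral_nestingWeight {ρ : Measure Ω} [SigmaFinite ρ] {A : Set Ω} (hA : ρ A ≠ ∞)
    {v v' : Ω × Ω → ℝ} (hv : ∀ᵐ p ∂(ρ.prod ρ), v p = v' p) (hv' : Measurable v')
    (hv0 : ∀ p, 0 ≤ v' p) {C : ℝ} (hC : ∀ p, v' p ≤ C) {n : ℕ} {t : BinaryTree Unit}
    (ht : t.numNodes = n) :
    IntegrableOn (nestingWeight v (fiberPartition (leaderFun t) n)) (Set.univ.pi fun _ => A)
        (Measure.pi fun _ => ρ) ∧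
      ∫ ω in Set.univ.pi fun _ => A, nestingWeight v (fiberPartition (leaderFun t) n) ω
        ∂(Measure.pi fun _ => ρ) = (treeIntegral (ρ.restrict A)
          (fun p => ENNReal.ofReal (v' p)) t 1 1).toReal := by
  have hfin : IsFiniteMeasure (ρ.restrict A) := isFiniteMeasure_restrict.2 hA
  have hrestr : (Measure.pi fun _ : (fiberPartition (leaderFun t) n).parts => ρ).restrict
      (Set.univ.pi fun _ => A) = Measure.pi fun _ => ρ.restrict A := Measure.restrict_pi_pi _ _
  have hv2 : ∀ᵐ p ∂((ρ.restrict A).prod (ρ.restrict A)), v p = v' p := by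
    rw [Measure.prod_restrict]
    exact ae_restrict_of_ae hv
  have hae := nestingWeight_ae_eq (n := n) hv2 (isLeader_leaderFun ht)
  have hnn : ∀ ω, 0 ≤ nestingWeight v' (fiberPartition (leaderFun t) n) ω := fun ω =>
    Finset.prod_nonneg fun B _ => hv0 _
  have hlint := lintegral_nestingWeight (μ := ρ.restrict A) hv' hv0 ht
  have hmeas := (measurable_nestingWeight hv' (fiberPartition (leaderFun t) n)).aestronglyMeasurable
    (μ := Measure.pi fun _ => ρ.restrict A)
  obtain ⟨K, hK⟩ := exists_treeIntegral_le (μ := ρ.restrict A)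
    (w := fun p => ENNReal.ofReal (v' p)) (C := C.toNNReal)
    (fun p => ENNReal.ofReal_le_ofReal (hC p)) t 1
  rw [IntegrableOn, hrestr, integral_congr_ae hae, integral_eq_lintegral_of_nonneg_ae
    (Filter.Eventually.of_forall hnn) hmeas, hlint]
  refine ⟨Integrable.congr ⟨hmeas, ?_⟩ hae.symm, rfl⟩
  rw [hasFiniteIntegral_iff_ofReal (Filter.Eventually.of_forall hnn), hlint]
  exact (hK 1 1 (fun _ => le_rfl) fun _ => le_rfl).trans_lt ENNReal.coe_lt_top

end TreeIntegral

/-! ### Boolean cumulants and interval partitions -/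

section BooleanCumulants

open Finset BinaryTree

theorem sum_treesOfNumNodesEq_succ {R : Type*} [AddCommMonoid R] (F : BinaryTree Unit → R) (n : ℕ) :
    ∑ t ∈ treesOfNumNodesEq (n + 1), F t = ∑ p ∈ antidiagonal n, ∑ l ∈ treesOfNumNodesEq p.1,
      ∑ r ∈ treesOfNumNodesEq p.2, F (.node () l r) := by
  rw [treesOfNumNodesEq_succ, sum_biUnion]
  · refine sum_congr rfl fun p _ => ?_
    rw [sum_map, sum_product]
    rfl
  · intro p _ q _ hpq
    rw [Function.onFun, disjoint_left]
    intro t ht ht'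
    simp only [mem_map, mem_product, mem_treesOfNumNodesEq, Prod.exists] at ht ht'
    obtain ⟨l, r, h, rfl⟩ := ht
    obtain ⟨l', r', h', h2⟩ := ht'
    have h3 : node () l' r' = node () l r := h2
    rw [BinaryTree.node.injEq] at h3
    obtain ⟨-, rfl, rfl⟩ := h3
    exact hpq (Prod.ext (h.1.symm.trans h'.1) (h.2.symm.trans h'.2))

/-- The trees that encode interval partitions. -/
def IsIntervalTree : BinaryTree Unit → Prop
  | .nil => True
  | .node _ l r => if l.numNodes = 0 then IsIntervalTree r else r.numNodes = 0 ∧ IsIntervalTree l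

/-- If both subtrees are nonempty, the last element is joined across the right interval, so it is
neither its own leader nor in the block of its left neighbour. -/
theorem Encodes.isIntervalTree_iff {f : ℕ → ℕ} {t : BinaryTree Unit} {a : ℕ} (h : Encodes f t a) :
    IsIntervalTree t ↔ ∀ j, a < j → j < a + t.numNodes → f j = j ∨ f j = f (j - 1) := by
  induction t generalizing a with
  | nil =>
    simp only [IsIntervalTree, numNodes, true_iff]
    omega
  | node u l r ihl ihr =>
    obtain ⟨h1, h2, h3⟩ := h
    have hb : a + (node u l r).numNodes = a + l.numNodes + r.numNodes + 1 := by
      simp only [numNodes]; omega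
    rw [hb]
    simp only [IsIntervalTree]
    split_ifs with h0
    · rw [if_pos h0] at h3
      rw [ihr h2]
      constructor
      · intro h j hj1 hj2
        rcases Nat.lt_succ_iff_lt_or_eq.1 hj2 with hj3 | rfl
        · exact h j (by omega) (by omega)
        · exact Or.inl h3
      · intro h j hj1 hj2
        exact h j (by omega) (by omega)
    · rw [if_neg h0] at h3
      rw [ihl h1]
      constructor
      · rintro ⟨hr0, h⟩ j hj1 hj2
        rcases Nat.lt_succ_iff_lt_or_eq.1 hj2 with hj3 | rfl
        · exact h j hj1 (by omega)
        · right
          rw [h3, hr0, Nat.add_zero]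
      · intro h
        refine ⟨?_, fun j hj1 hj2 => h j hj1 (by omega)⟩
        by_contra hr0
        have h4 := h (a + l.numNodes + r.numNodes) (by omega) (by omega)
        have h5 := h1.isLeader.apply_le (a + l.numNodes - 1) (by omega) (by omega)
        have h6 := h2.isLeader.le_apply (a + l.numNodes + r.numNodes - 1) (by omega) (by omega)
        omega

theorem isIntervalPartition_fiberPartition_iff {f : ℕ → ℕ} {n : ℕ} (hf : IsLeader f 0 n) :
    IsIntervalPartition (fiberPartition f n) ↔ ∀ j, 0 < j → j < n → f j = j ∨ f j = f (j - 1) := by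
  constructor
  · intro h j hj0 hj
    by_cases hjj : f j = j
    · exact Or.inl hjj
    right
    have hle := hf.apply_le j (Nat.zero_le _) hj
    obtain ⟨i, i', -, hB⟩ := h _ (part_fiberPartition f ⟨j, hj⟩ ▸
      Finpartition.part_mem _ |>.2 (mem_univ _))
    have h1 : (⟨j, hj⟩ : Fin n) ∈ Icc i i' := hB ▸ mem_block.2 rfl
    have h2 : (⟨f j, by omega⟩ : Fin n) ∈ Icc i i' :=
      hB ▸ mem_block.2 (hf.apply_apply j (Nat.zero_le _) hj)
    rw [mem_Icc, Fin.le_def, Fin.le_def] at h1 h2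
    simp only at h1 h2
    have h3 : (⟨j - 1, by omega⟩ : Fin n) ∈ Icc i i' := by
      rw [mem_Icc, Fin.le_def, Fin.le_def]
      simp only
      omega
    rw [← hB, mem_block] at h3
    exact h3.symm
  · intro h B hB
    obtain ⟨q, hq, rfl⟩ := (mem_parts_fiberPartition hf).1 hB
    rw [mem_leaders] at hq
    have hqm : (⟨q, hq.1.2⟩ : Fin n) ∈ block f n q := mem_block.2 hq.2
    obtain ⟨m, hm, hmax⟩ := (block f n q).exists_max_image id ⟨_, hqm⟩
    refine ⟨⟨q, hq.1.2⟩, m, hmax _ hqm, ?_⟩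
    rw [mem_block] at hm
    -- Descent from the maximum of the block: an element above q in the block is not a leader, so
    -- its left neighbour lies in the block too.
    have key : ∀ d : ℕ, q ≤ m - d → d ≤ m → f (m - d) = q := by
      intro d
      induction d with
      | zero => exact fun _ _ => hm
      | succ d ih =>
        intro h1 h2
        have h3 := ih (by omega) (by omega)
        have h4 := h (m - d) (by omega) (by omega)
        rw [show (m : ℕ) - (d + 1) = m - d - 1 by omega]
        omega
    ext x
    rw [mem_block, mem_Icc, Fin.le_def]
    constructor
    · intro hx
      have := hf.apply_le x (Nat.zero_le _) x.2
      exact ⟨by simp only; omega, hmax x (mem_block.2 hx)⟩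
    · rintro ⟨h1, h2⟩
      rw [Fin.le_def] at h2
      simp only at h1
      have := key (m - x) (by omega) (by omega)
      rwa [show (m : ℕ) - (m - x) = x by omega] at this

theorem IsIntervalPartition.isNoncrossing {n : ℕ} {π : Finpartition (univ : Finset (Fin n))}
    (h : IsIntervalPartition π) : IsNoncrossing π := by
  intro B hB B₂ hB₂ i i₂ j j₂ h1 h2 h3 hi hj hi₂ hj₂
  obtain ⟨a, b, -, rfl⟩ := h B hB
  rw [mem_Icc] at hi hj
  exact π.eq_of_mem_parts hB hB₂ (mem_Icc.2 ⟨hi.1.trans h1.le, h2.le.trans hj.2⟩) hi₂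

open Classical in
/-- The sum over the interval partitions `π` of `{1, …, n}` of `∏_{B ∈ π} s |B|`, where `m` is added
to the size of the last block. -/
noncomputable def intervalSum (s : ℕ → ℝ) (n m : ℕ) : ℝ :=
  ∑ t ∈ treesOfNumNodesEq n, if IsIntervalTree t then blockProd s t m else 0

theorem intervalSum_zero (s : ℕ → ℝ) (m : ℕ) : intervalSum s 0 m = 1 := by
  simp [intervalSum, IsIntervalTree, blockProd]

theorem intervalSum_succ_eq_add (s : ℕ → ℝ) (n m : ℕ) :
    intervalSum s (n + 1) m = s (m + 1) * intervalSum s n 0 +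
      if n = 0 then 0 else intervalSum s n (m + 1) := by
  classical
  rw [intervalSum, sum_treesOfNumNodesEq_succ]
  -- Only an empty left subtree (the last element is a singleton) or an empty right subtree (it
  -- joins its neighbour) contributes. For n = 0 the two cases coincide, and the inner conditional
  -- avoids counting twice.
  have h1 : ∀ p ∈ antidiagonal n, (∑ l ∈ treesOfNumNodesEq p.1, ∑ r ∈ treesOfNumNodesEq p.2,
      if IsIntervalTree (.node () l r) then blockProd s (.node () l r) m else 0) =
      (if p = (0, n) then s (m + 1) * intervalSum s n 0 else 0) +
        if p = (n, 0) then (if n = 0 then 0 else intervalSum s n (m + 1)) else 0 := by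
    rintro ⟨i, j⟩ hp
    rw [HasAntidiagonal.mem_antidiagonal] at hp
    simp only at hp
    by_cases hi : i = 0
    · subst hi
      obtain rfl : j = n := by omega
      have : (if ((0, j) : ℕ × ℕ) = (j, 0) then (if j = 0 then 0 else intervalSum s j (m + 1)) else 0)
          = 0 := by
        by_cases hj : j = 0 <;> simp [hj, eq_comm]
      rw [if_pos rfl, this, add_zero, intervalSum, mul_sum]
      simp [IsIntervalTree, blockProd, numNodes]
    · rw [if_neg (by simp [hi]), zero_add]
      by_cases hj : j = 0
      · subst hj
        obtain rfl : i = n := by omega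
        rw [if_pos rfl, if_neg hi, intervalSum]
        refine sum_congr rfl fun l hl => ?_
        rw [mem_treesOfNumNodesEq] at hl
        simp [IsIntervalTree, blockProd, numNodes, hl, hi]
      · rw [if_neg (by simp [hj])]
        refine sum_eq_zero fun l hl => sum_eq_zero fun r hr => ?_
        rw [mem_treesOfNumNodesEq] at hl hr
        simp [IsIntervalTree, hl, hr, hi, hj]
  rw [sum_congr rfl h1, sum_add_distrib, sum_ite_eq' (antidiagonal n), sum_ite_eq' (antidiagonal n),
    if_pos (by simp), if_pos (by simp)]

/-- Unrolls `intervalSum_succ_eq_add` along the last block, which has p.1 + 1 elements. -/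
theorem intervalSum_succ (s : ℕ → ℝ) (n m : ℕ) :
    intervalSum s (n + 1) m = ∑ p ∈ antidiagonal n, s (m + 1 + p.1) * intervalSum s p.2 0 := by
  induction n generalizing m with
  | zero => rw [intervalSum_succ_eq_add]; simp
  | succ n ih =>
    rw [intervalSum_succ_eq_add, if_neg (Nat.succ_ne_zero n), ih (m + 1),
      Finset.Nat.sum_antidiagonal_succ]
    refine congrArg₂ (· + ·) rfl (sum_congr rfl fun p _ => ?_)
    rw [show m + 1 + 1 + p.1 = m + 1 + (p.1 + 1) by omega]

theorem prod_parts_eq_blockProd {R : Type*} [CommMonoid R] (s : ℕ → R) {t : BinaryTree Unit} {n : ℕ}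
    (ht : t.numNodes = n) :
    ∏ B ∈ (fiberPartition (leaderFun t) n).parts, s B.card = blockProd s t 0 := by
  rw [prod_parts_fiberPartition (isLeader_leaderFun ht), (encodes_leaderFun t).blockProd_eq]
  simp only [zero_add, ht, ite_self, add_zero]

/-- Replacing each moment by its negative produces the sign (-1)^{|π|}. For n + 1 points |π| ≥ 1, so
the exponent |π| - 1 costs exactly one further sign. -/
theorem booleanCumulant_eq_intervalSum (μ : Measure ℝ) (n : ℕ) :
    booleanCumulant μ (n + 1) = -intervalSum (fun i => -moment μ i) (n + 1) 0 := by
  classical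
  have h1 : booleanCumulant μ (n + 1) = ∑ π ∈ noncrossingPartitions (n + 1),
      if IsIntervalPartition π then
        (-1) ^ (π.parts.card - 1) * ∏ B ∈ π.parts, moment μ B.card else 0 := by
    rw [booleanCumulant, ← sum_filter]
    refine sum_congr ?_ fun _ _ => rfl
    ext π
    simp only [intervalPartitions, noncrossingPartitions, mem_filter, mem_univ, true_and]
    exact ⟨fun h => ⟨h.isNoncrossing, h⟩, fun h => h.2⟩
  rw [h1, sum_noncrossingPartitions, intervalSum, ← sum_neg_distrib]
  refine sum_congr rfl fun t ht => ?_
  rw [mem_treesOfNumNodesEq] at ht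
  have hf := isLeader_leaderFun ht
  have hint : IsIntervalPartition (fiberPartition (leaderFun t) (n + 1)) ↔ IsIntervalTree t := by
    rw [isIntervalPartition_fiberPartition_iff hf, (encodes_leaderFun t).isIntervalTree_iff,
      zero_add, ht]
  simp only [hint]
  split_ifs with hI
  · rw [← prod_parts_eq_blockProd (fun i => -moment μ i) ht]
    have hcard : (fiberPartition (leaderFun t) (n + 1)).parts.card ≠ 0 :=
      card_ne_zero_of_mem (Finpartition.part_mem _ |>.2 (mem_univ (0 : Fin (n + 1))))
    obtain ⟨c, hc⟩ := Nat.exists_eq_succ_of_ne_zero hcard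
    simp_rw [neg_eq_neg_one_mul (moment μ _)]
    rw [prod_mul_distrib, prod_const, hc, Nat.succ_sub_one, pow_succ]
    ring
  · rw [neg_zero]

/-- Boolean cumulants are determined by their recursive relation with the moments. -/
theorem booleanCumulant_eq_of_recursion (μ : Measure ℝ) (c : ℕ → ℝ) (h0 : moment μ 0 = 1)
    (hc : ∀ n, moment μ (n + 1) = ∑ p ∈ antidiagonal n, c (p.1 + 1) * moment μ p.2) (n : ℕ) :
    booleanCumulant μ (n + 1) = c (n + 1) := by
  induction n using Nat.strong_induction_on with
  | h n ih =>
    have h1 := hc n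
    rw [booleanCumulant_eq_intervalSum, intervalSum_succ]
    cases n with
    | zero =>
      simp [intervalSum_zero, h0] at h1 ⊢
      exact h1
    | succ n =>
      rw [Finset.Nat.sum_antidiagonal_succ', h0] at h1
      rw [Finset.Nat.sum_antidiagonal_succ', intervalSum_zero]
      simp only at h1 ⊢
      -- After swapping the antidiagonal, the induction hypothesis replaces each shorter interval
      -- sum by -c.
      have h2 : ∑ p ∈ antidiagonal n, -moment μ (0 + 1 + p.1) *
          intervalSum (fun i => -moment μ i) (p.2 + 1) 0 =
          ∑ p ∈ antidiagonal n, c (p.1 + 1) * moment μ (p.2 + 1) := by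
        rw [← Finset.Nat.sum_antidiagonal_swap]
        refine sum_congr rfl fun p hp => ?_
        have hp1 : p.1 < n + 1 := by
          have := HasAntidiagonal.mem_antidiagonal.1 hp
          omega
        rw [← ih p.1 hp1, booleanCumulant_eq_intervalSum, Prod.fst_swap, Prod.snd_swap,
          show 0 + 1 + p.2 = p.2 + 1 by omega]
        ring
      rw [h2, show 0 + 1 + (n + 1) = n + 1 + 1 by omega]
      linarith

end BooleanCumulants

/-! ### Recursions for sums over non-crossing partitions -/

section TreeSum

open Finset BinaryTree

universe u

/-- Both sides run over the triples of natural numbers with sum n. -/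
theorem sum_antidiagonal_fst_comm {R : Type*} [AddCommMonoid R] (f : ℕ → ℕ → ℕ → R) (n : ℕ) :
    ∑ p ∈ antidiagonal n, ∑ q ∈ antidiagonal p.1, f p.2 q.1 q.2 =
      ∑ p ∈ antidiagonal n, ∑ q ∈ antidiagonal p.1, f q.1 q.2 p.2 := by
  rw [sum_sigma', sum_sigma']
  refine sum_nbij' (fun x => ⟨(x.1.2 + x.2.1, x.2.2), (x.1.2, x.2.1)⟩)
    (fun x => ⟨(x.2.2 + x.1.2, x.2.1), (x.2.2, x.1.2)⟩) ?_ ?_ ?_ ?_ ?_ <;>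
  rintro ⟨⟨a, b⟩, ⟨c, d⟩⟩ hx <;>
  simp only [mem_sigma, HasAntidiagonal.mem_antidiagonal] at hx ⊢ <;>
  obtain ⟨h1, h2⟩ := hx <;> subst h2 <;> simp <;> omega

variable {Ω : Type u} [MeasurableSpace Ω] {μ : Measure Ω} {w : Ω × Ω → ℝ≥0∞}

/-- The sum over the non-crossing partitions of `{1, …, n}` of the products of the weights `κ |B|`
of the blocks and the integral of the tree, where `m` is added to the size of the last block. -/
noncomputable def treeSum (μ : Measure Ω) (w : Ω × Ω → ℝ≥0∞) (κ : ℕ → ℂ) (m n : ℕ)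
    (φ g : Ω → ℝ≥0∞) : ℂ :=
  ∑ t ∈ treesOfNumNodesEq n, blockProd κ t m * ((treeIntegral μ w t φ g).toReal : ℂ)

theorem treeSum_zero (κ : ℕ → ℂ) (m : ℕ) (φ g : Ω → ℝ≥0∞) : treeSum μ w κ m 0 φ g = 1 := by
  simp [treeSum, blockProd, treeIntegral]

/-- The sum of the trees that hang below a vertex `y`. -/
noncomputable def treeFun (μ : Measure Ω) (w : Ω × Ω → ℝ≥0∞) (κ : ℕ → ℂ) (n : ℕ) (y : Ω) : ℂ :=
  treeSum μ w κ 0 n (fun z => w (y, z)) 1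

theorem treeFun_zero (κ : ℕ → ℂ) (y : Ω) : treeFun μ w κ 0 y = 1 := treeSum_zero κ 0 _ _

theorem measurable_treeFun [SFinite μ] (hw : Measurable w) (κ : ℕ → ℂ) (n : ℕ) :
    Measurable (treeFun μ w κ n) := by
  refine Finset.measurable_sum _ fun t _ => Measurable.const_mul ?_ _
  exact Complex.measurable_ofReal.comp
    (measurable_treeIntegral hw t (G := fun _ => 1) hw measurable_const).ennreal_toReal

theorem exists_treeFun_le [IsFiniteMeasure μ] {C : ℝ≥0} (hw : ∀ p, w p ≤ C) (κ : ℕ → ℂ) (n : ℕ) :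
    ∃ K : ℝ, ∀ y, ‖treeFun μ w κ n y‖ ≤ K := by
  choose K hK using fun t => exists_treeIntegral_le (μ := μ) hw t (max C 1)
  refine ⟨∑ t ∈ treesOfNumNodesEq n, ‖blockProd κ t 0‖ * K t, fun y => norm_sum_le_of_le _ ?_⟩
  intro t _
  rw [norm_mul, Complex.norm_real, Real.norm_of_nonneg ENNReal.toReal_nonneg]
  refine mul_le_mul_of_nonneg_left ?_ (norm_nonneg _)
  refine ENNReal.toReal_le_coe_of_le_coe (hK t _ _ (fun z => ?_) fun z => ?_)
  · exact (hw _).trans (by exact_mod_cast le_max_left C 1)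
  · exact ENNReal.one_le_coe_iff.2 (le_max_right C 1)

/-- Splitting off the last element of the interval. -/
theorem treeSum_succ (κ : ℕ → ℂ) (m n : ℕ) (φ g : Ω → ℝ≥0∞) :
    treeSum μ w κ m (n + 1) φ g =
      κ (m + 1) * ((∫⁻ y, φ y * g y ∂μ).toReal : ℂ) * treeSum μ w κ 0 n φ 1 +
        ∑ p ∈ antidiagonal n, if p.1 = 0 then 0 else ∑ r ∈ treesOfNumNodesEq p.2,
          blockProd κ r 0 * treeSum μ w κ (m + 1) p.1 φ
            fun y => g y * treeIntegral μ w r (fun z => w (y, z)) 1 := by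
  rw [treeSum, sum_treesOfNumNodesEq_succ]
  -- The case of a singleton last element is the term p.1 = 0 of the antidiagonal.
  have h1 : κ (m + 1) * ((∫⁻ y, φ y * g y ∂μ).toReal : ℂ) * treeSum μ w κ 0 n φ 1 =
      ∑ p ∈ antidiagonal n, if p.1 = 0 then
        κ (m + 1) * ((∫⁻ y, φ y * g y ∂μ).toReal : ℂ) * treeSum μ w κ 0 p.2 φ 1 else 0 := by
    rw [Finset.sum_eq_single (0, n)]
    · simp
    · rintro ⟨i, j⟩ hp hne
      rw [HasAntidiagonal.mem_antidiagonal] at hp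
      rw [if_neg]
      rintro rfl
      exact hne (by simpa using hp)
    · simp
  rw [h1, ← sum_add_distrib]
  refine sum_congr rfl fun p _ => ?_
  split_ifs with h0
  · rw [h0, treesOfNumNodesEq_zero, sum_singleton, add_zero, treeSum, mul_sum]
    refine sum_congr rfl fun r _ => ?_
    rw [blockProd, treeIntegral, numNodes, if_pos rfl, if_pos rfl, ENNReal.toReal_mul, Complex.ofReal_mul]
    ring
  · rw [zero_add, sum_comm]
    refine sum_congr rfl fun r _ => ?_
    rw [treeSum, mul_sum]
    refine sum_congr rfl fun l hl => ?_
    rw [mem_treesOfNumNodesEq] at hl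
    rw [blockProd, treeIntegral, hl, if_neg h0, if_neg h0]
    ring

theorem integrable_toReal_mul [IsFiniteMeasure μ] {f : Ω → ℝ≥0∞} {D : ℝ≥0} (hf : Measurable f)
    (hfD : ∀ y, f y ≤ D) {F : Ω → ℂ} (hF : Measurable F) {K : ℝ} (hK : ∀ y, ‖F y‖ ≤ K) :
    Integrable (fun y => ((f y).toReal : ℂ) * F y) μ := by
  refine Integrable.of_bound
    ((Complex.measurable_ofReal.comp hf.ennreal_toReal).mul hF).aestronglyMeasurable (D * K)
    (Filter.Eventually.of_forall fun y => ?_)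
  rw [norm_mul, Complex.norm_real, Real.norm_of_nonneg ENNReal.toReal_nonneg]
  exact mul_le_mul (ENNReal.toReal_le_coe_of_le_coe (hfD y)) (hK y) (norm_nonneg _) D.2

/-- Splitting off the component of the last element of the interval. -/
theorem treeSum_succ_eq_sum [IsFiniteMeasure μ] {C : ℝ≥0} (hwm : Measurable w) (hw : ∀ p, w p ≤ C)
    (κ : ℕ → ℂ) {F : ℕ → ℕ → Ω → ℂ} (hF : ∀ m b, Measurable (F m b))
    (hFb : ∀ m b, ∃ K : ℝ, ∀ y, ‖F m b y‖ ≤ K) (hF0 : ∀ m y, F m 0 y = κ (m + 1))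
    (hFs : ∀ m b y, F m (b + 1) y =
      ∑ p ∈ antidiagonal b, treeFun μ w κ p.1 y * F (m + 1) p.2 y) (n m : ℕ) {φ g : Ω → ℝ≥0∞}
    (hφ : Measurable φ) (hg : Measurable g) {D E : ℝ≥0} (hφD : ∀ y, φ y ≤ D) (hgE : ∀ y, g y ≤ E) :
    treeSum μ w κ m (n + 1) φ g = ∑ p ∈ antidiagonal n,
      (∫ y, ((φ y * g y).toReal : ℂ) * F m p.1 y ∂μ) * treeSum μ w κ 0 p.2 φ 1 := by
  induction n using Nat.strong_induction_on generalizing m g E with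
  | h n ih =>
    have hφg : Measurable fun y => φ y * g y := hφ.mul hg
    have hφgD : ∀ y, φ y * g y ≤ (D * E : ℝ≥0) := fun y => by
      rw [ENNReal.coe_mul]
      exact mul_le_mul' (hφD y) (hgE y)
    have hI0 : (∫ y, ((φ y * g y).toReal : ℂ) * F m 0 y ∂μ) =
        κ (m + 1) * ((∫⁻ y, φ y * g y ∂μ).toReal : ℂ) := by
      simp only [hF0]
      rw [integral_mul_const, integral_complex_ofReal, integral_toReal hφg.aemeasurable
        (Filter.Eventually.of_forall fun y => (hφgD y).trans_lt ENNReal.coe_lt_top), mul_comm]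
    rw [treeSum_succ]
    cases n with
    | zero => rw [Finset.Nat.antidiagonal_zero, sum_singleton, sum_singleton, if_pos rfl, add_zero, hI0]
    | succ n =>
      rw [Finset.Nat.sum_antidiagonal_succ, Finset.Nat.sum_antidiagonal_succ, hI0, if_pos rfl,
        zero_add]
      congr 1
      -- The induction hypothesis is used with m + 1, as the removed element belongs to the last
      -- block, and with g multiplied by the integral of the right subtree. Summing over right
      -- subtrees then yields `treeFun`, the weight of the last gap.
      have hterm : ∀ p ∈ antidiagonal n, (if p.1 + 1 = 0 then 0 else
          ∑ r ∈ treesOfNumNodesEq p.2, blockProd κ r 0 * treeSum μ w κ (m + 1) (p.1 + 1) φ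
            fun y => g y * treeIntegral μ w r (fun z => w (y, z)) 1) =
          ∑ q ∈ antidiagonal p.1, (∫ y, ((φ y * g y).toReal : ℂ) *
            (treeFun μ w κ p.2 y * F (m + 1) q.1 y) ∂μ) * treeSum μ w κ 0 q.2 φ 1 := by
        intro p hp
        have hpn : p.1 < n + 1 := by
          have := HasAntidiagonal.mem_antidiagonal.1 hp
          omega
        rw [if_neg (Nat.succ_ne_zero _)]
        choose Kr hKr using fun r => exists_treeIntegral_le (μ := μ) hw r (max C 1)
        have hrm : ∀ r, Measurable fun y => treeIntegral μ w r (fun z => w (y, z)) 1 := fun r =>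
          measurable_treeIntegral hwm r (G := fun _ => 1) hwm measurable_const
        have hrb : ∀ r y, treeIntegral μ w r (fun z => w (y, z)) 1 ≤ Kr r := fun r y =>
          hKr r _ _ (fun z => (hw _).trans (by exact_mod_cast le_max_left C 1))
            fun z => by exact ENNReal.one_le_coe_iff.2 (le_max_right C 1)
        have hstep : ∀ r, treeSum μ w κ (m + 1) (p.1 + 1) φ
            (fun y => g y * treeIntegral μ w r (fun z => w (y, z)) 1) =
            ∑ q ∈ antidiagonal p.1, (∫ y, ((φ y * g y).toReal : ℂ) *
              (((treeIntegral μ w r (fun z => w (y, z)) 1).toReal : ℂ) * F (m + 1) q.1 y) ∂μ) *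
                treeSum μ w κ 0 q.2 φ 1 := by
          intro r
          have hgr : Measurable fun y => g y * treeIntegral μ w r (fun z => w (y, z)) 1 :=
            hg.mul (hrm r)
          rw [ih p.1 hpn (m + 1) hgr (E := E * Kr r) fun y => by
            rw [ENNReal.coe_mul]
            exact mul_le_mul' (hgE y) (hrb r y)]
          refine sum_congr rfl fun q _ => ?_
          congr 1
          refine integral_congr_ae (Filter.Eventually.of_forall fun y => ?_)
          simp only [ENNReal.toReal_mul, Complex.ofReal_mul]
          ring
        simp only [hstep, mul_sum]
        rw [sum_comm]
        refine sum_congr rfl fun q _ => ?_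
        have hint : (∫ y, ((φ y * g y).toReal : ℂ) * (treeFun μ w κ p.2 y * F (m + 1) q.1 y) ∂μ) =
            ∑ r ∈ treesOfNumNodesEq p.2, blockProd κ r 0 * ∫ y, ((φ y * g y).toReal : ℂ) *
              (((treeIntegral μ w r (fun z => w (y, z)) 1).toReal : ℂ) * F (m + 1) q.1 y) ∂μ := by
          simp only [← integral_const_mul]
          rw [← integral_finsetSum]
          · refine integral_congr_ae (Filter.Eventually.of_forall fun y => ?_)
            simp only [treeFun, treeSum, sum_mul, mul_sum]
            refine sum_congr rfl fun r _ => ?_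
            ring
          · intro r _
            obtain ⟨K, hK⟩ := hFb (m + 1) q.1
            refine (integrable_toReal_mul hφg hφgD (K := Kr r * K)
              ((Complex.measurable_ofReal.comp (hrm r).ennreal_toReal).mul (hF _ _))
              fun y => ?_).const_mul _
            simp only [Pi.mul_apply, Function.comp_apply]
            rw [norm_mul, Complex.norm_real, Real.norm_of_nonneg ENNReal.toReal_nonneg]
            exact mul_le_mul (ENNReal.toReal_le_coe_of_le_coe (hrb r y)) (hK y) (norm_nonneg _)
              (Kr r).2
        rw [hint, sum_mul]
        refine sum_congr rfl fun r _ => ?_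
        ring
      -- The last gap is regrouped with the rest of its component, so that together they form F m (b
      -- + 1) by `hFs`.
      rw [sum_congr rfl hterm,
        sum_antidiagonal_fst_comm (fun j b c => (∫ y, ((φ y * g y).toReal : ℂ) *
            (treeFun μ w κ j y * F (m + 1) b y) ∂μ) * treeSum μ w κ 0 c φ 1)]
      refine sum_congr rfl fun p _ => ?_
      rw [← sum_mul]
      congr 1
      simp only [hFs, mul_sum]
      rw [integral_finsetSum]
      intro q _
      obtain ⟨K, hK⟩ := hFb (m + 1) q.2
      obtain ⟨L, hL⟩ := exists_treeFun_le (μ := μ) hw κ q.1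
      exact integrable_toReal_mul hφg hφgD ((measurable_treeFun hwm κ q.1).mul (hF _ _))
        (K := L * K) fun y => by
          rw [norm_mul]
          exact mul_le_mul (hL y) (hK y) (norm_nonneg _) ((norm_nonneg _).trans (hL y))

end TreeSum

/-! ### Vectors carried by open blocks -/

section TreeVec

open Finset

universe u

variable {Ω : Type u}
  {H : Type*} [NormedAddCommGroup H] [InnerProductSpace ℂ H]

/-- The vector that an open block carries when its last element has just been reached, where
`b` elements follow its first element, and `M` are the sums over the hanging trees. -/
noncomputable def openVec (M : ℕ → Ω → ℂ) (S : H →L[ℂ] H) (h : H) : ℕ → Ω → H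
  | 0, _ => h
  | b + 1, y => S (∑ i : Fin (b + 1), M (b - i) y • openVec M S h i y)

/-- The vector that an open block carries, followed by hanging trees. -/
noncomputable def treeVec (M : ℕ → Ω → ℂ) (S : H →L[ℂ] H) (h : H) (n : ℕ) (y : Ω) : H :=
  ∑ p ∈ antidiagonal n, M p.1 y • openVec M S h p.2 y

theorem openVec_succ (M : ℕ → Ω → ℂ) (S : H →L[ℂ] H) (h : H) (b : ℕ) (y : Ω) :
    openVec M S h (b + 1) y = S (treeVec M S h b y) := by
  rw [openVec, treeVec, ← Finset.Nat.sum_antidiagonal_swap,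
    Finset.Nat.sum_antidiagonal_eq_sum_range_succ_mk, ← Fin.sum_univ_eq_sum_range
      (fun i => M (i, b - i).swap.1 y • openVec M S h (i, b - i).swap.2 y) (b + 1)]
  rfl

theorem treeVec_zero {M : ℕ → Ω → ℂ} (hM0 : ∀ y, M 0 y = 1) (S : H →L[ℂ] H) (h : H) (y : Ω) :
    treeVec M S h 0 y = h := by
  rw [treeVec, Finset.Nat.antidiagonal_zero, sum_singleton, hM0, one_smul, openVec]

/-- Either no tree hangs after the latest element of the block, which is then reached by an S, or
the last hanging component, of weight E, is split off. This is the recursion that X̂ imposes on the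
created functions t_n. -/
theorem treeVec_succ {M E : ℕ → Ω → ℂ} (hM0 : ∀ y, M 0 y = 1) (hM : ∀ n y, M (n + 1) y =
      ∑ p ∈ antidiagonal n, E p.1 y * M p.2 y) (S : H →L[ℂ] H) (h : H) (n : ℕ) (y : Ω) :
    treeVec M S h (n + 1) y = S (treeVec M S h n y) +
      ∑ p ∈ antidiagonal n, E p.1 y • treeVec M S h p.2 y := by
  rw [treeVec, Finset.Nat.sum_antidiagonal_succ, hM0, one_smul, openVec_succ]
  congr 1
  simp only [hM, sum_smul, mul_smul, treeVec, smul_sum]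
  rw [← sum_antidiagonal_fst_comm (fun b c i => E b y • M c y • openVec M S h i y),
    ← Finset.Nat.sum_antidiagonal_swap]
  rfl

theorem exists_treeVec_le {M : ℕ → Ω → ℂ} (hM : ∀ n, ∃ K : ℝ, ∀ y, ‖M n y‖ ≤ K) (S : H →L[ℂ] H)
    (h : H) (n : ℕ) : ∃ K : ℝ, ∀ y, ‖treeVec M S h n y‖ ≤ K := by
  choose K hK using hM
  have ho : ∀ b, ∃ L : ℝ, ∀ y, ‖openVec M S h b y‖ ≤ L := by
    intro b
    induction b using Nat.strong_induction_on with
    | h b ih =>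
      cases b with
      | zero => exact ⟨‖h‖, fun y => by rw [openVec]⟩
      | succ b =>
        choose L hL using ih
        refine ⟨‖S‖ * ∑ i : Fin (b + 1), K (b - i) * L i i.2, fun y => ?_⟩
        rw [openVec]
        refine S.le_opNorm_of_le (norm_sum_le_of_le _ fun i _ => ?_)
        rw [norm_smul]
        exact mul_le_mul (hK _ y) (hL _ _ y) (norm_nonneg _) ((norm_nonneg _).trans (hK _ y))
  choose L hL using ho
  refine ⟨∑ p ∈ antidiagonal n, K p.1 * L p.2, fun y => norm_sum_le_of_le _ fun p _ => ?_⟩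
  rw [norm_smul]
  exact mul_le_mul (hK _ y) (hL _ y) (norm_nonneg _) ((norm_nonneg _).trans (hK _ y))

/-- The weight of a block that is closed by `m + 1` further elements. -/
noncomputable def closeFun (κ : ℕ → ℂ) (M : ℕ → Ω → ℂ) (S : H →L[ℂ] H) (h : H) (m : ℕ) :
    ℕ → Ω → ℂ
  | 0, _ => κ (m + 1)
  | b + 1, y => ⟪h, (S ^ m) (treeVec M S h b y)⟫_ℂ

/-- Expanding `treeVec` by its last gap leaves an open vector h, which closes to κ (m + 2), or an
image under S, which raises the power of S by one. This is the property required of F in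
`treeSum_succ_eq_sum`. -/
theorem closeFun_succ {κ : ℕ → ℂ} {S : H →L[ℂ] H} {h : H} (hκ : ∀ r, κ (r + 2) = ⟪h, (S ^ r) h⟫_ℂ)
    (M : ℕ → Ω → ℂ) (m b : ℕ) (y : Ω) : closeFun κ M S h m (b + 1) y =
      ∑ p ∈ antidiagonal b, M p.1 y * closeFun κ M S h (m + 1) p.2 y := by
  have h1 : ∀ i, closeFun κ M S h (m + 1) i y = ⟪h, (S ^ m) (openVec M S h i y)⟫_ℂ := by
    intro i
    cases i with
    | zero => rw [closeFun, openVec, hκ]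
    | succ i =>
      rw [closeFun, openVec_succ, pow_succ]
      rfl
  simp only [h1]
  rw [closeFun, treeVec, map_sum, inner_sum]
  simp only [map_smul, inner_smul_right]

theorem exists_closeFun_le (κ : ℕ → ℂ) {M : ℕ → Ω → ℂ} (hM : ∀ n, ∃ K : ℝ, ∀ y, ‖M n y‖ ≤ K)
    (S : H →L[ℂ] H) (h : H) (m b : ℕ) : ∃ K : ℝ, ∀ y, ‖closeFun κ M S h m b y‖ ≤ K := by
  cases b with
  | zero => exact ⟨‖κ (m + 1)‖, fun y => by rw [closeFun]⟩
  | succ b =>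
    obtain ⟨K, hK⟩ := exists_treeVec_le hM S h b
    refine ⟨‖h‖ * (‖S ^ m‖ * K), fun y => ?_⟩
    rw [closeFun]
    exact (norm_inner_le_norm _ _).trans (mul_le_mul_of_nonneg_left
      ((S ^ m).le_opNorm_of_le (hK y)) (norm_nonneg _))

variable [MeasurableSpace Ω]

theorem stronglyMeasurable_openVec {M : ℕ → Ω → ℂ} (hM : ∀ n, Measurable (M n)) (S : H →L[ℂ] H)
    (h : H) (b : ℕ) : StronglyMeasurable (openVec M S h b) := by
  induction b using Nat.strong_induction_on with
  | h b ih =>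
    cases b with
    | zero =>
      have h0 : openVec M S h 0 = fun _ => h := funext fun y => by rw [openVec]
      rw [h0]
      exact stronglyMeasurable_const
    | succ b =>
      have h0 : openVec M S h (b + 1) = fun y => S (∑ i : Fin (b + 1), M (b - i) y •
          openVec M S h i y) := funext fun y => by rw [openVec]
      rw [h0]
      refine S.continuous.comp_stronglyMeasurable (Finset.stronglyMeasurable_fun_sum _ fun i _ => ?_)
      exact (hM _).stronglyMeasurable.smul (ih i i.2)

theorem stronglyMeasurable_treeVec {M : ℕ → Ω → ℂ} (hM : ∀ n, Measurable (M n)) (S : H →L[ℂ] H)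
    (h : H) (n : ℕ) : StronglyMeasurable (treeVec M S h n) :=
  Finset.stronglyMeasurable_fun_sum _ fun _ _ =>
    (hM _).stronglyMeasurable.smul (stronglyMeasurable_openVec hM S h _)

theorem measurable_closeFun (κ : ℕ → ℂ) {M : ℕ → Ω → ℂ} (hM : ∀ n, Measurable (M n))
    (S : H →L[ℂ] H) (h : H) (m b : ℕ) : Measurable (closeFun κ M S h m b) := by
  cases b with
  | zero =>
    exact measurable_const
  | succ b =>
    exact (stronglyMeasurable_const.inner ((S ^ m).continuous.comp_stronglyMeasurable
      (stronglyMeasurable_treeVec hM S h b))).measurable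

variable {μ : Measure Ω} [IsFiniteMeasure μ] {w : Ω × Ω → ℝ≥0∞} {C : ℝ≥0} {κ : ℕ → ℂ} {S : H →L[ℂ] H} {h : H}

theorem treeSum_succ_eq_sum_closeFun (hwm : Measurable w) (hw : ∀ p, w p ≤ C)
    (hκ : ∀ r, κ (r + 2) = ⟪h, (S ^ r) h⟫_ℂ) (n : ℕ) {φ : Ω → ℝ≥0∞} (hφ : Measurable φ) {D : ℝ≥0}
    (hφD : ∀ y, φ y ≤ D) : treeSum μ w κ 0 (n + 1) φ 1 = ∑ p ∈ antidiagonal n,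
      (∫ y, ((φ y).toReal : ℂ) * closeFun κ (treeFun μ w κ) S h 0 p.1 y ∂μ) *
        treeSum μ w κ 0 p.2 φ 1 := by
  have := treeSum_succ_eq_sum (μ := μ) hwm hw κ (F := closeFun κ (treeFun μ w κ) S h)
    (measurable_closeFun κ (measurable_treeFun hwm κ) S h)
    (exists_closeFun_le κ (exists_treeFun_le hw κ) S h) (fun m y => rfl) (closeFun_succ hκ _) n 0 hφ
    (g := 1) measurable_const hφD (E := 1) fun y => le_rfl
  simpa only [Pi.one_apply, mul_one] using this

/-- The case φ = w(x, ·), which supplies the relation between M and E assumed in `treeVec_succ`. -/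
theorem treeFun_succ (hwm : Measurable w) (hw : ∀ p, w p ≤ C)
    (hκ : ∀ r, κ (r + 2) = ⟪h, (S ^ r) h⟫_ℂ) (n : ℕ) (x : Ω) :
    treeFun μ w κ (n + 1) x = ∑ p ∈ antidiagonal n,
      (∫ y, ((w (x, y)).toReal : ℂ) * closeFun κ (treeFun μ w κ) S h 0 p.1 y ∂μ) *
        treeFun μ w κ p.2 x :=
  treeSum_succ_eq_sum_closeFun hwm hw hκ n (hwm.comp measurable_prodMk_left) fun _ => hw _

end TreeVec

/-! ### Powers of the field operator on the vacuum -/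

section FieldOperatorPowers

open Finset

universe u

variable {Ω : Type*} [MeasurableSpace Ω] {ρ : Measure Ω} [SigmaFinite ρ]
  {H : Type u} [NormedAddCommGroup H] [InnerProductSpace ℂ H] [CompleteSpace H]

/-- The decomposition of the vectors `X̂ⁿ ξ` according to their leftmost tensor factor. -/
theorem fieldOperator_pow_succ_vacuum {w : Lp ℝ ∞ (ρ.prod ρ)} (hw : 0 ≤ w) {A : Set Ω}
    (hA : MeasurableSet A) (hAρ : ρ A ≠ ∞) {α : ℂ} {h : H} {S : H →L[ℂ] H}
    {t s : ℕ → Lp H 2 ρ} {e : ℕ → ℕ → Lp H 2 ρ} {φ : ℕ → Lp ℂ 1 ρ} {m : ℕ → ℂ}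
    (ht0 : t 0 = indicatorConstLp 2 hA hAρ h)
    (ht : ∀ n, t (n + 1) = s n + ∑ p ∈ antidiagonal n, e p.1 p.2)
    (hs : ∀ b, ∀ᵐ x ∂ρ, s b x = (indicatorField ρ hA S).toFun x (t b x))
    (he : ∀ b c, ∀ᵐ x ∂ρ, e b c x = weightedIntegral w (φ b) x • t c x)
    (hφ0 : α • scalarMul w H (indicatorConstLp 1 hA hAρ (1 : ℂ)) = scalarMul w H (φ 0))
    (hφ : ∀ b, ∀ᵐ x ∂ρ, φ (b + 1) x = ⟪(indicatorConstLp 2 hA hAρ h : Lp H 2 ρ) x, t b x⟫_ℂ)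
    (hm0 : m 0 = 1) (hm : ∀ n, m (n + 1) = ∑ p ∈ antidiagonal n, (∫ y, φ p.1 y ∂ρ) * m p.2)
    (n : ℕ) :
    (fieldOperator w hA hAρ α h S ^ (n + 1)) (vacuum w H) = m (n + 1) • vacuum w H +
      ∑ p ∈ antidiagonal n, creation w (t p.1)
        ((fieldOperator w hA hAρ α h S ^ p.2) (vacuum w H)) := by
  set X := fieldOperator w hA hAρ α h S with hX
  have hV0 : (X ^ 0) (vacuum w H) = vacuum w H := by rw [pow_zero, one_apply_eq_self]
  have hVs : ∀ n, (X ^ (n + 1)) (vacuum w H) = X ((X ^ n) (vacuum w H)) := fun n => by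
    rw [pow_succ', mul_apply_eq_comp]
  have hXv : ∀ v, X v = scalarMul w H (φ 0) v + creation w (t 0) v +
      ContinuousLinearMap.adjoint (creation w (t 0)) v +
        operatorMul w (indicatorField ρ hA S) v := fun v => by
    rw [hX, fieldOperator, hφ0, ← ht0, _root_.add_apply, _root_.add_apply, _root_.add_apply]
  rw [← ht0] at hφ
  induction n using Nat.strong_induction_on with
  | h n ih =>
    -- One application of X̂ to the decomposition of X̂^n ξ_F. The term with φ 0 comes from α
    -- 𝔫(1_A), those with φ (p + 1) from annihilation of t p; for n = 0 the operator 𝔪 contributes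
    -- nothing.
    have key : (X ^ (n + 1)) (vacuum w H) = creation w (t 0) ((X ^ n) (vacuum w H)) +
        (∑ p ∈ antidiagonal n, scalarMul w H (φ p.1) ((X ^ p.2) (vacuum w H)) +
          if n = 0 then 0 else ∑ p ∈ antidiagonal (n - 1),
            creation w (s p.1) ((X ^ p.2) (vacuum w H))) := by
      cases n with
      | zero =>
        rw [hVs, hXv, hV0, adjoint_creation_vacuum, operatorMul_vacuum, if_pos rfl,
          Finset.Nat.antidiagonal_zero, sum_singleton, hV0]
        abel
      | succ n =>
        rw [hVs, hXv, Finset.Nat.sum_antidiagonal_succ, if_neg (Nat.succ_ne_zero n),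
          Nat.add_sub_cancel]
        have h1 : ContinuousLinearMap.adjoint (creation w (t 0)) ((X ^ (n + 1)) (vacuum w H)) =
            ∑ p ∈ antidiagonal n, scalarMul w H (φ (p.1 + 1)) ((X ^ p.2) (vacuum w H)) := by
          rw [ih n n.lt_succ_self, map_add, map_smul, adjoint_creation_vacuum, smul_zero, zero_add,
            map_sum]
          exact sum_congr rfl fun p _ => adjoint_creation_creation hw _ _ _ (hφ p.1) _
        have h2 : operatorMul w (indicatorField ρ hA S) ((X ^ (n + 1)) (vacuum w H)) =
            ∑ p ∈ antidiagonal n, creation w (s p.1) ((X ^ p.2) (vacuum w H)) := by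
          rw [ih n n.lt_succ_self, map_add, map_smul, operatorMul_vacuum, smul_zero, zero_add,
            map_sum]
          exact sum_congr rfl fun p _ => operatorMul_creation w _ (hs p.1) _
        rw [h1, h2]
        abel
    rw [key]
    cases n with
    | zero =>
      rw [if_pos rfl, Finset.Nat.antidiagonal_zero, sum_singleton, sum_singleton, hm,
        Finset.Nat.antidiagonal_zero, sum_singleton, hm0, hV0, scalarMul_vacuum, mul_one]
      abel
    | succ n =>
      -- The induction hypothesis is used a second time, on the powers below 𝔫(φ): their vacuum
      -- parts add up to m, and their creation parts absorb 𝔫(φ) into e.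
      have h1 : ∀ p ∈ antidiagonal n, scalarMul w H (φ p.1) ((X ^ (p.2 + 1)) (vacuum w H)) =
          ((∫ y, φ p.1 y ∂ρ) * m (p.2 + 1)) • vacuum w H +
            ∑ q ∈ antidiagonal p.2, creation w (e p.1 q.1) ((X ^ q.2) (vacuum w H)) := by
        intro p hp
        have hpn : p.2 < n + 1 := by
          have := HasAntidiagonal.mem_antidiagonal.1 hp
          omega
        rw [ih p.2 hpn, map_add, map_smul, scalarMul_vacuum, smul_smul, mul_comm, map_sum]
        congr 1
        exact sum_congr rfl fun q _ => scalarMul_creation w _ (he p.1 q.1) _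
      have h2 : ∀ p ∈ antidiagonal n, creation w (t (p.1 + 1)) ((X ^ p.2) (vacuum w H)) =
          creation w (s p.1) ((X ^ p.2) (vacuum w H)) +
            ∑ q ∈ antidiagonal p.1, creation w (e q.1 q.2) ((X ^ p.2) (vacuum w H)) := by
        intro p _
        rw [ht, ← creationLinear_apply, map_add, map_sum, _root_.add_apply,
          _root_.sum_apply]
        rfl
      have h3 : ∑ p ∈ antidiagonal n, ∑ q ∈ antidiagonal p.2,
          creation w (e p.1 q.1) ((X ^ q.2) (vacuum w H)) =
          ∑ p ∈ antidiagonal n, ∑ q ∈ antidiagonal p.1,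
            creation w (e q.1 q.2) ((X ^ p.2) (vacuum w H)) := by
        rw [← sum_antidiagonal_fst_comm
          (fun a b c => creation w (e a b) ((X ^ c) (vacuum w H))),
          ← Finset.Nat.sum_antidiagonal_swap]
        rfl
      rw [Finset.Nat.sum_antidiagonal_succ', sum_congr rfl h1, sum_add_distrib, h3,
        Finset.Nat.sum_antidiagonal_succ, sum_congr rfl h2, sum_add_distrib, hm,
        Finset.Nat.sum_antidiagonal_succ', add_smul, sum_smul, if_neg (Nat.succ_ne_zero n),
        Nat.add_sub_cancel, hV0, hm0, scalarMul_vacuum, mul_one]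
      abel

omit [CompleteSpace H] in
theorem inner_vacuum_fieldOperator_pow {w : Lp ℝ ∞ (ρ.prod ρ)} {X : Fock w H →L[ℂ] Fock w H}
    {t : ℕ → Lp H 2 ρ} {c : ℂ} {n : ℕ} (hX : (X ^ (n + 1)) (vacuum w H) = c • vacuum w H +
      ∑ p ∈ antidiagonal n, creation w (t p.1) ((X ^ p.2) (vacuum w H))) :
    ⟪vacuum w H, (X ^ (n + 1)) (vacuum w H)⟫_ℂ = c := by
  rw [hX, inner_add_right, inner_smul_right, inner_vacuum_self, mul_one, inner_sum,
    sum_eq_zero fun p _ => inner_vacuum_creation _ _ _, add_zero]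

end FieldOperatorPowers

/-! ### Vacuum moments as sums over trees -/

section VacuumMoments

open Finset

universe u

variable {Ω : Type*} [MeasurableSpace Ω] {ρ : Measure Ω}

theorem memLp_indicator_of_bound {E : Type*} [NormedAddCommGroup E] {A : Set Ω}
    (hA : MeasurableSet A) (hAρ : ρ A ≠ ∞) {f : Ω → E} (hf : StronglyMeasurable f) {K : ℝ}
    (hK : ∀ y, ‖f y‖ ≤ K) (p : ℝ≥0∞) : MemLp (A.indicator f) p ρ := by
  have : IsFiniteMeasure (ρ.restrict A) := ⟨by rwa [Measure.restrict_apply_univ, lt_top_iff_ne_top]⟩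
  rw [memLp_indicator_iff_restrict hA]
  exact MemLp.of_bound hf.aestronglyMeasurable K (Filter.Eventually.of_forall hK)

variable [SigmaFinite ρ] {H : Type u} [NormedAddCommGroup H] [InnerProductSpace ℂ H]

omit [SigmaFinite ρ] in
theorem weightedIntegral_smul (w : Lp ℝ ∞ (ρ.prod ρ)) (c : ℂ) (φ : Lp ℂ 1 ρ) (x : Ω) :
    weightedIntegral w (c • φ) x = c * weightedIntegral w φ x := by
  rw [weightedIntegral, weightedIntegral, ← integral_const_mul]
  refine integral_congr_ae ((Lp.coeFn_smul c φ).mono fun y hy => ?_)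
  simp only [hy, Pi.smul_apply, smul_eq_mul, mul_assoc]

theorem scalarMul_smul (w : Lp ℝ ∞ (ρ.prod ρ)) (c : ℂ) (φ : Lp ℂ 1 ρ) :
    scalarMul w H (c • φ) = c • scalarMul w H φ := by
  ext1 v
  refine lp.ext (funext fun k => ?_)
  rw [_root_.smul_apply, lp.coeFn_smul, Pi.smul_apply, scalarMul_apply, scalarMul_apply]
  cases k with
  | zero =>
    rw [scalarMulComponent, scalarMulComponent, _root_.smul_apply, _root_.smul_apply, smul_smul,
      ← integral_const_mul]
    congr 1
    exact integral_congr_ae (Lp.coeFn_smul c φ)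
  | succ k =>
    refine Lp.ext ?_
    filter_upwards [coeFn_scalarMulComponent w (c • φ) k (v (k + 1)),
      coeFn_scalarMulComponent w φ k (v (k + 1)),
      Lp.coeFn_smul c (scalarMulComponent w H φ (k + 1) (v (k + 1)))] with ω h1 h2 h3
    rw [h1, h3, Pi.smul_apply, h2, weightedIntegral_smul, mul_smul]

variable [CompleteSpace H]

/-- The sequences in `fieldOperator_pow_succ_vacuum` are realised by combinatorial functions
supported on A: t by `treeVec`, φ by `closeFun`, e by E times `treeVec`, and m by `treeSum`. Their
recursions are those of the preceding sections. -/
theorem inner_vacuum_fieldOperator_pow_eq_treeSum {w : Lp ℝ ∞ (ρ.prod ρ)} (hw : 0 ≤ w) {A : Set Ω}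
    (hA : MeasurableSet A) (hAρ : ρ A ≠ ∞) {w' : Ω × Ω → ℝ≥0∞} (hw'm : Measurable w') {C : ℝ≥0}
    (hw'C : ∀ p, w' p ≤ C) (hww' : ∀ᵐ p ∂ρ.prod ρ, w p = (w' p).toReal) {κ : ℕ → ℂ} {h : H}
    {S : H →L[ℂ] H} (hκ : ∀ r, κ (r + 2) = ⟪h, (S ^ r) h⟫_ℂ) (n : ℕ) :
    ⟪vacuum w H, (fieldOperator w hA hAρ (κ 1) h S ^ n) (vacuum w H)⟫_ℂ =
      treeSum (ρ.restrict A) w' κ 0 n 1 1 := by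
  cases n with
  | zero => rw [pow_zero, one_apply_eq_self, inner_vacuum_self, treeSum_zero]
  | succ n =>
  have : IsFiniteMeasure (ρ.restrict A) := ⟨by rwa [Measure.restrict_apply_univ, lt_top_iff_ne_top]⟩
  have hMm := measurable_treeFun (μ := ρ.restrict A) hw'm κ
  have hMb := exists_treeFun_le (μ := ρ.restrict A) hw'C κ
  have hM0 : ∀ y, treeFun (ρ.restrict A) w' κ 0 y = 1 := treeFun_zero κ
  have hMs := treeFun_succ (μ := ρ.restrict A) hw'm hw'C hκ
  have hms := fun n => treeSum_succ_eq_sum_closeFun (μ := ρ.restrict A) hw'm hw'C hκ n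
    (φ := 1) measurable_const (D := 1) fun y => le_rfl
  -- From here on M is used only through its recursion, its measurability and its bounds.
  generalize hMdef : treeFun (ρ.restrict A) w' κ = M at *
  have hTm := stronglyMeasurable_treeVec hMm S h
  have hTb := exists_treeVec_le hMb S h
  have hFm := measurable_closeFun κ hMm S h 0
  have hFb := exists_closeFun_le κ hMb S h 0
  set E : ℕ → Ω → ℂ := fun b x => ∫ y, ((w' (x, y)).toReal : ℂ) * closeFun κ M S h 0 b y
    ∂ρ.restrict A with hE
  have hEm : ∀ b, StronglyMeasurable (E b) := fun b =>
    StronglyMeasurable.integral_prod_right (f := fun x y => ((w' (x, y)).toReal : ℂ) *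
      closeFun κ M S h 0 b y) ((Complex.measurable_ofReal.comp hw'm.ennreal_toReal).mul
        ((hFm b).comp measurable_snd)).stronglyMeasurable
  choose KT hKT using hTb
  choose KF hKF using hFb
  have hEb : ∀ b x, ‖E b x‖ ≤ C * KF b * (ρ.restrict A).real Set.univ := fun b x =>
    norm_integral_le_of_norm_le_const (Filter.Eventually.of_forall fun y => by
      rw [norm_mul, Complex.norm_real, Real.norm_of_nonneg ENNReal.toReal_nonneg]
      exact mul_le_mul (ENNReal.toReal_le_coe_of_le_coe (hw'C _)) (hKF b y) (norm_nonneg _) C.2)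
  have htL := fun b => memLp_indicator_of_bound hA hAρ (hTm b) (hKT b) 2
  have hsL := fun b => memLp_indicator_of_bound hA hAρ
    (S.continuous.comp_stronglyMeasurable (hTm b)) (fun y => S.le_opNorm_of_le (hKT b y)) 2
  have heL := fun b c => memLp_indicator_of_bound hA hAρ ((hEm b).smul (hTm c))
    (K := C * KF b * (ρ.restrict A).real Set.univ * KT c) (fun y => by
      rw [Pi.smul_apply', norm_smul]
      exact mul_le_mul (hEb b y) (hKT c y) (norm_nonneg _) ((norm_nonneg _).trans (hEb b y))) 2
  have hφL := fun b => memLp_indicator_of_bound hA hAρ (hFm b).stronglyMeasurable (hKF b) 1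
  obtain ⟨t, ht⟩ : ∃ t : ℕ → Lp H 2 ρ, ∀ b, t b =ᵐ[ρ] A.indicator (treeVec M S h b) :=
    ⟨fun b => (htL b).toLp _, fun b => (htL b).coeFn_toLp⟩
  obtain ⟨s, hs⟩ : ∃ s : ℕ → Lp H 2 ρ, ∀ b, s b =ᵐ[ρ] A.indicator (S ∘ treeVec M S h b) :=
    ⟨fun b => (hsL b).toLp _, fun b => (hsL b).coeFn_toLp⟩
  obtain ⟨e, he⟩ : ∃ e : ℕ → ℕ → Lp H 2 ρ, ∀ b c, e b c =ᵐ[ρ]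
      A.indicator (E b • treeVec M S h c) :=
    ⟨fun b c => (heL b c).toLp _, fun b c => (heL b c).coeFn_toLp⟩
  obtain ⟨φ, hφ⟩ : ∃ φ : ℕ → Lp ℂ 1 ρ, ∀ b, φ b =ᵐ[ρ] A.indicator (closeFun κ M S h 0 b) :=
    ⟨fun b => (hφL b).toLp _, fun b => (hφL b).coeFn_toLp⟩
  have main := fieldOperator_pow_succ_vacuum hw hA hAρ (α := κ 1) (h := h) (S := S) (t := t)
    (s := s) (e := e) (φ := φ) (m := fun n => treeSum (ρ.restrict A) w' κ 0 n 1 1)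
    ?_ ?_ ?_ ?_ ?_ ?_ (treeSum_zero κ 0 _ _) ?_ n
  · exact inner_vacuum_fieldOperator_pow main
  · refine Lp.ext ?_
    filter_upwards [ht 0, indicatorConstLp_coeFn (p := 2) (hs := hA) (hμs := hAρ) (c := h)]
      with x h1 h2
    rw [h1, h2]
    simp only [Set.indicator, treeVec_zero hM0]
  · intro n
    refine Lp.ext ?_
    filter_upwards [ht (n + 1), hs n, Lp.coeFn_add (s n) (∑ p ∈ antidiagonal n, e p.1 p.2),
      Lp.coeFn_finsetSum (antidiagonal n) fun p => e p.1 p.2,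
      ae_all_iff.2 fun b => ae_all_iff.2 (he b)] with x h1 h2 h3 h4 h5
    rw [h1, h3, Pi.add_apply, h2, h4, Finset.sum_apply]
    simp only [h5]
    by_cases hx : x ∈ A
    · simp only [Set.indicator_of_mem hx]
      exact treeVec_succ (E := E) hM0 hMs S h n x
    · simp only [Set.indicator_of_notMem hx, sum_const_zero, add_zero]
  · intro b
    filter_upwards [hs b, ht b] with x h1 h2
    rw [h1, h2, indicatorField]
    by_cases hx : x ∈ A
    · simp only [Set.indicator_of_mem hx, Function.comp_apply]
    · simp only [Set.indicator_of_notMem hx, map_zero]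
  · intro b c
    filter_upwards [he b c, ht c,
      Measure.ae_ae_of_ae_prod hww'] with x h1 h2 h3
    -- Valid for those x for which w(x, ·) and w'(x, ·) agree almost everywhere.
    have h4 : weightedIntegral w (φ b) x = E b x := by
      rw [weightedIntegral, hE]
      simp only
      rw [← integral_indicator hA]
      refine integral_congr_ae ?_
      filter_upwards [h3, hφ b] with y h5 h6
      rw [h5, h6]
      by_cases hy : y ∈ A
      · simp only [Set.indicator_of_mem hy, mul_comm]
      · simp only [Set.indicator_of_notMem hy, zero_mul]
    rw [h1, h2, h4]
    by_cases hx : x ∈ A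
    · simp only [Set.indicator_of_mem hx, Pi.smul_apply']
    · simp only [Set.indicator_of_notMem hx, smul_zero]
  -- At b = 0 `closeFun` is the constant κ 1, which is the scalar α of the field operator.
  · rw [← scalarMul_smul]
    congr 1
    refine Lp.ext ?_
    filter_upwards [hφ 0, Lp.coeFn_smul (κ 1) (indicatorConstLp 1 hA hAρ (1 : ℂ)),
      indicatorConstLp_coeFn (p := 1) (hs := hA) (hμs := hAρ) (c := (1 : ℂ))] with x h1 h2 h3
    rw [h1, h2, Pi.smul_apply, h3]
    by_cases hx : x ∈ A
    · simp [hx, closeFun]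
    · simp [hx]
  · intro b
    filter_upwards [hφ (b + 1), ht b,
      indicatorConstLp_coeFn (p := 2) (hs := hA) (hμs := hAρ) (c := h)] with x h1 h2 h3
    rw [h1, h2, h3]
    by_cases hx : x ∈ A
    · simp only [Set.indicator_of_mem hx, closeFun, pow_zero, one_apply_eq_self]
    · simp only [Set.indicator_of_notMem hx, inner_zero_left]
  · intro n
    rw [hms]
    refine sum_congr rfl fun p _ => ?_
    congr 1
    rw [integral_congr_ae (hφ p.1), integral_indicator hA]
    simp

end VacuumMoments

/-! ### Boolean cumulants of an operator in block form -/

section BlockOperators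

open Finset

theorem blockProd_map {R R' : Type*} [CommMonoid R] [CommMonoid R'] (f : R →* R') (s : ℕ → R)
    (t : BinaryTree Unit) (m : ℕ) : blockProd (fun n => f (s n)) t m = f (blockProd s t m) := by
  induction t generalizing m with
  | nil => exact (map_one f).symm
  | node u l r ihl ihr =>
    rw [blockProd, blockProd, map_mul, ihl, ihr]
    split_ifs <;> rfl

variable {H : Type*} [NormedAddCommGroup H] [InnerProductSpace ℂ H]

theorem ofReal_re_inner_of_isSelfAdjoint [CompleteSpace H] {T : H →L[ℂ] H} (hT : IsSelfAdjoint T)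
    (x : H) : ((⟪x, T x⟫_ℂ).re : ℂ) = ⟪x, T x⟫_ℂ :=
  Complex.conj_eq_iff_re.1 (by
    rw [inner_conj_symm]
    exact (ContinuousLinearMap.isSelfAdjoint_iff_isSymmetric.1 hT) x x)

/-- The boolean cumulants of the operator with the block decomposition `α`, `h`, `S`. -/
noncomputable def blockCumulant (α : ℂ) (h : H) (S : H →L[ℂ] H) : ℕ → ℂ
  | 0 => 0
  | 1 => α
  | r + 2 => ⟪h, (S ^ r) h⟫_ℂ

theorem ofReal_re_blockCumulant [CompleteSpace H] {α : ℂ} (hα : (starRingEnd ℂ) α = α) (h : H)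
    {S : H →L[ℂ] H} (hS : IsSelfAdjoint S) (n : ℕ) :
    ((blockCumulant α h S n).re : ℂ) = blockCumulant α h S n := by
  match n with
  | 0 => rfl
  | 1 => exact Complex.conj_eq_iff_re.1 hα
  | r + 2 => exact ofReal_re_inner_of_isSelfAdjoint (hS.pow r) h

variable {ξ : H} {X : H →L[ℂ] H} {α : ℂ} {h : (ℂ ∙ ξ)ᗮ} {S : (ℂ ∙ ξ)ᗮ →L[ℂ] (ℂ ∙ ξ)ᗮ}

theorem inner_coe_orthogonal (v : (ℂ ∙ ξ)ᗮ) : ⟪ξ, (v : H)⟫_ℂ = 0 :=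
  Submodule.mem_orthogonal_singleton_iff_inner_right.1 v.2

/-- Write X^n ξ = a_n ξ + v_n with v_n orthogonal to ξ. Then a_{n+1} = α a_n + ⟨h, v_n⟩ and v_{n+1}
= a_n h + S v_n, so v_{n+1} is the sum of the a_c S^b h over b + c = n. -/
theorem inner_pow_succ_of_block (hξ : ‖ξ‖ = 1)
    (hblock : ∀ (c : ℂ) (v : (ℂ ∙ ξ)ᗮ),
      X (c • ξ + (v : H)) = (α * c + ⟪h, v⟫_ℂ) • ξ + ((c • h + S v : (ℂ ∙ ξ)ᗮ) : H)) (n : ℕ) :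
    ⟪ξ, (X ^ (n + 1)) ξ⟫_ℂ =
      ∑ p ∈ antidiagonal n, blockCumulant α h S (p.1 + 1) * ⟪ξ, (X ^ p.2) ξ⟫_ℂ := by
  have hξξ : ⟪ξ, ξ⟫_ℂ = 1 := by rw [inner_self_eq_norm_sq_to_K, hξ]; simp
  have hin : ∀ (c : ℂ) (v : (ℂ ∙ ξ)ᗮ), ⟪ξ, c • ξ + (v : H)⟫_ℂ = c := fun c v => by
    rw [inner_add_right, inner_smul_right, hξξ, inner_coe_orthogonal, mul_one, add_zero]
  have hXs : ∀ n, (X ^ (n + 1)) ξ = X ((X ^ n) ξ) := fun n => by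
    rw [pow_succ', mul_apply_eq_comp]
  set a : ℕ → ℂ := fun n => ⟪ξ, (X ^ n) ξ⟫_ℂ with ha
  have ha0 : a 0 = 1 := by rw [ha]; simp only [pow_zero, one_apply_eq_self, hξξ]
  -- The second clause describes v_{n+1} rather than v_n, so that the formula needs no separate case
  -- n = 0.
  have key : ∀ n, ∃ v : (ℂ ∙ ξ)ᗮ, (X ^ n) ξ = a n • ξ + (v : H) ∧
      a n • h + S v = ∑ p ∈ antidiagonal n, a p.2 • (S ^ p.1) h ∧
      α * a n + ⟪h, v⟫_ℂ = ∑ p ∈ antidiagonal n, blockCumulant α h S (p.1 + 1) * a p.2 := by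
    intro n
    induction n with
    | zero =>
      refine ⟨0, ?_, ?_, ?_⟩
      · rw [ha0, pow_zero, one_apply_eq_self, one_smul, ZeroMemClass.coe_zero, add_zero]
      · simp
      · simp [blockCumulant]
    | succ n ih =>
      obtain ⟨v, h1, h2, -⟩ := ih
      have h4 : (X ^ (n + 1)) ξ = (α * a n + ⟪h, v⟫_ℂ) • ξ + ((a n • h + S v : (ℂ ∙ ξ)ᗮ) : H) := by
        rw [hXs, h1, hblock]
      have h5 : a (n + 1) = α * a n + ⟪h, v⟫_ℂ := by
        rw [ha]
        simp only
        rw [h4, hin]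
      refine ⟨a n • h + S v, by rw [h4, h5], ?_, ?_⟩
      · rw [h2, Finset.Nat.sum_antidiagonal_succ, map_sum, pow_zero, one_apply_eq_self]
        simp only [map_smul, pow_succ', mul_apply_eq_comp]
      · rw [h2, Finset.Nat.sum_antidiagonal_succ, inner_sum]
        simp only [inner_smul_right, blockCumulant, mul_comm]
  obtain ⟨v, h1, -, h3⟩ := key n
  rw [← h3, hXs, h1, hblock, hin]

theorem conj_eq_of_block [CompleteSpace H] (hξ : ‖ξ‖ = 1) (hX : IsSelfAdjoint X)
    (hblock : ∀ (c : ℂ) (v : (ℂ ∙ ξ)ᗮ),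
      X (c • ξ + (v : H)) = (α * c + ⟪h, v⟫_ℂ) • ξ + ((c • h + S v : (ℂ ∙ ξ)ᗮ) : H)) :
    (starRingEnd ℂ) α = α := by
  have h1 := inner_pow_succ_of_block hξ hblock 0
  have hξξ : ⟪ξ, ξ⟫_ℂ = 1 := by rw [inner_self_eq_norm_sq_to_K, hξ]; simp
  rw [Finset.Nat.antidiagonal_zero, sum_singleton, zero_add, pow_one, pow_zero, one_apply_eq_self,
    hξξ, mul_one] at h1
  change ⟪ξ, X ξ⟫_ℂ = α at h1
  rw [← h1]
  exact Complex.conj_eq_iff_re.2 (ofReal_re_inner_of_isSelfAdjoint hX ξ)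

theorem isSelfAdjoint_of_block [CompleteSpace H] (hX : IsSelfAdjoint X)
    (hblock : ∀ (c : ℂ) (v : (ℂ ∙ ξ)ᗮ),
      X (c • ξ + (v : H)) = (α * c + ⟪h, v⟫_ℂ) • ξ + ((c • h + S v : (ℂ ∙ ξ)ᗮ) : H)) :
    IsSelfAdjoint S := by
  have h1 : ∀ u v : (ℂ ∙ ξ)ᗮ, ⟪(u : H), X v⟫_ℂ = ⟪u, S v⟫_ℂ := fun u v => by
    have h2 := hblock 0 v
    rw [zero_smul, zero_add, zero_smul, zero_add] at h2
    rw [h2, inner_add_right, inner_smul_right, ← inner_conj_symm (u : H) ξ, inner_coe_orthogonal, map_zero,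
      mul_zero, zero_add, Submodule.coe_inner]
  refine ContinuousLinearMap.isSelfAdjoint_iff_isSymmetric.2 fun u v => ?_
  have h3 := (ContinuousLinearMap.isSelfAdjoint_iff_isSymmetric.1 hX) u v
  simp only [ContinuousLinearMap.coe_coe] at h3 ⊢
  rw [← h1, ← h3, ← inner_conj_symm, ← h1, inner_conj_symm]

/-- The numbers `blockCumulant` are real because α and S are self-adjoint, so the recursion for the
moments of X can be read over ℝ, where it determines the boolean cumulants. -/
theorem ofReal_booleanCumulant_of_block [CompleteSpace H] (hξ : ‖ξ‖ = 1) (hX : IsSelfAdjoint X)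
    (hblock : ∀ (c : ℂ) (v : (ℂ ∙ ξ)ᗮ),
      X (c • ξ + (v : H)) = (α * c + ⟪h, v⟫_ℂ) • ξ + ((c • h + S v : (ℂ ∙ ξ)ᗮ) : H)) (n : ℕ) :
    (booleanCumulant (spectralDistribution X ξ) (n + 1) : ℂ) = blockCumulant α h S (n + 1) := by
  have hre := ofReal_re_blockCumulant (conj_eq_of_block hξ hX hblock) h
    (isSelfAdjoint_of_block hX hblock)
  rw [← hre]
  congr 1
  refine booleanCumulant_eq_of_recursion _ (fun n => (blockCumulant α h S n).re) ?_ (fun n => ?_) n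
  · rw [(moment_spectralDistribution X hX ξ 0).2, pow_zero, one_apply_eq_self,
      inner_self_eq_norm_sq_to_K, hξ]
    simp
  · have hm : ∀ k, (moment (spectralDistribution X ξ) k : ℂ) = ⟪ξ, (X ^ k) ξ⟫_ℂ := fun k => by
      rw [(moment_spectralDistribution X hX ξ k).2]
      exact ofReal_re_inner_of_isSelfAdjoint (hX.pow k) ξ
    rw [← Complex.ofReal_inj, hm, inner_pow_succ_of_block hξ hblock, Complex.ofReal_sum]
    refine sum_congr rfl fun p _ => ?_
    rw [Complex.ofReal_mul, hre, hm]

end BlockOperators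

end FockModel
-- The moment formula
theorem mainTheorem10
    {H : Type*} [NormedAddCommGroup H] [InnerProductSpace ℂ H] [CompleteSpace H]
    (ξ : H) (hξ : ‖ξ‖ = 1) (X : H →L[ℂ] H) (hX : IsSelfAdjoint X)
    (α : ℂ) (h : (ℂ ∙ ξ)ᗮ) (S : (ℂ ∙ ξ)ᗮ →L[ℂ] (ℂ ∙ ξ)ᗮ)
    (hblock : ∀ (c : ℂ) (v : (ℂ ∙ ξ)ᗮ),
      X (c • ξ + (v : H)) = (α * c + ⟪h, v⟫_ℂ) • ξ + ((c • h + S v : (ℂ ∙ ξ)ᗮ) : H))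
    {Ω : Type*} [MeasurableSpace Ω] (ρ : Measure Ω) [SigmaFinite ρ]
    (w : Lp ℝ ∞ (ρ.prod ρ)) (hw : 0 ≤ w)
    (A : Set Ω) (hA : MeasurableSet A) (hAρ : ρ A ≠ ∞) :
    IsSelfAdjoint (fieldOperator w hA hAρ α h S) ∧
    ∀ k : ℕ,
      Integrable (fun x : ℝ => x ^ k)
        (spectralDistribution (fieldOperator w hA hAρ α h S) (vacuum w (ℂ ∙ ξ)ᗮ)) ∧
      (∀ π ∈ noncrossingPartitions k,
        IntegrableOn (nestingWeight w π) (Set.univ.pi fun _ => A) (Measure.pi fun _ => ρ)) ∧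
      moment (spectralDistribution (fieldOperator w hA hAρ α h S) (vacuum w (ℂ ∙ ξ)ᗮ)) k =
        ∑ π ∈ noncrossingPartitions k,
          booleanCumulantPartition (spectralDistribution X ξ) π *
            ∫ ω in Set.univ.pi fun _ => A, nestingWeight w π ω ∂(Measure.pi fun _ => ρ) := by
  have hα := conj_eq_of_block hξ hX hblock
  have hS := isSelfAdjoint_of_block hX hblock
  have hsa := isSelfAdjoint_fieldOperator w hA hAρ hα h hS
  -- A version of w with 0 ≤ v ≤ ‖w‖ everywhere: the tree recursions fix coordinates one by one and
  -- use pointwise bounds.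
  set v : Ω × Ω → ℝ := fun p => min (max (w p) 0) ‖w‖ with hv
  have hvm : Measurable v :=
    ((Lp.stronglyMeasurable w).measurable.max measurable_const).min measurable_const
  have hv0 : ∀ p, 0 ≤ v p := fun p => le_min (le_max_right _ _) (norm_nonneg _)
  have hvC : ∀ p, v p ≤ ‖w‖ := fun p => min_le_right _ _
  have hwv : ∀ᵐ p ∂ρ.prod ρ, w p = v p := by
    filter_upwards [weight_le w, (Lp.coeFn_nonneg w).2 hw] with p h1 h2
    simp only [Pi.zero_apply] at h2
    rw [hv]
    simp only
    rw [max_eq_left h2, min_eq_left ((le_abs_self _).trans h1)]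
  have hint := fun {n : ℕ} {t : BinaryTree Unit} (ht : t.numNodes = n) =>
    integral_nestingWeight hAρ hwv hvm hv0 hvC ht
  have hcum := ofReal_booleanCumulant_of_block hξ hX hblock
  refine ⟨hsa, fun k => ?_⟩
  obtain ⟨h1, h2⟩ := moment_spectralDistribution _ hsa (vacuum w (ℂ ∙ ξ)ᗮ) k
  refine ⟨h1, fun π hπ => ?_, ?_⟩
  · obtain ⟨t, ht, rfl⟩ := exists_fiberPartition_leaderFun_eq hπ
    exact (hint ht).1
  -- Shifted by one, `hcum` is the required identity κ_{r+2} = ⟨h, S^r h⟩; its first instance says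
  -- κ_1 = α.
  have h3 := inner_vacuum_fieldOperator_pow_eq_treeSum hw hA hAρ
    (w' := fun p => ENNReal.ofReal (v p)) hvm.ennreal_ofReal (C := ‖w‖.toNNReal)
    (fun p => ENNReal.ofReal_le_ofReal (hvC p))
    (hwv.mono fun p hp => by rw [ENNReal.toReal_ofReal (hv0 p), hp])
    (κ := fun n => (booleanCumulant (spectralDistribution X ξ) n : ℂ)) (h := h) (S := S)
    (fun r => hcum (r + 1)) k
  have h4 : (booleanCumulant (spectralDistribution X ξ) 1 : ℂ) = α := hcum 0
  rw [h4] at h3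
  rw [h2, h3, ← Complex.ofReal_inj, sum_noncrossingPartitions, treeSum]
  have h5 : ∀ t ∈ BinaryTree.treesOfNumNodesEq k,
      blockProd (fun n => (booleanCumulant (spectralDistribution X ξ) n : ℂ)) t 0 *
        ((treeIntegral (ρ.restrict A) (fun p => ENNReal.ofReal (v p)) t 1 1).toReal : ℂ) =
      ((booleanCumulantPartition (spectralDistribution X ξ) (fiberPartition (leaderFun t) k) *
        ∫ ω in Set.univ.pi fun _ => A, nestingWeight w (fiberPartition (leaderFun t) k) ω
          ∂(Measure.pi fun _ => ρ) : ℝ) : ℂ) := by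
    intro t ht
    rw [BinaryTree.mem_treesOfNumNodesEq] at ht
    rw [(hint ht).2, booleanCumulantPartition, prod_parts_eq_blockProd _ ht, Complex.ofReal_mul]
    congr 1
    exact blockProd_map (Complex.ofRealHom : ℝ →* ℂ) _ t 0
  rw [Finset.sum_congr rfl h5, ← Complex.ofReal_sum, Complex.ofReal_re]
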